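/- All Banach spaces are complex. Let $X$, $Y$, $\partial X$ and $V$ be Banach spaces with continuous embeddings $V\hookrightarrow Y\hookrightarrow X$. Let $A:D(A)\to X$ be a linear operator with $D(A)\subset Y$, and let $L:D(A)\to\partial X$ be linear and surjective. Assume that $A_0:=A|_{\ker L}$ (with domain $\{u\in D(A):Lu=0\}$) is closed, densely defined, and has nonempty resolvent set $\rho(A_0)$, and that the operator $u\mapsto(Au,Lu)$ from $D(A)\subset X$ to $X\times\partial X$ is closed. Let $B:D(A)\to\partial X$ be linear and bounded with respect to the graph norm $\|u\|_X+\|Au\|_X+\|Lu\|_{\partial X}$ on $D(A)$, and let $\tilde B:\partial X\to\partial X$ be linear and bounded. Assume that $L$ extends to a bounded operator from $Y$ to $\partial X$, again denoted by $L$, whose kernel is $V$. Set $\mathcal X:=X\times\partial X$ and $$\mathcal V:=\{(u,x)\in Y\times\partial X: Lu=x\},$$ a closed subspace of $Y\times\partial X$, and let $\mathcal A$ be the operator on $\mathcal X$ given by $$\mathcal A(u,x):=(Au,\;Bu+\tilde Bx),\qquad D(\mathcal A):=\{(u,x)\in D(A)\times\partial X: Lu=x\}.$$ For $\lambda\in\rho(A_0)$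 let $D^A_\lambda:\partial X\to\ker(\lambda-A)\subset X$ denote the Dirichlet operator, i.e. the (bounded) inverse of $L|_{\ker(\lambda-A)}$. A cosine operator function on a Banach space $E$ is a strongly continuous $C:\mathbb R\to\mathcal L(E)$ with $C(0)=I$ and $C(t+s)+C(t-s)=2C(t)C(s)$ for all $t,s\in\mathbb R$; its generator is $Kx=\lim_{t\to0}\frac{2}{t^2}(C(t)x-x)$, defined for those $x$ for which the limit exists; one writes $C(t)=C(t,K)$ and $S(t,K)x:=\int_0^tC(s,K)x\,ds$. One says that $K$ generates a cosine operator function with associated phase space $F\times E$ if $K$ is the generator of a cosine operator function on $E$ and $F$ is a Banach space with dense continuous embeddings $[D(K)]\hookrightarrow F\hookrightarrow E$ (where $[D(K)]$ is $D(K)$ with the graph norm) such that the operator matrix $\begin{pmatrix}0&I_F\\K&0\end{pmatrix}$ with domain $D(K)\times F$ generates a strongly continuous semigroup on $F\times E$. Suppose that $A_0$ generates a cosine operator function with associated phase space $V\times X$. Assume that, for some $\epsilon>0$, $$\|D^A_\lambda\|_{\mathcal L(\partial X,X)}=O(|\lambda|^{-\epsilon})\qquad\text{as }|\lambda|\to\infty,\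 \operatorname{Re}\lambda>0,$$ and that there is a constant $M>0$ such that $$\int_0^1\|B\,S(s,A_0)f\|_{\partial X}\,ds\le M\|f\|_X\qquad\text{for all }f\in D(A_0).$$ Then $\mathcal A$ generates a cosine operator function with associated phase space $\mathcal V\times\mathcal X$. -/

import Mathlib

open Filter Topology Asymptotics

noncomputable section

namespace SecondOrder

/-! ### Cosine operator functions, semigroups, phase spaces -/

section General

variable {E : Type*} [NormedAddCommGroup E] [NormedSpace ℂ E]

/-- A cosine operator function on `E`: a strongly continuous family of bounded operators indexed by
`ℝ` that satisfies d'Alembert's functional equation and is the identity at `0`. -/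
structure IsCosineFunction (C : ℝ → E →L[ℂ] E) : Prop where
  strongly_continuous : ∀ x : E, Continuous fun t : ℝ => C t x
  dAlembert : ∀ (t s : ℝ) (x : E), C (t + s) x + C (t - s) x = (2 : ℂ) • C t (C s x)
  at_zero : C 0 = ContinuousLinearMap.id ℂ E

/-- `K` is the generator of the cosine operator function `C`: its domain is the set of those `x` for
which `lim_{t → 0} (2 / t ^ 2) (C(t) x - x)` exists, and `K x` is that limit. -/
def IsCosineGenerator (C : ℝ → E →L[ℂ] E) (K : E →ₗ.[ℂ] E) : Prop :=
  ∀ x y : E, (x, y) ∈ K.graph ↔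
    Tendsto (fun t : ℝ => (2 / (t : ℂ) ^ 2) • (C t x - x)) (𝓝[≠] 0) (𝓝 y)

/-- The sine operator function `S(t) x = ∫₀ᵗ C(s) x ds`. -/
def sine (C : ℝ → E →L[ℂ] E) (t : ℝ) (x : E) : E :=
  ∫ s in (0 : ℝ)..t, C s x

/-- A strongly continuous semigroup on `E`; only the values at times `t ≥ 0` matter. -/
structure IsC0Semigroup (T : ℝ → E →L[ℂ] E) : Prop where
  at_zero : T 0 = ContinuousLinearMap.id ℂ E
  semigroup : ∀ t s : ℝ, 0 ≤ t → 0 ≤ s → ∀ x : E, T (t + s) x = T t (T s x)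
  strongly_continuous : ∀ x : E, ContinuousOn (fun t : ℝ => T t x) (Set.Ici 0)

/-- `G` is the generator of the semigroup `T`: its domain is the set of those `x` for which
`lim_{t → 0+} t⁻¹ (T(t) x - x)` exists, and `G x` is that limit. -/
def IsSemigroupGenerator (T : ℝ → E →L[ℂ] E) (G : E →ₗ.[ℂ] E) : Prop :=
  ∀ x y : E, (x, y) ∈ G.graph ↔
    Tendsto (fun t : ℝ => ((t : ℂ)⁻¹) • (T t x - x)) (𝓝[>] 0) (𝓝 y)

variable {F : Type*} [NormedAddCommGroup F] [NormedSpace ℂ F]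

/-- For a subspace `F` of `E` (given through its embedding `j`), the operator matrix
`(0, I; K, 0)` on `F × E` with domain `D(K) × F`. -/
def reductionMatrix (K : E →ₗ.[ℂ] E) (j : F →L[ℂ] E) (hj : Function.Injective j) :
    (F × E) →ₗ.[ℂ] (F × E) where
  domain := (K.domain.comap (j : F →ₗ[ℂ] E)).prod (LinearMap.range (j : F →ₗ[ℂ] E))
  toFun :=
    { toFun := fun z =>
        ((LinearEquiv.ofInjective (j : F →ₗ[ℂ] E) hj).symm ⟨z.1.2, z.2.2⟩, K ⟨j z.1.1, z.2.1⟩)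
      map_add' := fun z w => by
        refine Prod.ext ?_ ?_
        · exact map_add (LinearEquiv.ofInjective (j : F →ₗ[ℂ] E) hj).symm
            ⟨z.1.2, z.2.2⟩ ⟨w.1.2, w.2.2⟩
        · refine Eq.trans ?_ (K.map_add ⟨j z.1.1, z.2.1⟩ ⟨j w.1.1, w.2.1⟩)
          exact congrArg (fun u : K.domain => K u) (Subtype.ext (map_add j z.1.1 w.1.1))
      map_smul' := fun c z => by
        refine Prod.ext ?_ ?_
        · exact map_smul (LinearEquiv.ofInjective (j : F →ₗ[ℂ] E) hj).symm c ⟨z.1.2, z.2.2⟩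
        · refine Eq.trans ?_ (K.map_smul c ⟨j z.1.1, z.2.1⟩)
          exact congrArg (fun u : K.domain => K u) (Subtype.ext (map_smul j c z.1.1)) }

/-- The subspace `F` of `E`, embedded by `j`, is a Banach space with dense continuous embeddings
`[D(K)] ↪ F ↪ E`, where `[D(K)]` is `D(K)` with the graph norm, and the operator matrix
`(0, I; K, 0)` with domain `D(K) × F` generates a strongly continuous semigroup on `F × E`. -/
structure IsKisynskiSpace (K : E →ₗ.[ℂ] E) (j : F →L[ℂ] E) : Prop where
  complete : CompleteSpace F
  injective : Function.Injective j
  denseRange : DenseRange j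
  domain_le : ∀ u : K.domain, ∃ v : F, j v = u
  domain_embedding_continuous : ∃ c : ℝ, ∀ (v : F) (u : K.domain), j v = u →
    ‖v‖ ≤ c * (‖(u : E)‖ + ‖K u‖)
  domain_dense : Dense {v : F | j v ∈ K.domain}
  semigroup : ∃ T : ℝ → (F × E) →L[ℂ] (F × E),
    IsC0Semigroup T ∧ IsSemigroupGenerator T (reductionMatrix K j injective)

/-- `K` generates a cosine operator function on `E` with associated phase space `F × E`, the
subspace `F` of `E` being given through its embedding `j`. -/
def GeneratesCosineWithPhaseSpace (K : E →ₗ.[ℂ] E) (j : F →L[ℂ] E) : Prop :=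
  (∃ C : ℝ → E →L[ℂ] E, IsCosineFunction C ∧ IsCosineGenerator C K) ∧ IsKisynskiSpace K j

/-- `λ - K` is a bijection of `D(K)` onto `E` with bounded inverse. -/
def resolventSet (K : E →ₗ.[ℂ] E) : Set ℂ :=
  {l | ∃ R : E →L[ℂ] E,
    (∀ x : E, ∃ h : R x ∈ K.domain, l • R x - K ⟨R x, h⟩ = x) ∧
    (∀ u : K.domain, R (l • (u : E) - K u) = u)}

theorem IsCosineFunction.even {C : ℝ → E →L[ℂ] E} (hC : IsCosineFunction C) (t : ℝ) (x : E) :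
    C (-t) x = C t x := by
  have h := hC.dAlembert 0 t x
  rw [hC.at_zero] at h
  simp only [zero_add, zero_sub, ContinuousLinearMap.id_apply, two_smul] at h
  exact add_left_cancel h

theorem IsCosineFunction.comm {C : ℝ → E →L[ℂ] E} (hC : IsCosineFunction C) (t s : ℝ) (x : E) :
    C t (C s x) = C s (C t x) := by
  have h1 := hC.dAlembert t s x
  have h2 := hC.dAlembert s t x
  rw [add_comm s t, ← neg_sub t s, hC.even] at h2
  have h3 : (2 : ℂ) • C t (C s x) = (2 : ℂ) • C s (C t x) := h1.symm.trans h2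
  exact smul_right_injective E (two_ne_zero : (2 : ℂ) ≠ 0) h3

/-- The sine operator function leaves the domain of the generator invariant. -/
theorem sine_mem_domain [CompleteSpace E] {C : ℝ → E →L[ℂ] E} {K : E →ₗ.[ℂ] E}
    (hC : IsCosineFunction C) (hK : IsCosineGenerator C K) (s : ℝ) {f : E} (hf : f ∈ K.domain) :
    sine C s f ∈ K.domain := by
  obtain ⟨y, hy⟩ := LinearPMap.mem_domain_iff.1 hf
  refine LinearPMap.mem_domain_iff.2 ⟨sine C s y, (hK _ _).2 ?_⟩
  have hlim := (hK _ _).1 hy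
  have hint : ∀ x : E, IntervalIntegrable (fun r : ℝ => C r x) MeasureTheory.volume 0 s :=
    fun x => (hC.strongly_continuous x).intervalIntegrable 0 s
  obtain ⟨M, hM⟩ : ∃ M : ℝ, ∀ r : Set.uIcc (0 : ℝ) s, ‖C r‖ ≤ M := by
    refine banach_steinhaus fun x => ?_
    obtain ⟨c, hc⟩ := isCompact_uIcc.exists_bound_of_continuousOn
      (s := Set.uIcc (0 : ℝ) s) (hC.strongly_continuous x).continuousOn
    exact ⟨c, fun r => hc r r.2⟩
  have hrew : ∀ t : ℝ, (2 / (t : ℂ) ^ 2) • (C t (sine C s f) - sine C s f) =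
      sine C s ((2 / (t : ℂ) ^ 2) • (C t f - f)) := by
    intro t
    unfold sine
    rw [← ContinuousLinearMap.intervalIntegral_comp_comm (C t) (hint f)]
    have hint' : IntervalIntegrable (fun r : ℝ => C t (C r f)) MeasureTheory.volume 0 s :=
      ((C t).continuous.comp (hC.strongly_continuous f)).intervalIntegrable 0 s
    rw [← intervalIntegral.integral_sub hint' (hint f), ← intervalIntegral.integral_smul]
    refine intervalIntegral.integral_congr fun r _ => ?_
    simp only [map_smul, map_sub, hC.comm t r f]
  simp only [hrew]
  rw [tendsto_iff_norm_sub_tendsto_zero] at hlim ⊢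
  have hb : Tendsto (fun t : ℝ => M * ‖(2 / (t : ℂ) ^ 2) • (C t f - f) - y‖ * |s - 0|)
      (𝓝[≠] 0) (𝓝 0) := by
    simpa using (hlim.const_mul M).mul_const |s - 0|
  refine squeeze_zero (fun _ => norm_nonneg _) (fun t => ?_) hb
  unfold sine
  rw [← intervalIntegral.integral_sub (hint _) (hint _)]
  refine intervalIntegral.norm_integral_le_of_norm_le_const fun r hr => ?_
  rw [← map_sub]
  exact (C r).le_of_opNorm_le (hM ⟨r, Set.uIoc_subset_uIcc hr⟩) _

end General

/-! ### The boundary setting -/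

section Boundary

variable {X : Type*} [NormedAddCommGroup X] [NormedSpace ℂ X]
  {bX : Type*} [NormedAddCommGroup bX] [NormedSpace ℂ bX]

/-- The operator `(A; L) : D(A) → X × ∂X`, `u ↦ (A u, L u)`. -/
def stackedOperator (A : X →ₗ.[ℂ] X) (L : A.domain →ₗ[ℂ] bX) : X →ₗ.[ℂ] (X × bX) where
  domain := A.domain
  toFun := A.toFun.prod L

/-- The restriction `A₀` of `A` to `ker L`. -/
def restrictKer (A : X →ₗ.[ℂ] X) (L : A.domain →ₗ[ℂ] bX) : X →ₗ.[ℂ] X where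
  domain := (LinearMap.ker L).map A.domain.subtype
  toFun := A.toFun ∘ₗ Submodule.inclusion (Submodule.map_subtype_le A.domain (LinearMap.ker L))

theorem restrictKer_domain_le (A : X →ₗ.[ℂ] X) (L : A.domain →ₗ[ℂ] bX) :
    (restrictKer A L).domain ≤ A.domain :=
  Submodule.map_subtype_le A.domain (LinearMap.ker L)

/-- The operator matrix `(A, 0; B, B')` on `X × ∂X` with the coupled domain
`{(u, x) ∈ D(A) × ∂X : L u = x}`. -/
def operatorMatrix (A : X →ₗ.[ℂ] X) (L B : A.domain →ₗ[ℂ] bX) (B' : bX →L[ℂ] bX) :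
    (X × bX) →ₗ.[ℂ] (X × bX) where
  domain :=
    { carrier := {p | ∃ h : p.1 ∈ A.domain, L ⟨p.1, h⟩ = p.2}
      add_mem' := fun {p q} hp hq => by
        obtain ⟨h, e⟩ := hp
        obtain ⟨h', e'⟩ := hq
        refine ⟨A.domain.add_mem h h', ?_⟩
        exact (map_add L ⟨p.1, h⟩ ⟨q.1, h'⟩).trans (by rw [e, e'])
      zero_mem' := ⟨A.domain.zero_mem, map_zero L⟩
      smul_mem' := fun c p hp => by
        obtain ⟨h, e⟩ := hp
        refine ⟨A.domain.smul_mem c h, ?_⟩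
        exact (map_smul L c ⟨p.1, h⟩).trans (by rw [e]) }
  toFun :=
    { toFun := fun p => (A ⟨p.1.1, p.2.1⟩, B ⟨p.1.1, p.2.1⟩ + B' p.1.2)
      map_add' := fun p q => by
        refine Prod.ext ?_ ?_
        · exact A.map_add ⟨p.1.1, p.2.1⟩ ⟨q.1.1, q.2.1⟩
        · have h1 := map_add B ⟨p.1.1, p.2.1⟩ ⟨q.1.1, q.2.1⟩
          have h2 := map_add B' p.1.2 q.1.2
          exact (congrArg₂ (· + ·) h1 h2).trans (add_add_add_comm _ _ _ _)
      map_smul' := fun c p => by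
        refine Prod.ext ?_ ?_
        · exact A.map_smul c ⟨p.1.1, p.2.1⟩
        · have h1 := map_smul B c ⟨p.1.1, p.2.1⟩
          have h2 := map_smul B' c p.1.2
          exact (congrArg₂ (· + ·) h1 h2).trans (smul_add _ _ _).symm }

/-- `D` is a (two-sided) inverse of the restriction of `L` to `ker (λ - A)`. -/
def IsDirichletOperator (A : X →ₗ.[ℂ] X) (L : A.domain →ₗ[ℂ] bX) (l : ℂ) (D : bX →L[ℂ] X) :
    Prop :=
  (∀ x : bX, ∃ h : D x ∈ A.domain, A ⟨D x, h⟩ = l • D x ∧ L ⟨D x, h⟩ = x) ∧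
  (∀ u : A.domain, A u = l • (u : X) → D (L u) = u)

open Classical in
/-- The Dirichlet operator `D_λ : ∂X → X`, i.e. the inverse of `L` restricted to `ker (λ - A)`. It
exists for every `λ` in the resolvent set of `A₀` (see `dirichletOperator_spec`); the value is `0`
for those `λ` for which there is no bounded inverse. -/
def dirichletOperator (A : X →ₗ.[ℂ] X) (L : A.domain →ₗ[ℂ] bX) (l : ℂ) : bX →L[ℂ] X :=
  if h : ∃ D : bX →L[ℂ] X, IsDirichletOperator A L l D then h.choose else 0

theorem IsDirichletOperator.unique {A : X →ₗ.[ℂ] X} {L : A.domain →ₗ[ℂ] bX} {l : ℂ}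
    {D D' : bX →L[ℂ] X} (hD : IsDirichletOperator A L l D) (hD' : IsDirichletOperator A L l D') :
    D = D' := by
  ext x
  obtain ⟨h, h1, h2⟩ := hD.1 x
  have h3 := hD'.2 ⟨D x, h⟩ h1
  rw [h2] at h3
  exact h3.symm

/-- For `λ` in the resolvent set of `A₀` the Dirichlet operator is the bounded inverse of `L`
restricted to `ker (λ - A)`. -/
theorem dirichletOperator_spec [CompleteSpace X] [CompleteSpace bX]
    (A : X →ₗ.[ℂ] X) (L : A.domain →ₗ[ℂ] bX) (hL : Function.Surjective L)
    (hclosed : (stackedOperator A L).IsClosed) {l : ℂ} (hl : l ∈ resolventSet (restrictKer A L)) :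
    IsDirichletOperator A L l (dirichletOperator A L l) := by
  have hex : ∃ D : bX →L[ℂ] X, IsDirichletOperator A L l D := by
    obtain ⟨R, hR1, hR2⟩ := hl
    have huniq : ∀ u v : A.domain, A u = l • (u : X) → A v = l • (v : X) → L u = L v → u = v := by
      intro u v hu hv huv
      have hmem : ((u - v : A.domain) : X) ∈ (restrictKer A L).domain :=
        ⟨u - v, by simp [huv], rfl⟩
      have h1 := hR2 ⟨_, hmem⟩
      have h2 : (restrictKer A L) ⟨_, hmem⟩ = A (u - v) := rfl
      rw [h2, A.map_sub, hu, hv] at h1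
      simp only [AddSubgroupClass.coe_sub, smul_sub, sub_self, map_zero] at h1
      exact Subtype.ext (sub_eq_zero.1 h1.symm)
    have hexist : ∀ x : bX, ∃ u : A.domain, A u = l • (u : X) ∧ L u = x := by
      intro x
      obtain ⟨u, hu⟩ := hL x
      obtain ⟨h, h1⟩ := hR1 (l • (u : X) - A u)
      obtain ⟨w, hw, hw'⟩ := id h
      have h2 : (restrictKer A L) ⟨R (l • (u : X) - A u), h⟩ = A w := by
        change A ⟨_, _⟩ = A w
        congr 1
        exact Subtype.ext hw'.symm
      have hw'' : (w : X) = R (l • (u : X) - A u) := hw'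
      rw [h2, ← hw''] at h1
      refine ⟨u - w, ?_, ?_⟩
      · rw [A.map_sub, AddSubgroupClass.coe_sub, smul_sub]
        have : l • (u : X) - l • (w : X) = A u - A w := by
          rw [sub_eq_sub_iff_sub_eq_sub, ← h1]
        exact this.symm
      · rw [map_sub, LinearMap.mem_ker.1 hw, sub_zero, hu]
    choose d hd1 hd2 using hexist
    let D : bX →ₗ[ℂ] X :=
      { toFun := fun x => d x
        map_add' := fun x y => by
          rw [← Submodule.coe_add]
          congr 1
          apply huniq _ _ (hd1 _)
          · rw [A.map_add, hd1, hd1, Submodule.coe_add, smul_add]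
          · rw [map_add, hd2, hd2, hd2]
        map_smul' := fun c x => by
          rw [RingHom.id_apply, ← Submodule.coe_smul]
          congr 1
          apply huniq _ _ (hd1 _)
          · rw [A.map_smul, hd1, Submodule.coe_smul, smul_comm]
          · rw [map_smul, hd2, hd2] }
    have hgraph : IsClosed (D.graph : Set (bX × X)) := by
      have hset : (D.graph : Set (bX × X)) = (fun p : bX × X => (p.2, (l • p.2, p.1))) ⁻¹'
          ((stackedOperator A L).graph : Set (X × (X × bX))) := by
        ext p
        simp only [SetLike.mem_coe, LinearMap.mem_graph_iff, Set.mem_preimage,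
          LinearPMap.mem_graph_iff]
        constructor
        · intro hp
          refine ⟨d p.1, hp.symm, ?_⟩
          change (A (d p.1), L (d p.1)) = _
          rw [hd1, hd2, hp]
          rfl
        · rintro ⟨u, hu1, hu2⟩
          have hu3 : (A u, L u) = (l • p.2, p.1) := hu2
          have hA : A u = l • p.2 := congrArg Prod.fst hu3
          have hLu : L u = p.1 := congrArg Prod.snd hu3
          rw [← hu1] at hA ⊢
          have := huniq u (d p.1) hA (hd1 _) (by rw [hd2, hLu])
          rw [this]
          rfl
      rw [hset]
      exact IsClosed.preimage (by fun_prop) hclosed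
    refine ⟨ContinuousLinearMap.ofIsClosedGraph hgraph, fun x => ⟨(d x).2, hd1 x, hd2 x⟩,
      fun u hu => ?_⟩
    exact congrArg Subtype.val (huniq (d (L u)) u (hd1 _) hu (hd2 _))
  unfold dirichletOperator
  rw [dif_pos hex]
  exact hex.choose_spec

variable {Y : Type*} [NormedAddCommGroup Y] [NormedSpace ℂ Y]

/-- The space `{(u, x) ∈ Y × ∂X : L u = x}`, with the norm of `Y × ∂X`. -/
def coupledSpace (LY : Y →L[ℂ] bX) : Submodule ℂ (Y × bX) where
  carrier := {p | LY p.1 = p.2}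
  add_mem' := fun {p q} hp hq => by
    change LY (p.1 + q.1) = p.2 + q.2
    rw [map_add, show LY p.1 = p.2 from hp, show LY q.1 = q.2 from hq]
  zero_mem' := map_zero LY
  smul_mem' := fun c p hp => by
    change LY (c • p.1) = c • p.2
    rw [map_smul, show LY p.1 = p.2 from hp]

/-- The embedding of `{(u, x) ∈ Y × ∂X : L u = x}` into `X × ∂X` induced by the embedding
`i : Y → X`. -/
def coupledEmbedding (i : Y →L[ℂ] X) (LY : Y →L[ℂ] bX) : coupledSpace LY →L[ℂ] X × bX :=
  (i.prodMap (ContinuousLinearMap.id ℂ bX)).comp (coupledSpace LY).subtypeL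

end Boundary

end SecondOrder

end

/-! Write `G` for the reduction matrix of `A₀` and `T` for its semigroup on `V × X`. A reduction
matrix anticommutes with the reflection `(f, e) ↦ (-f, e)`. Its semigroup therefore becomes a group,
and the corner `pr₂ T(|t|)(0, ·)` is a cosine function generated by the lower left entry. This is
`IsKisynskiSpace.generatesCosine`: it suffices to check the embeddings (`isKisynskiSpace_coupled`)
and to show that the reduction matrix of the coupled operator generates a semigroup
(`exists_coupled_semigroup`).

Every `u ∈ D(A)` with `L u = x` is `p + D x` with `p ∈ D(A₀)`, where `D` is the Dirichlet operator
at `λ`, and `A u = A₀ p + λ D x`. In the coordinates `(p, x)`, with `∂X` rescaled by a small `δ`,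
the reduction matrix becomes `diag(G, 0)` plus a bounded operator plus a feedback term: `B p` is fed
into `X` through `-D` and into `∂X` through `δ`. Only this last term is unbounded. It is handled by
Miyadera's theorem (`exists_miyadera_perturbation`, in coupled form `exists_coupled_perturbation`).
The theorem requires `∫ ‖B pr₁ T(s) z‖ ds ≤ c ‖z‖` on a short interval, with `c` times the norm of
the feedback path small. That norm is at most `max ‖D‖ δ`, so the decay of `D` along `λ = μ²`
provides the smallness.

Since `pr₁ T(s)(f, g) = C(s) f + S(s) g`, the hypothesis covers the sine part of the integral
estimate. The cosine part, with the `V`-norm of `f` on the right, is derived from it by averaging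
over `a` the identity `C(t) = (C(t + 2a) + C(t - 2a)) / 2 - (S(t + a) - S(t - a)) S(a) A₀`
(`cosine_eq_add_sub`). The average of the first term consists of sine operators, and `S(a) A₀` is
bounded from `V` to `X`. The result is `IsReductionSemigroup.integral_norm_reductionObservation_le`.

Unbounded operators are handled throughout via resolvents: a generator domain is the range of a
resolvent `R`, and a perturbation `P` on that domain is represented by the bounded operator `Ψ = P
R`. -/

noncomputable section

namespace SecondOrder

open MeasureTheory

/-! ### Strongly continuous families of operators -/

section StrongContinuity

variable {E : Type*} [NormedAddCommGroup E] [NormedSpace ℂ E]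
  {F : Type*} [NormedAddCommGroup F] [NormedSpace ℂ F]

/-- A family of bounded operators indexed by `ℝ` that is continuous for the strong topology. -/
def IsStronglyContinuous (S : ℝ → E →L[ℂ] F) : Prop :=
  ∀ x : E, Continuous fun t : ℝ => S t x

namespace IsStronglyContinuous

variable {S : ℝ → E →L[ℂ] F}

theorem exists_bound [CompleteSpace E] (hS : IsStronglyContinuous S) (a b : ℝ) :
    ∃ M : ℝ, 0 ≤ M ∧ ∀ t ∈ Set.Icc a b, ‖S t‖ ≤ M := by
  obtain ⟨M, hM⟩ : ∃ M : ℝ, ∀ r : Set.Icc a b, ‖S r‖ ≤ M := by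
    refine banach_steinhaus fun x => ?_
    obtain ⟨c, hc⟩ := isCompact_Icc.exists_bound_of_continuousOn
      (s := Set.Icc a b) (hS x).continuousOn
    exact ⟨c, fun r => hc r r.2⟩
  exact ⟨max M 0, le_max_right _ _, fun t ht => (hM ⟨t, ht⟩).trans (le_max_left _ _)⟩

/-- The uniform boundedness principle on `[t - 1, t + 1]` upgrades strong continuity to joint
continuity in time and vector. -/
theorem tendsto_apply [CompleteSpace E] (hS : IsStronglyContinuous S) {α : Type*} {l : Filter α}
    {τ : α → ℝ} {x : α → E} {t : ℝ} {y : E} (hτ : Tendsto τ l (𝓝 t)) (hx : Tendsto x l (𝓝 y)) :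
    Tendsto (fun a => S (τ a) (x a)) l (𝓝 (S t y)) := by
  obtain ⟨M, hM0, hM⟩ := hS.exists_bound (t - 1) (t + 1)
  have h1 : Tendsto (fun a => S (τ a) y) l (𝓝 (S t y)) := ((hS y).tendsto t).comp hτ
  have h2 : Tendsto (fun a => S (τ a) (x a - y)) l (𝓝 0) := by
    have hb : Tendsto (fun a => M * ‖x a - y‖) l (𝓝 0) := by
      simpa using (tendsto_iff_norm_sub_tendsto_zero.1 hx).const_mul M
    refine squeeze_zero_norm' ?_ hb
    filter_upwards [hτ (Icc_mem_nhds (sub_one_lt t) (lt_add_one t))] with a ha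
    exact (S (τ a)).le_of_opNorm_le (hM _ ha) _
  simpa using h2.add h1

theorem continuous_apply [CompleteSpace E] (hS : IsStronglyContinuous S) {α : Type*}
    [TopologicalSpace α] {τ : α → ℝ} {x : α → E} (hτ : Continuous τ) (hx : Continuous x) :
    Continuous fun a => S (τ a) (x a) :=
  continuous_iff_continuousAt.2 fun _ => hS.tendsto_apply hτ.continuousAt hx.continuousAt

/-- The product rule without norm differentiability of `S`: the orbit of the fixed vector `x t` is
differentiated, and joint continuity absorbs the moving slope of `x`. -/
theorem hasDerivWithinAt_apply [CompleteSpace E] (hS : IsStronglyContinuous S) {x : ℝ → E} {x' : E}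
    {k : F} {s : Set ℝ} {t : ℝ} (hx : HasDerivWithinAt x x' s t)
    (hk : HasDerivWithinAt (fun r => S r (x t)) k s t) :
    HasDerivWithinAt (fun r => S r (x r)) (k + S t x') s t := by
  rw [hasDerivWithinAt_iff_tendsto_slope] at hx hk ⊢
  have h1 := hS.tendsto_apply (tendsto_id.mono_left nhdsWithin_le_nhds) hx
  refine (hk.add h1).congr fun r => ?_
  simp only [slope, vsub_eq_sub, id_eq, ← Complex.coe_smul, map_smul, map_sub, ← smul_add]
  congr 1
  abel

theorem intervalIntegrable (hS : IsStronglyContinuous S) (x : E) (a b : ℝ) :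
    IntervalIntegrable (fun t => S t x) volume a b :=
  (hS x).intervalIntegrable a b

end IsStronglyContinuous

variable [CompleteSpace E]

/-- The strong integral `x ↦ ∫ₐᵇ S(s) x ds` as a bounded operator. -/
def strongIntegral (S : ℝ → E →L[ℂ] F) (hS : IsStronglyContinuous S) (a b : ℝ) : E →L[ℂ] F :=
  LinearMap.mkContinuousOfExistsBound
    { toFun := fun x => ∫ s in a..b, S s x
      map_add' := fun x y => by
        simp only [map_add]
        exact intervalIntegral.integral_add (hS.intervalIntegrable x a b)
          (hS.intervalIntegrable y a b)
      map_smul' := fun c x => by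
        simp only [map_smul, RingHom.id_apply]
        exact intervalIntegral.integral_smul c _ } <| by
    obtain ⟨M, -, hM⟩ := hS.exists_bound (min a b) (max a b)
    refine ⟨M * |b - a|, fun x => ?_⟩
    have h := intervalIntegral.norm_integral_le_of_norm_le_const (a := a) (b := b)
      (f := fun s => S s x) (C := M * ‖x‖) fun s hs =>
        (S s).le_of_opNorm_le (hM s (Set.uIoc_subset_uIcc hs)) x
    exact h.trans (le_of_eq (by ring))

theorem strongIntegral_apply {S : ℝ → E →L[ℂ] F} (hS : IsStronglyContinuous S) (a b : ℝ) (x : E) :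
    strongIntegral S hS a b x = ∫ s in a..b, S s x :=
  rfl

theorem hasDerivAt_strongIntegral [CompleteSpace F] {S : ℝ → E →L[ℂ] F}
    (hS : IsStronglyContinuous S) (a t : ℝ) (x : E) :
    HasDerivAt (fun r => strongIntegral S hS a r x) (S t x) t :=
  (hS x).integral_hasStrictDerivAt a t |>.hasDerivAt

theorem isStronglyContinuous_strongIntegral [CompleteSpace F] {S : ℝ → E →L[ℂ] F}
    (hS : IsStronglyContinuous S) (a : ℝ) : IsStronglyContinuous (strongIntegral S hS a) :=
  fun x => continuous_iff_continuousAt.2 fun t => (hasDerivAt_strongIntegral hS a t x).continuousAt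

end StrongContinuity

/-! ### Strongly continuous semigroups -/

section Semigroup

variable {E : Type*} [NormedAddCommGroup E] [NormedSpace ℂ E]

/-- `y` is the right derivative at `0` of the orbit `t ↦ T(t) x`. -/
def OrbitDeriv (T : ℝ → E →L[ℂ] E) (x y : E) : Prop :=
  Tendsto (fun t : ℝ => ((t : ℂ)⁻¹) • (T t x - x)) (𝓝[>] 0) (𝓝 y)

theorem orbitDeriv_congr {T T' : ℝ → E →L[ℂ] E} (h : ∀ t, 0 ≤ t → T t = T' t) (x y : E) :
    OrbitDeriv T x y ↔ OrbitDeriv T' x y :=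
  tendsto_congr' (by filter_upwards [self_mem_nhdsWithin] with t ht; rw [h t (le_of_lt ht)])

/-- A strongly continuous semigroup that is extended to a strongly continuous family on `ℝ`. -/
structure IsExtendedSemigroup (T : ℝ → E →L[ℂ] E) : Prop extends IsC0Semigroup T where
  cont : IsStronglyContinuous T

/-- Freezing negative times at `0` gives continuity on all of `ℝ`, so that integrals and
convolutions need no side conditions; generators only see `t ≥ 0`. -/
theorem IsC0Semigroup.extend {T : ℝ → E →L[ℂ] E} (hT : IsC0Semigroup T) :
    IsExtendedSemigroup fun t => T (max t 0) where
  at_zero := by simp [hT.at_zero]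
  semigroup t s ht hs x := by
    simp only [max_eq_left ht, max_eq_left hs, max_eq_left (add_nonneg ht hs)]
    exact hT.semigroup t s ht hs x
  strongly_continuous x := by
    refine (hT.strongly_continuous x).congr fun t ht => ?_
    simp only [max_eq_left (Set.mem_Ici.1 ht)]
  cont x := (hT.strongly_continuous x).comp_continuous (by fun_prop) fun t =>
    Set.mem_Ici.2 (le_max_right _ _)

theorem orbitDeriv_iff_hasDerivWithinAt {T : ℝ → E →L[ℂ] E} (h0 : T 0 = ContinuousLinearMap.id ℂ E)
    (x y : E) : OrbitDeriv T x y ↔ HasDerivWithinAt (fun t => T t x) y (Set.Ioi 0) 0 := by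
  rw [hasDerivWithinAt_iff_tendsto_slope' Set.self_notMem_Ioi]
  refine tendsto_congr fun t => ?_
  simp only [slope, vsub_eq_sub, sub_zero, h0, ContinuousLinearMap.id_apply, ← Complex.coe_smul,
    Complex.ofReal_inv]

namespace IsExtendedSemigroup

variable {T : ℝ → E →L[ℂ] E}

theorem zero_apply (hT : IsExtendedSemigroup T) (x : E) : T 0 x = x := by
  rw [hT.at_zero, ContinuousLinearMap.id_apply]

theorem comm (hT : IsExtendedSemigroup T) {t s : ℝ} (ht : 0 ≤ t) (hs : 0 ≤ s) (x : E) :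
    T t (T s x) = T s (T t x) := by
  rw [← hT.semigroup t s ht hs, ← hT.semigroup s t hs ht, add_comm]

theorem orbitDeriv_apply (hT : IsExtendedSemigroup T) {x y : E} (h : OrbitDeriv T x y) {t : ℝ}
    (ht : 0 ≤ t) : OrbitDeriv T (T t x) (T t y) := by
  refine (((T t).continuous.tendsto y).comp h).congr' ?_
  filter_upwards [self_mem_nhdsWithin] with s hs
  simp only [Function.comp_apply, map_smul, map_sub, hT.comm ht (le_of_lt hs)]

theorem hasDerivWithinAt (hT : IsExtendedSemigroup T) {x y : E} (h : OrbitDeriv T x y) {t : ℝ}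
    (ht : 0 ≤ t) : HasDerivWithinAt (fun s => T s x) (T t y) (Set.Ioi t) t := by
  have h1 := (orbitDeriv_iff_hasDerivWithinAt hT.at_zero _ _).1 (hT.orbitDeriv_apply h ht)
  have h2 : HasDerivWithinAt (fun s : ℝ => s - t) 1 (Set.Ioi t) t :=
    (hasDerivAt_id t).sub_const t |>.hasDerivWithinAt
  have h3 := HasDerivWithinAt.scomp_of_eq t h1 h2 (fun s hs => Set.mem_Ioi.2 (sub_pos.2 hs)) (by simp)
  rw [one_smul] at h3
  refine h3.congr (fun s hs => ?_) ?_
  · change T s x = T (s - t) (T t x)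
    rw [← hT.semigroup _ _ (sub_nonneg.2 (le_of_lt hs)) ht, sub_add_cancel]
  · simp [hT.zero_apply]

variable [CompleteSpace E]

theorem apply_sub_eq_integral (hT : IsExtendedSemigroup T) {x y : E} (h : OrbitDeriv T x y) {t : ℝ}
    (ht : 0 ≤ t) : T t x - x = ∫ s in (0 : ℝ)..t, T s y := by
  rw [intervalIntegral.integral_eq_sub_of_hasDeriv_right (f := fun s => T s x)
    (hT.cont x).continuousOn (fun s hs => ?_) (hT.cont.intervalIntegrable y 0 t), hT.zero_apply]
  rw [min_eq_left ht] at hs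
  exact hT.hasDerivWithinAt h hs.1.le

theorem orbitDeriv_integral (hT : IsExtendedSemigroup T) (x : E) {t : ℝ} (ht : 0 ≤ t) :
    OrbitDeriv T (strongIntegral T hT.cont 0 t x) (T t x - x) := by
  rw [orbitDeriv_iff_hasDerivWithinAt hT.at_zero]
  have h1 : HasDerivAt (fun r => strongIntegral T hT.cont t (t + r) x) (T t x) 0 := by
    have := (hasDerivAt_strongIntegral hT.cont t (t + 0) x).comp_const_add t 0
    simpa using this
  have h2 := hasDerivAt_strongIntegral hT.cont 0 0 x
  rw [hT.zero_apply] at h2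
  have h3 := ((h1.sub h2).add_const (strongIntegral T hT.cont 0 t x)).hasDerivWithinAt
    (s := Set.Ioi 0)
  refine h3.congr_of_eventuallyEq ?_ (by simp [strongIntegral_apply, hT.zero_apply])
  filter_upwards [self_mem_nhdsWithin] with r hr
  have hi := fun a b => hT.cont.intervalIntegrable x a b
  simp only [strongIntegral_apply, Pi.sub_apply]
  rw [← ContinuousLinearMap.intervalIntegral_comp_comm (T r) (hi 0 t)]
  have h4 : ∫ s in (0 : ℝ)..t, T r (T s x) = ∫ s in (0 : ℝ)..t, T (r + s) x := by
    refine intervalIntegral.integral_congr fun s hs => ?_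
    rw [Set.uIcc_of_le ht] at hs
    exact (hT.semigroup r s (le_of_lt hr) hs.1 x).symm
  rw [h4, intervalIntegral.integral_comp_add_left (fun s => T s x), add_zero, add_comm r t,
    ← intervalIntegral.integral_add_adjacent_intervals (hi 0 r) (hi r t),
    ← intervalIntegral.integral_add_adjacent_intervals (hi r t) (hi t (t + r))]
  abel

theorem exists_exp_bound (hT : IsExtendedSemigroup T) :
    ∃ M ω : ℝ, 1 ≤ M ∧ 0 ≤ ω ∧ ∀ t, 0 ≤ t → ‖T t‖ ≤ M * Real.exp (ω * t) := by
  obtain ⟨M₀, -, hM₀⟩ := hT.cont.exists_bound 0 1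
  set M := max M₀ 1
  have hM1 : 1 ≤ M := le_max_right _ _
  have hM : ∀ t ∈ Set.Icc (0 : ℝ) 1, ‖T t‖ ≤ M := fun t ht => (hM₀ t ht).trans (le_max_left _ _)
  refine ⟨M, Real.log M, hM1, Real.log_nonneg hM1, fun t ht => ?_⟩
  -- Each unit of time costs one factor `M`, so `ω = log M` is the growth rate; `M ≥ 1` lets `n =
  -- ⌊t⌋` be replaced by `t`.
  have key : ∀ n : ℕ, ∀ t ∈ Set.Icc (n : ℝ) (n + 1), ‖T t‖ ≤ M * M ^ n := by
    intro n
    induction n with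
    | zero => intro t ht; simpa using hM t (by simpa using ht)
    | succ n ih =>
      intro t ht
      push_cast at ht
      have hn : (0 : ℝ) ≤ n := n.cast_nonneg
      have h1 := ih (t - 1) ⟨by linarith [ht.1], by linarith [ht.2]⟩
      have h2 : T t = (T 1).comp (T (t - 1)) := by
        ext x
        rw [ContinuousLinearMap.comp_apply, ← hT.semigroup 1 (t - 1) zero_le_one
          (by linarith [ht.1]), add_sub_cancel]
      rw [h2]
      refine (ContinuousLinearMap.opNorm_comp_le _ _).trans ?_
      calc ‖T 1‖ * ‖T (t - 1)‖ ≤ M * (M * M ^ n) := by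
            gcongr
            exact hM 1 (by simp)
        _ = M * M ^ (n + 1) := by ring
  refine (key ⌊t⌋₊ t ⟨Nat.floor_le ht, (Nat.lt_floor_add_one t).le⟩).trans ?_
  gcongr
  rw [Real.exp_mul, Real.exp_log (by linarith), ← Real.rpow_natCast]
  exact Real.rpow_le_rpow_of_exponent_le hM1 (Nat.floor_le ht)

end IsExtendedSemigroup

/-- `R` is the bounded inverse of `ν - G`, where `G` is the generator of `T`. -/
structure IsSemigroupResolvent (T : ℝ → E →L[ℂ] E) (ν : ℂ) (R : E →L[ℂ] E) : Prop where
  orbitDeriv : ∀ x, OrbitDeriv T (R x) (ν • R x - x)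
  left_inv : ∀ x y, OrbitDeriv T x y → R (ν • x - y) = x

theorem OrbitDeriv.unique {T : ℝ → E →L[ℂ] E} {x y y' : E} (h : OrbitDeriv T x y)
    (h' : OrbitDeriv T x y') : y = y' :=
  tendsto_nhds_unique h h'

theorem OrbitDeriv.smul {T : ℝ → E →L[ℂ] E} {x y : E} (h : OrbitDeriv T x y) (c : ℂ) :
    OrbitDeriv T (c • x) (c • y) := by
  refine (Filter.Tendsto.const_smul h c).congr fun t => ?_
  rw [map_smul, ← smul_sub, smul_comm]

/-- The rescaled family `e^{-ν t} T(t)`. -/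
def rescale (ν : ℝ) (T : ℝ → E →L[ℂ] E) (t : ℝ) : E →L[ℂ] E :=
  (Real.exp (-(ν * t)) : ℂ) • T t

theorem rescale_apply (ν : ℝ) (T : ℝ → E →L[ℂ] E) (t : ℝ) (x : E) :
    rescale ν T t x = (Real.exp (-(ν * t)) : ℂ) • T t x :=
  rfl

theorem IsExtendedSemigroup.rescale {T : ℝ → E →L[ℂ] E} (hT : IsExtendedSemigroup T) (ν : ℝ) :
    IsExtendedSemigroup (rescale ν T) := by
  have hc : IsStronglyContinuous (SecondOrder.rescale ν T) := fun x => by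
    simp only [rescale_apply]
    have := hT.cont x
    fun_prop
  refine ⟨⟨by simp [SecondOrder.rescale, hT.at_zero], fun t s ht hs x => ?_,
    fun x => (hc x).continuousOn⟩, hc⟩
  simp only [rescale_apply, hT.semigroup t s ht hs, map_smul, smul_smul, ← Complex.ofReal_mul,
    ← Real.exp_add]
  congr 4
  ring

theorem orbitDeriv_rescale {T : ℝ → E →L[ℂ] E} (hT : IsExtendedSemigroup T) (ν : ℝ) (x y : E) :
    OrbitDeriv (rescale ν T) x y ↔ OrbitDeriv T x ((ν : ℂ) • x + y) := by
  rw [orbitDeriv_iff_hasDerivWithinAt hT.at_zero,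
    orbitDeriv_iff_hasDerivWithinAt (hT.rescale ν).at_zero]
  have hexp : ∀ c : ℝ, HasDerivWithinAt (fun t : ℝ => Real.exp (c * t)) c (Set.Ioi 0) 0 := by
    intro c
    have := ((hasDerivAt_id (0 : ℝ)).const_mul c).exp
    simpa using this.hasDerivWithinAt
  constructor
  · intro h
    have := (hexp ν).smul h
    simp only [rescale_apply, mul_zero, Real.exp_zero, one_smul, neg_zero, hT.zero_apply,
      Complex.ofReal_one] at this
    rw [add_comm, Complex.coe_smul]
    refine this.congr (fun t _ => ?_) ?_
    · simp only [Pi.smul_apply', ← Complex.coe_smul, smul_smul, ← Complex.ofReal_mul,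
        ← Real.exp_add]
      simp
    · simp [hT.zero_apply]
  · intro h
    have := (hexp (-ν)).smul h
    simp only [mul_zero, Real.exp_zero, one_smul, hT.zero_apply] at this
    refine (this.congr_deriv ?_).congr (fun t _ => ?_) ?_
    · rw [Complex.coe_smul, neg_smul]; abel
    · simp only [Pi.smul_apply', rescale_apply, ← Complex.coe_smul, neg_mul]
    · simp [rescale_apply, hT.zero_apply]

/-- With `Tν(s) = e^{-νs} T(s)`, the operator `ν - G` maps `∫₀¹ Tν(s) x ds` to `x - Tν(1) x`. Once
`‖Tν(1)‖ < 1`, a Neumann series inverts the right-hand side, so no improper Laplace integral is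
needed. -/
theorem IsExtendedSemigroup.exists_resolvent [CompleteSpace E] {T : ℝ → E →L[ℂ] E}
    (hT : IsExtendedSemigroup T) :
    ∃ ν₀ : ℝ, 0 < ν₀ ∧ ∀ ν : ℝ, ν₀ < ν → ∃ R, IsSemigroupResolvent T ν R := by
  -- The logarithm makes `e^{-ν} ‖T 1‖ < 1`; the `1` only makes the threshold positive.
  refine ⟨max 1 (Real.log (‖T 1‖ + 1)), by positivity, fun ν hν => ?_⟩
  have hlog : Real.log (‖T 1‖ + 1) < ν := (le_max_right _ _).trans_lt hν
  have hs := hT.rescale ν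
  set Tν := SecondOrder.rescale ν T
  have hnorm : ‖Tν 1‖ < 1 := by
    have h1 : ‖T 1‖ + 1 < Real.exp ν := (Real.log_lt_iff_lt_exp (by positivity)).1 hlog
    change ‖(Real.exp (-(ν * 1)) : ℂ) • T 1‖ < 1
    rw [norm_smul, Complex.norm_real, Real.norm_of_nonneg (Real.exp_pos _).le, mul_one,
      Real.exp_neg, inv_mul_lt_iff₀ (Real.exp_pos _)]
    linarith
  set u : (E →L[ℂ] E)ˣ := Units.oneSub (Tν 1) hnorm
  have hu : ∀ x, (u : E →L[ℂ] E) x = x - Tν 1 x := fun x => rfl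
  have hinv : ∀ x, (u : E →L[ℂ] E) ((↑u⁻¹ : E →L[ℂ] E) x) = x := fun x => by
    rw [← mul_apply_eq_comp, u.mul_inv, one_apply_eq_self]
  have hinv' : ∀ x, (↑u⁻¹ : E →L[ℂ] E) ((u : E →L[ℂ] E) x) = x := fun x => by
    rw [← mul_apply_eq_comp, u.inv_mul, one_apply_eq_self]
  set I := strongIntegral Tν hs.cont 0 1
  have hcomm : Commute (u : E →L[ℂ] E) I := by
    refine ContinuousLinearMap.ext fun x => ?_
    rw [mul_apply_eq_comp, mul_apply_eq_comp, hu, hu, map_sub]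
    congr 1
    change Tν 1 (∫ s in (0 : ℝ)..1, Tν s x) = ∫ s in (0 : ℝ)..1, Tν s (Tν 1 x)
    rw [← ContinuousLinearMap.intervalIntegral_comp_comm _ (hs.cont.intervalIntegrable x 0 1)]
    refine intervalIntegral.integral_congr fun s hs' => ?_
    rw [Set.uIcc_of_le zero_le_one] at hs'
    exact hs.comm zero_le_one hs'.1 x
  have hcomm' : ∀ x, I ((↑u⁻¹ : E →L[ℂ] E) x) = (↑u⁻¹ : E →L[ℂ] E) (I x) := fun x =>
    (DFunLike.congr_fun hcomm.units_inv_left.eq x).symm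
  refine ⟨I.comp (↑u⁻¹ : E →L[ℂ] E), fun x => ?_, fun x y hxy => ?_⟩
  · have h1 := hs.orbitDeriv_integral ((↑u⁻¹ : E →L[ℂ] E) x) zero_le_one
    rw [← neg_sub, ← hu, hinv] at h1
    rw [sub_eq_add_neg]
    exact (orbitDeriv_rescale hT ν _ _).1 h1
  · have h1 : OrbitDeriv Tν x (y - (ν : ℂ) • x) := by
      rw [orbitDeriv_rescale hT, add_sub_cancel]
      exact hxy
    have h2 : Tν 1 x - x = I (y - (ν : ℂ) • x) := hs.apply_sub_eq_integral h1 zero_le_one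
    rw [← neg_sub, ← hu, ← neg_sub, map_neg, neg_inj] at h2
    rw [ContinuousLinearMap.comp_apply, hcomm', ← h2, hinv']

namespace IsSemigroupResolvent

variable {T : ℝ → E →L[ℂ] E} {ν : ℂ} {R : E →L[ℂ] E}

theorem comm (hT : IsExtendedSemigroup T) (hR : IsSemigroupResolvent T ν R) {t : ℝ} (ht : 0 ≤ t)
    (x : E) : R (T t x) = T t (R x) := by
  have h := hR.left_inv _ _ (hT.orbitDeriv_apply (hR.orbitDeriv x) ht)
  rwa [← map_smul, ← map_sub, sub_sub_cancel] at h

/-- The averages `t⁻¹ ∫₀ᵗ T(s) x ds` lie in the domain of the generator, which is the range of `R`,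
and tend to `x`. -/
theorem denseRange [CompleteSpace E] (hT : IsExtendedSemigroup T)
    (hR : IsSemigroupResolvent T ν R) : DenseRange R := by
  intro x
  have h1 : Tendsto (fun t : ℝ => (t : ℂ)⁻¹ • strongIntegral T hT.cont 0 t x) (𝓝[>] 0) (𝓝 x) := by
    have h := (hasDerivAt_strongIntegral hT.cont 0 0 x).hasDerivWithinAt (s := Set.Ioi 0)
    rw [hasDerivWithinAt_iff_tendsto_slope' Set.self_notMem_Ioi, hT.zero_apply] at h
    refine h.congr fun t => ?_
    simp [slope, strongIntegral_apply, ← Complex.coe_smul]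
  refine mem_closure_of_tendsto h1 ?_
  filter_upwards [self_mem_nhdsWithin] with t ht
  exact ⟨_, hR.left_inv _ _ ((hT.orbitDeriv_integral x (le_of_lt ht)).smul _)⟩

end IsSemigroupResolvent

end Semigroup

/-! ### The Miyadera perturbation theorem -/

section Miyadera

variable {E : Type*} [NormedAddCommGroup E] [NormedSpace ℂ E]

theorem norm_le_of_denseRange {F : Type*} [NormedAddCommGroup F] [NormedSpace ℂ F]
    {R : E →L[ℂ] E} (hR : DenseRange R) {Λ : E →L[ℂ] F} {c : ℝ} (hc : 0 ≤ c)
    (h : ∀ y, ‖Λ (R y)‖ ≤ c * ‖R y‖) : ‖Λ‖ ≤ c :=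
  Λ.opNorm_le_bound hc fun x =>
    hR.induction_on x (isClosed_le (by fun_prop) (by fun_prop)) h

variable {T : ℝ → E →L[ℂ] E} {R Ψ : E →L[ℂ] E} {q ω : ℝ} {ν : ℂ}

theorem IsSemigroupResolvent.injective (hR : IsSemigroupResolvent T ν R) :
    Function.Injective R := fun a b hab => by
  have h := hR.orbitDeriv a
  rw [hab] at h
  exact sub_right_injective (h.unique (hR.orbitDeriv b))

/-- The Miyadera condition, with weight `e^{-ω t}` and constant `q`, for the perturbation `P` of the
generator with resolvent `R` such that `P R = Ψ`. -/
def MiyaderaBound (T : ℝ → E →L[ℂ] E) (R Ψ : E →L[ℂ] E) (ω q : ℝ) : Prop :=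
  ∀ t, 0 ≤ t → ∀ y, ∫ s in (0 : ℝ)..t, Real.exp (-(ω * s)) * ‖Ψ (T s y)‖ ≤ q * ‖R y‖

/-- Splitting `e^{ω(t - s)} = e^{ωt} e^{-ωs}` leaves exactly the Miyadera integral. Hence convolving
multiplies a bound `m e^{ωt}` by `q`, as an operator on the range of `R`. -/
theorem norm_convolution_le (hT : IsStronglyContinuous T) (hb : MiyaderaBound T R Ψ ω q)
    {F : ℝ → E →L[ℂ] E} {m : ℝ} (hm : ∀ t, 0 ≤ t → ‖F t‖ ≤ m * Real.exp (ω * t)) {t : ℝ} (ht : 0 ≤ t) (y : E) :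
    ‖∫ s in (0 : ℝ)..t, F (t - s) (Ψ (T s y))‖ ≤ q * m * Real.exp (ω * t) * ‖R y‖ := by
  have hm0 : 0 ≤ m := by
    have := (norm_nonneg _).trans (hm 0 le_rfl)
    simpa using this
  have hcont : Continuous fun s => Ψ (T s y) := Ψ.continuous.comp (hT y)
  calc ‖∫ s in (0 : ℝ)..t, F (t - s) (Ψ (T s y))‖
      ≤ ∫ s in (0 : ℝ)..t, m * Real.exp (ω * t) * (Real.exp (-(ω * s)) * ‖Ψ (T s y)‖) := by
        refine intervalIntegral.norm_integral_le_of_norm_le ht ?_ ?_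
        · refine Filter.Eventually.of_forall fun s hs => ?_
          refine ((F (t - s)).le_of_opNorm_le (hm _ (sub_nonneg.2 hs.2)) _).trans (le_of_eq ?_)
          rw [mul_sub, sub_eq_add_neg, Real.exp_add]
          ring
        · exact (continuous_const.mul ((by fun_prop : Continuous fun s : ℝ =>
            Real.exp (-(ω * s))).mul hcont.norm)).intervalIntegrable _ _
    _ = m * Real.exp (ω * t) * ∫ s in (0 : ℝ)..t, Real.exp (-(ω * s)) * ‖Ψ (T s y)‖ :=
        intervalIntegral.integral_const_mul _ _
    _ ≤ m * Real.exp (ω * t) * (q * ‖R y‖) := by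
        gcongr
        exact hb t ht y
    _ = _ := by ring

/-- Iterating the homogeneous equation multiplies the bound by `q < 1` each time. This uniqueness
statement yields the semigroup law of the perturbed family. -/
theorem eq_zero_of_volterra (hT : IsStronglyContinuous T) (hR : DenseRange R) (hq : 0 ≤ q)
    (hq1 : q < 1) (hb : MiyaderaBound T R Ψ ω q) {Δ : ℝ → E →L[ℂ] E} {m : ℝ} (hm : ∀ t, 0 ≤ t → ‖Δ t‖ ≤ m * Real.exp (ω * t))
    (heq : ∀ t, 0 ≤ t → ∀ y, Δ t (R y) = ∫ s in (0 : ℝ)..t, Δ (t - s) (Ψ (T s y)))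
    {t : ℝ} (ht : 0 ≤ t) : Δ t = 0 := by
  have hm0 : 0 ≤ m := by
    have := (norm_nonneg _).trans (hm 0 le_rfl)
    simpa using this
  have key : ∀ n : ℕ, ∀ t, 0 ≤ t → ‖Δ t‖ ≤ q ^ n * m * Real.exp (ω * t) := by
    intro n
    induction n with
    | zero => simpa using hm
    | succ n ih =>
      intro t ht
      refine norm_le_of_denseRange hR (by positivity) fun y => ?_
      rw [heq t ht]
      refine (norm_convolution_le hT hb ih ht y).trans (le_of_eq (by ring))
  have hlim : Tendsto (fun n : ℕ => q ^ n * m * Real.exp (ω * t)) atTop (𝓝 0) := by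
    simpa using ((tendsto_pow_atTop_nhds_zero_of_lt_one hq hq1).mul_const m).mul_const
      (Real.exp (ω * t))
  exact norm_le_zero_iff.1 (ge_of_tendsto' hlim fun n => key n t ht)

variable [CompleteSpace E]

theorem IsStronglyContinuous.convolution {F S : ℝ → E →L[ℂ] E} (hF : IsStronglyContinuous F)
    (hS : IsStronglyContinuous S) (Ψ : E →L[ℂ] E) (t : ℝ) :
    IsStronglyContinuous fun s => (F (t - s)).comp (Ψ.comp (S s)) := fun x =>
  hF.continuous_apply (by fun_prop) (Ψ.continuous.comp (hS x))

theorem continuous_convolution (hT : IsStronglyContinuous T) {F : ℝ → E →L[ℂ] E}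
    (hF : IsStronglyContinuous F) (y : E) :
    Continuous fun t => ∫ s in (0 : ℝ)..t, F (t - s) (Ψ (T s y)) := by
  refine intervalIntegral.continuous_parametric_intervalIntegral_of_continuous
    (f := fun t s => F (t - s) (Ψ (T s y))) ?_ continuous_id
  exact hF.continuous_apply (by fun_prop) ((Ψ.continuous.comp (hT y)).comp continuous_snd)

/-- One step of the Volterra iteration. -/
theorem exists_volterra_step (hT : IsStronglyContinuous T) (hR : DenseRange R) (hq : 0 ≤ q)
    (hω : 0 ≤ ω) (hb : MiyaderaBound T R Ψ ω q) {F : ℝ → E →L[ℂ] E} (hF : IsStronglyContinuous F)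
    {m : ℝ} (hm : ∀ t, ‖F t‖ ≤ m * Real.exp (ω * max t 0)) :
    ∃ F' : ℝ → E →L[ℂ] E, IsStronglyContinuous F' ∧
      (∀ t, ‖F' t‖ ≤ q * m * Real.exp (ω * max t 0)) ∧
      ∀ t, 0 ≤ t → ∀ y, F' t (R y) = ∫ s in (0 : ℝ)..t, F (t - s) (Ψ (T s y)) := by
  have hm0 : 0 ≤ m := by
    have := (norm_nonneg _).trans (hm 0)
    simpa using this
  have hm' : ∀ t, 0 ≤ t → ‖F t‖ ≤ m * Real.exp (ω * t) := fun t ht => by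
    simpa [max_eq_left ht] using hm t
  let Λ : ℝ → E →L[ℂ] E := fun t => strongIntegral _ (hF.convolution hT Ψ t) 0 t
  have hΛ : ∀ t y, Λ t y = ∫ s in (0 : ℝ)..t, F (t - s) (Ψ (T s y)) := fun t y => rfl
  have hΛb : ∀ t, 0 ≤ t → ∀ y, ‖(Λ t : E →ₗ[ℂ] E) y‖ ≤
      (q * m * Real.exp (ω * t)) * ‖(R : E →ₗ[ℂ] E) y‖ :=
    fun t ht y => norm_convolution_le hT hb hm' ht y
  have hRd : DenseRange (R : E →ₗ[ℂ] E) := hR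
  -- The convolution is controlled by `‖R y‖`, so it defines a bounded operator on the dense range
  -- of `R`, which extends to `E`.
  let F' : ℝ → E →L[ℂ] E := fun t =>
    LinearMap.extendOfNorm (Λ (max t 0) : E →ₗ[ℂ] E) (R : E →ₗ[ℂ] E)
  have hF'R : ∀ t y, F' t (R y) = Λ (max t 0) y := fun t y =>
    LinearMap.extendOfNorm_eq hRd ⟨_, hΛb _ (le_max_right _ _)⟩ y
  have hF'b : ∀ t, ‖F' t‖ ≤ q * m * Real.exp (ω * max t 0) := fun t =>
    LinearMap.opNorm_extendOfNorm_le hRd (by positivity) (hΛb _ (le_max_right _ _))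
  refine ⟨F', fun x => ?_, hF'b, fun t ht y => ?_⟩
  · refine continuous_iff_continuousAt.2 fun t₀ => ?_
    have hRc : ∀ y, Continuous fun t => F' t (R y) := fun y => by
      simp only [hF'R, hΛ]
      exact (continuous_convolution hT hF y).comp (by fun_prop : Continuous fun t : ℝ => max t 0)
    set B := q * m * Real.exp (ω * max (t₀ + 1) 0)
    have hB : 0 ≤ B := by positivity
    rw [Metric.continuousAt_iff']
    intro δ hδ
    obtain ⟨y, hy⟩ := hR.exists_dist_lt x (show 0 < δ / (3 * (B + 1)) by positivity)
    have hsmall : ∀ t, t < t₀ + 1 → ‖F' t (x - R y)‖ < δ / 3 := fun t ht => by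
      have h1 : ‖F' t‖ ≤ B := (hF'b t).trans (by
        have : max t 0 ≤ max (t₀ + 1) 0 := max_le_max ht.le le_rfl
        change _ ≤ q * m * Real.exp (ω * max (t₀ + 1) 0)
        gcongr)
      calc ‖F' t (x - R y)‖ ≤ B * ‖x - R y‖ := (F' t).le_of_opNorm_le h1 _
        _ ≤ (B + 1) * ‖x - R y‖ := by gcongr; linarith
        _ < (B + 1) * (δ / (3 * (B + 1))) := by rw [← dist_eq_norm]; gcongr
        _ = δ / 3 := by field_simp
    filter_upwards [Metric.continuousAt_iff'.1 (hRc y).continuousAt (δ / 3) (by positivity),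
      Iio_mem_nhds (lt_add_one t₀)] with t h1 h2
    have h3 := hsmall t h2
    have h4 := hsmall t₀ (lt_add_one t₀)
    rw [dist_eq_norm] at h1 ⊢
    have h5 : F' t x - F' t₀ x = F' t (x - R y) + (F' t (R y) - F' t₀ (R y)) - F' t₀ (x - R y) := by
      simp only [map_sub]; abel
    rw [h5]
    have h6 := norm_sub_le (F' t (x - R y) + (F' t (R y) - F' t₀ (R y))) (F' t₀ (x - R y))
    have h7 := norm_add_le (F' t (x - R y)) (F' t (R y) - F' t₀ (R y))
    linarith
  · rw [hF'R, max_eq_left ht, hΛ]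

/-- The solution of the Volterra equation `U(t) R y = T(t) R y + ∫₀ᵗ U(t - s) Ψ T(s) y ds`. -/
theorem exists_volterra_solution (hT : IsStronglyContinuous T) (hR : DenseRange R) (hq : 0 ≤ q)
    (hq1 : q < 1) (hω : 0 ≤ ω) {M : ℝ} (hM : ∀ t, ‖T t‖ ≤ M * Real.exp (ω * max t 0))
    (hb : MiyaderaBound T R Ψ ω q) :
    ∃ U : ℝ → E →L[ℂ] E, IsStronglyContinuous U ∧
      (∃ M', ∀ t, 0 ≤ t → ‖U t‖ ≤ M' * Real.exp (ω * t)) ∧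
      ∀ t, 0 ≤ t → ∀ y, U t (R y) = T t (R y) + ∫ s in (0 : ℝ)..t, U (t - s) (Ψ (T s y)) := by
  have hM0 : 0 ≤ M := by
    have := (norm_nonneg _).trans (hM 0)
    simpa using this
  let State := {p : (ℝ → E →L[ℂ] E) × ℝ //
    IsStronglyContinuous p.1 ∧ ∀ t, ‖p.1 t‖ ≤ p.2 * Real.exp (ω * max t 0)}
  have hstep : ∀ p : State, ∃ p' : State, p'.1.2 = q * p.1.2 ∧
      ∀ t, 0 ≤ t → ∀ y, p'.1.1 t (R y) = ∫ s in (0 : ℝ)..t, p.1.1 (t - s) (Ψ (T s y)) := by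
    rintro ⟨⟨F, m⟩, hF, hm⟩
    obtain ⟨F', h1, h2, h3⟩ := exists_volterra_step hT hR hq hω hb hF hm
    exact ⟨⟨(F', q * m), h1, h2⟩, rfl, h3⟩
  choose step hstep1 hstep2 using hstep
  -- The iterates carry their norm bounds `M qⁿ` along; the solution is the sum of this dominated
  -- series.
  let p : ℕ → State := fun n => step^[n] ⟨(T, M), hT, hM⟩
  have hp : ∀ n, p (n + 1) = step (p n) := fun n => Function.iterate_succ_apply' _ _ _
  have hpm : ∀ n, (p n).1.2 = M * q ^ n := by
    intro n
    induction n with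
    | zero => simp [p]
    | succ n ih => rw [hp, hstep1, ih]; ring
  let F : ℕ → ℝ → E →L[ℂ] E := fun n => (p n).1.1
  have hF : ∀ n, IsStronglyContinuous (F n) := fun n => (p n).2.1
  have hFb : ∀ n t, ‖F n t‖ ≤ M * q ^ n * Real.exp (ω * max t 0) := fun n t => by
    rw [← hpm]; exact (p n).2.2 t
  have hF0 : F 0 = T := rfl
  have hFs : ∀ n t, 0 ≤ t → ∀ y,
      F (n + 1) t (R y) = ∫ s in (0 : ℝ)..t, F n (t - s) (Ψ (T s y)) := fun n t ht y => by
    change (p (n + 1)).1.1 t (R y) = _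
    rw [hp]
    exact hstep2 _ t ht y
  have hgeom : HasSum (fun n => q ^ n) (1 - q)⁻¹ := hasSum_geometric_of_lt_one hq hq1
  have hbound : ∀ e : ℝ, HasSum (fun n => M * q ^ n * e) (M * (1 - q)⁻¹ * e) := fun e =>
    (hgeom.mul_left M).mul_right e
  have hsum : ∀ t, HasSum (fun n => F n t) (∑' n, F n t) := fun t =>
    (Summable.of_norm_bounded (hbound _).summable (hFb · t)).hasSum
  have hsum' : ∀ t x, HasSum (fun n => F n t x) ((∑' n, F n t) x) := fun t x =>
    (hsum t).mapL (ContinuousLinearMap.apply ℂ E x)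
  refine ⟨fun t => ∑' n, F n t, fun x => ?_, ⟨M * (1 - q)⁻¹, fun t ht => ?_⟩, fun t ht y => ?_⟩
  · refine continuous_iff_continuousAt.2 fun t₀ => ?_
    have hon : ContinuousOn (fun t => ∑' n, F n t x) (Set.Iio (t₀ + 1)) := by
      refine continuousOn_tsum (fun n => (hF n x).continuousOn)
        (((hbound (Real.exp (ω * max (t₀ + 1) 0))).mul_right ‖x‖).summable) fun n t ht => ?_
      refine (F n t).le_of_opNorm_le ((hFb n t).trans ?_) x
      have := (Set.mem_Iio.1 ht).le
      gcongr
    refine (hon.continuousAt (Iio_mem_nhds (lt_add_one t₀))).congr ?_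
    exact Filter.Eventually.of_forall fun t => (hsum' t x).tsum_eq
  · refine tsum_of_norm_bounded (hbound _) fun n => ?_
    have := hFb n t
    rwa [max_eq_left ht] at this
  · have hcont : Continuous fun s => Ψ (T s y) := Ψ.continuous.comp (hT y)
    have hint : HasSum (fun n => ∫ s in (0 : ℝ)..t, F n (t - s) (Ψ (T s y)))
        (∫ s in (0 : ℝ)..t, (∑' n, F n (t - s)) (Ψ (T s y))) := by
      refine intervalIntegral.hasSum_integral_of_dominated_convergence
        (fun n s => M * q ^ n * (Real.exp (ω * t) * ‖Ψ (T s y)‖)) (fun n => ?_) (fun n => ?_)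
        (Filter.Eventually.of_forall fun s _ => (hbound _).summable) ?_
        (Filter.Eventually.of_forall fun s _ => hsum' _ _)
      · exact ((hF n).continuous_apply (by fun_prop) hcont).aestronglyMeasurable
      · refine Filter.Eventually.of_forall fun s hs => ?_
        rw [Set.uIoc_of_le ht] at hs
        refine ((F n (t - s)).le_of_opNorm_le (hFb n _) _).trans ?_
        rw [mul_assoc]
        have : max (t - s) 0 ≤ t := max_le (by linarith [hs.1]) ht
        gcongr
      · simp only [(hbound _).tsum_eq]
        exact (continuous_const.mul (continuous_const.mul hcont.norm)).intervalIntegrable _ _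
    have h1 : HasSum (fun n => F (n + 1) t (R y))
        (∫ s in (0 : ℝ)..t, (∑' n, F n (t - s)) (Ψ (T s y))) := by
      simpa only [hFs _ t ht] using hint
    have h2 := (hasSum_nat_add_iff' 1).2 (hsum' t (R y))
    simp only [Finset.range_one, Finset.sum_singleton, hF0] at h2
    exact (sub_eq_iff_eq_add'.1 (h1.unique h2).symm)

/-- **Miyadera's perturbation theorem**: the sum of the generator of `T` and of a Miyadera
perturbation generates a strongly continuous semigroup. -/
theorem exists_miyadera_perturbation (hT : IsExtendedSemigroup T) (hR : IsSemigroupResolvent T ν R)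
    (hq : 0 ≤ q) (hq1 : q < 1) (hω : 0 ≤ ω) {M : ℝ}
    (hM : ∀ t, ‖T t‖ ≤ M * Real.exp (ω * max t 0)) (hb : MiyaderaBound T R Ψ ω q) :
    ∃ U : ℝ → E →L[ℂ] E, IsExtendedSemigroup U ∧
      ∀ z w, OrbitDeriv U z w ↔ ∃ y, z = R y ∧ w = ν • R y - y + Ψ y := by
  have hRd := hR.denseRange hT
  have hM0 : 0 ≤ M := by
    have := (norm_nonneg _).trans (hM 0)
    simpa using this
  obtain ⟨U, hU, ⟨M', hM'⟩, hUeq⟩ := exists_volterra_solution hT.cont hRd hq hq1 hω hM hb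
  have hM'0 : 0 ≤ M' := by
    have := (norm_nonneg _).trans (hM' 0 le_rfl)
    simpa using this
  have hΨ : ∀ y, Continuous fun s => Ψ (T s y) := fun y => Ψ.continuous.comp (hT.cont y)
  have hUs : IsExtendedSemigroup U := by
    refine ⟨⟨?_, fun t s ht hs x => ?_, fun x => (hU x).continuousOn⟩, hU⟩
    · refine ContinuousLinearMap.ext fun x => ?_
      refine hRd.induction_on x (isClosed_eq (by fun_prop) (by fun_prop)) fun y => ?_
      rw [hUeq 0 le_rfl, hT.at_zero]
      simp
    -- For fixed `t`, the defect `U(t + s) - U(t) U(s)` solves the homogeneous Volterra equation in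
    -- `s`: the part of the integral over `[s, t + s]`, shifted, reproduces the equation at time `t`
    -- for `T(s) y`.
    · have hzero := eq_zero_of_volterra hT.cont hRd hq hq1 hb
        (Δ := fun s => U (t + s) - (U t).comp (U s))
        (m := M' * Real.exp (ω * t) + M' * Real.exp (ω * t) * M') (fun s hs => ?_)
        (fun s hs y => ?_) hs
      · exact sub_eq_zero.1 (DFunLike.congr_fun hzero x)
      · refine (norm_sub_le _ _).trans ?_
        rw [add_mul]
        refine add_le_add ((hM' _ (add_nonneg ht hs)).trans (le_of_eq ?_)) ?_
        · rw [mul_add, Real.exp_add, mul_assoc]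
        · refine (ContinuousLinearMap.opNorm_comp_le _ _).trans ?_
          rw [mul_assoc _ M']
          exact mul_le_mul (hM' t ht) (hM' s hs) (norm_nonneg _) (by positivity)
      · have hi : ∀ a b, IntervalIntegrable (fun r => U (t + s - r) (Ψ (T r y))) volume a b :=
          fun a b => (hU.continuous_apply (by fun_prop) (hΨ y)).intervalIntegrable a b
        have hi2 : IntervalIntegrable (fun r => U (s - r) (Ψ (T r y))) volume 0 s :=
          (hU.continuous_apply (by fun_prop) (hΨ y)).intervalIntegrable 0 s
        have hi3 : IntervalIntegrable (fun r => U t (U (s - r) (Ψ (T r y)))) volume 0 s :=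
          ((U t).continuous.comp
            (hU.continuous_apply (by fun_prop) (hΨ y))).intervalIntegrable 0 s
        have h1 : ∫ r in s..(t + s), U (t + s - r) (Ψ (T r y)) =
            ∫ r in (0 : ℝ)..t, U (t - r) (Ψ (T r (T s y))) := by
          have := intervalIntegral.integral_comp_add_right (a := 0) (b := t)
            (fun r => U (t + s - r) (Ψ (T r y))) s
          rw [zero_add] at this
          rw [← this]
          refine intervalIntegral.integral_congr fun r hr => ?_
          rw [Set.uIcc_of_le ht] at hr
          simp only [hT.semigroup r s hr.1 hs, add_sub_add_right_eq_sub]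
        have h2 := hUeq t ht (T s y)
        rw [hR.comm hT hs] at h2
        simp only [sub_apply, ContinuousLinearMap.comp_apply, ← add_sub_assoc]
        rw [intervalIntegral.integral_sub (hi 0 s) hi3,
          ContinuousLinearMap.intervalIntegral_comp_comm _ hi2, hUeq _ (add_nonneg ht hs),
          hUeq s hs, ← intervalIntegral.integral_add_adjacent_intervals (hi 0 s) (hi s (t + s)), h1,
          map_add, h2, hT.semigroup t s ht hs]
        abel
  have hfwd : ∀ y, OrbitDeriv U (R y) (ν • R y - y + Ψ y) := fun y => by
    -- The substitution `s = t r` turns `t⁻¹` times the convolution into an integral over a fixed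
    -- interval, continuous at `t = 0` with value `Ψ y`.
    have h1 : Continuous fun t : ℝ => ∫ r in (0 : ℝ)..1, U (t - t * r) (Ψ (T (t * r) y)) := by
      refine intervalIntegral.continuous_parametric_intervalIntegral_of_continuous'
        (f := fun t r => U (t - t * r) (Ψ (T (t * r) y))) ?_ 0 1
      refine hU.continuous_apply (by fun_prop) ((hΨ y).comp (by fun_prop))
    have h2 : Tendsto (fun t : ℝ => ∫ r in (0 : ℝ)..1, U (t - t * r) (Ψ (T (t * r) y)))
        (𝓝[>] 0) (𝓝 (Ψ y)) := by
      have := (h1.tendsto 0).mono_left (nhdsWithin_le_nhds (s := Set.Ioi 0))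
      simpa [hT.at_zero, hUs.at_zero] using this
    refine (Filter.Tendsto.add (hR.orbitDeriv y) h2).congr' ?_
    filter_upwards [self_mem_nhdsWithin] with t ht
    have h3 := intervalIntegral.smul_integral_comp_mul_left (a := 0) (b := 1)
      (fun s => U (t - s) (Ψ (T s y))) t
    rw [mul_zero, mul_one] at h3
    rw [hUeq t (le_of_lt ht), ← h3, add_sub_right_comm, smul_add, ← Complex.coe_smul, smul_smul,
      inv_mul_cancel₀ (Complex.ofReal_ne_zero.2 (ne_of_gt ht)), one_smul]
  refine ⟨U, hUs, fun z w => ⟨fun hzw => ?_, ?_⟩⟩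
  -- The generator of `U` extends the perturbed operator. Equality follows because, for a common
  -- large `μ`, `μ` minus the perturbed operator is already surjective while `μ` minus the generator
  -- is injective.
  · obtain ⟨ν₁, -, h1⟩ := hT.exists_resolvent
    obtain ⟨ν₂, -, h2⟩ := hUs.exists_resolvent
    set μ : ℝ := max (max ν₁ ν₂) ω + 1
    have hμω : ω < μ := (le_max_right _ _).trans_lt (lt_add_one _)
    obtain ⟨R', hR'⟩ := h1 μ (((le_max_left _ _).trans (le_max_left _ _)).trans_lt (lt_add_one _))
    obtain ⟨RU, hRU⟩ := h2 μ (((le_max_right _ _).trans (le_max_left _ _)).trans_lt (lt_add_one _))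
    -- By the resolvent identity `R J = R'`, so `Ψ J` represents the perturbation composed with the
    -- resolvent at `μ`.
    set J : E →L[ℂ] E := (ν - (μ : ℂ)) • R' + ContinuousLinearMap.id ℂ E
    have hJ : ∀ y, J y = (ν - (μ : ℂ)) • R' y + y := fun y => rfl
    have hRJ : ∀ y, R (J y) = R' y := fun y => by
      rw [← hR.left_inv _ _ (hR'.orbitDeriv y), hJ, sub_smul]
      congr 1
      abel
    have hs := hT.rescale μ
    have hQ : ‖Ψ.comp J‖ ≤ q := by
      refine norm_le_of_denseRange hRd hq fun y => ?_
      -- A truncated Laplace transform: the argument of `Ψ` equals `∫₀^τ e^{-μs} T(s) y ds`. The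
      -- term `e^{-μτ} T(τ) R y` vanishes as `τ → ∞` since `μ > ω`.
      have hfin : ∀ τ, 0 ≤ τ → ‖Ψ (J (R y - rescale μ T τ (R y)))‖ ≤ q * ‖R y‖ := fun τ hτ => by
        have h3 := (orbitDeriv_rescale hT _ _ _).1 (hs.orbitDeriv_integral (R y) hτ)
        have h4 := hR'.left_inv _ _ h3
        rw [sub_add_cancel_left, neg_sub, ← hRJ, strongIntegral_apply] at h4
        have h5 : ∀ s ∈ Set.uIcc 0 τ, rescale μ T s (R y) = R (rescale μ T s y) := fun s hs' => by
          rw [Set.uIcc_of_le hτ] at hs'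
          rw [rescale_apply, rescale_apply, map_smul, hR.comm hT hs'.1]
        rw [intervalIntegral.integral_congr h5, ContinuousLinearMap.intervalIntegral_comp_comm _
          (hs.cont.intervalIntegrable y 0 τ)] at h4
        rw [hR.injective h4, ← ContinuousLinearMap.intervalIntegral_comp_comm _
          (hs.cont.intervalIntegrable y 0 τ)]
        refine le_trans ?_ (hb τ hτ y)
        refine intervalIntegral.norm_integral_le_of_norm_le hτ ?_ ?_
        · refine Filter.Eventually.of_forall fun s hs' => ?_
          rw [rescale_apply, map_smul, norm_smul, Complex.norm_real,
            Real.norm_of_nonneg (Real.exp_pos _).le]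
          gcongr
          exact hs'.1.le
        · exact ((by fun_prop : Continuous fun s : ℝ => Real.exp (-(ω * s))).mul
            (hΨ y).norm).intervalIntegrable _ _
      have hlim : Tendsto (fun τ => rescale μ T τ (R y)) atTop (𝓝 0) := by
        have h6 : Tendsto (fun τ : ℝ => M * Real.exp (-((μ - ω) * τ)) * ‖R y‖) atTop (𝓝 0) := by
          have h7 : Tendsto (fun τ : ℝ => (μ - ω) * τ) atTop atTop :=
            tendsto_id.const_mul_atTop (sub_pos.2 hμω)
          simpa using ((Real.tendsto_exp_neg_atTop_nhds_zero.comp h7).const_mul M).mul_const ‖R y‖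
        refine squeeze_zero_norm' ?_ h6
        filter_upwards [eventually_ge_atTop 0] with τ hτ
        rw [rescale_apply, norm_smul, Complex.norm_real, Real.norm_of_nonneg (Real.exp_pos _).le]
        have h8 := (T τ).le_of_opNorm_le (hM τ) (R y)
        rw [max_eq_left hτ] at h8
        calc Real.exp (-(μ * τ)) * ‖T τ (R y)‖
            ≤ Real.exp (-(μ * τ)) * (M * Real.exp (ω * τ) * ‖R y‖) := by gcongr
          _ = M * Real.exp (-((μ - ω) * τ)) * ‖R y‖ := by
            rw [show -((μ - ω) * τ) = -(μ * τ) + ω * τ by ring, Real.exp_add]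
            ring
      have hlim2 : Tendsto (fun τ => ‖Ψ (J (R y - rescale μ T τ (R y)))‖) atTop
          (𝓝 ‖Ψ (J (R y - 0))‖) :=
        (((Ψ.comp J).continuous.tendsto _).comp (tendsto_const_nhds.sub hlim)).norm
      rw [sub_zero] at hlim2
      exact le_of_tendsto hlim2 (by filter_upwards [eventually_ge_atTop 0] using hfin)
    set u : (E →L[ℂ] E)ˣ := Units.oneSub (Ψ.comp J) (hQ.trans_lt hq1)
    obtain ⟨y', hy'⟩ : ∃ y', y' - Ψ (J y') = (μ : ℂ) • z - w := by
      refine ⟨(↑u⁻¹ : E →L[ℂ] E) ((μ : ℂ) • z - w), ?_⟩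
      have : (u : E →L[ℂ] E) ((↑u⁻¹ : E →L[ℂ] E) ((μ : ℂ) • z - w)) = (μ : ℂ) • z - w := by
        rw [← mul_apply_eq_comp, u.mul_inv, one_apply_eq_self]
      exact this
    have hf := hfwd (J y')
    have h9 := hRU.left_inv _ _ hf
    have h10 : (μ : ℂ) • R (J y') - (ν • R (J y') - J y' + Ψ (J y')) = (μ : ℂ) • z - w := by
      rw [← hy', hRJ, hJ, sub_smul]
      abel
    rw [h10, hRU.left_inv _ _ hzw] at h9
    refine ⟨J y', h9, ?_⟩
    rw [← h9] at hf
    rw [← h9]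
    exact hzw.unique hf
  · rintro ⟨y, rfl, rfl⟩
    exact hfwd y

end Miyadera

/-! ### Semigroups generated by reduction matrices -/

/-- The iterated integral runs over a triangle of area `t² / 2`, so this is the mean value of `φ`
over shrinking triangles. -/
theorem tendsto_double_integral {E : Type*} [NormedAddCommGroup E] [NormedSpace ℂ E]
    [CompleteSpace E] {φ : ℝ → E} (hφ : Continuous φ) :
    Tendsto (fun t : ℝ => (2 / (t : ℂ) ^ 2) • ∫ s in (0 : ℝ)..t, ∫ r in (0 : ℝ)..s, φ r)
      (𝓝[>] 0) (𝓝 (φ 0)) := by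
  rw [Metric.tendsto_nhdsWithin_nhds]
  intro ε hε
  obtain ⟨δ, hδ, h⟩ := Metric.continuous_iff.1 hφ 0 (ε / 4) (by positivity)
  refine ⟨δ, hδ, fun t ht htδ => ?_⟩
  have ht0 : 0 < t := ht
  rw [Real.dist_eq, sub_zero, abs_of_pos ht0] at htδ
  have hprim : Continuous fun s : ℝ => ∫ r in (0 : ℝ)..s, φ r :=
    intervalIntegral.continuous_primitive (fun a b => hφ.intervalIntegrable a b) 0
  have h1 : ∫ s in (0 : ℝ)..t, (∫ r in (0 : ℝ)..s, (φ r - φ 0)) =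
      (∫ s in (0 : ℝ)..t, ∫ r in (0 : ℝ)..s, φ r) - (t ^ 2 / 2 : ℝ) • φ 0 := by
    have h2 : ∀ s : ℝ, ∫ r in (0 : ℝ)..s, (φ r - φ 0) = (∫ r in (0 : ℝ)..s, φ r) - s • φ 0 := by
      intro s
      rw [intervalIntegral.integral_sub (hφ.intervalIntegrable _ _) intervalIntegrable_const,
        intervalIntegral.integral_const, sub_zero]
    simp only [h2]
    rw [intervalIntegral.integral_sub (hprim.intervalIntegrable _ _)
      (Continuous.intervalIntegrable (by fun_prop) _ _), intervalIntegral.integral_smul_const,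
      integral_id]
    simp
  have h3 : ‖∫ s in (0 : ℝ)..t, (∫ r in (0 : ℝ)..s, (φ r - φ 0))‖ ≤ ε / 4 * t * |t - 0| := by
    refine intervalIntegral.norm_integral_le_of_norm_le_const fun s hs => ?_
    rw [Set.uIoc_of_le ht0.le] at hs
    have h4 : ‖∫ r in (0 : ℝ)..s, (φ r - φ 0)‖ ≤ ε / 4 * |s - 0| := by
      refine intervalIntegral.norm_integral_le_of_norm_le_const fun r hr => ?_
      rw [Set.uIoc_of_le hs.1.le] at hr
      rw [← dist_eq_norm]
      refine (h r ?_).le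
      rw [Real.dist_eq, sub_zero, abs_of_pos hr.1]
      linarith [hr.2, hs.2]
    rw [sub_zero, abs_of_pos hs.1] at h4
    refine h4.trans ?_
    gcongr
    exact hs.2
  rw [sub_zero, abs_of_pos ht0] at h3
  have h5 : (2 / (t : ℂ) ^ 2) • (∫ s in (0 : ℝ)..t, ∫ r in (0 : ℝ)..s, φ r) - φ 0 =
      (2 / (t : ℂ) ^ 2) • ∫ s in (0 : ℝ)..t, (∫ r in (0 : ℝ)..s, (φ r - φ 0)) := by
    rw [h1, smul_sub, ← Complex.coe_smul, smul_smul]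
    have : (2 / (t : ℂ) ^ 2) * ((t ^ 2 / 2 : ℝ) : ℂ) = 1 := by
      have : (t : ℂ) ≠ 0 := Complex.ofReal_ne_zero.2 ht0.ne'
      push_cast
      field_simp
    rw [this, one_smul]
  rw [dist_eq_norm, h5, norm_smul, norm_div, norm_pow, Complex.norm_real,
    Real.norm_of_nonneg ht0.le, Complex.norm_two]
  calc 2 / t ^ 2 * ‖∫ s in (0 : ℝ)..t, (∫ r in (0 : ℝ)..s, (φ r - φ 0))‖
      ≤ 2 / t ^ 2 * (ε / 4 * t * t) := by gcongr
    _ = ε / 2 := by field_simp; ring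
    _ < ε := by linarith

section Reduction

variable {E : Type*} [NormedAddCommGroup E] [NormedSpace ℂ E]
  {F : Type*} [NormedAddCommGroup F] [NormedSpace ℂ F]

theorem mem_graph_reductionMatrix {K : E →ₗ.[ℂ] E} {j : F →L[ℂ] E} (hj : Function.Injective j)
    {f f' : F} {e e' : E} :
    ((f, e), (f', e')) ∈ (reductionMatrix K j hj).graph ↔ (j f, e') ∈ K.graph ∧ j f' = e := by
  rw [LinearPMap.mem_graph_iff, LinearPMap.mem_graph_iff]
  constructor
  · rintro ⟨z, hz1, hz2⟩
    obtain ⟨⟨f₀, e₀⟩, hf₀, he₀⟩ := z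
    simp only [Prod.mk.injEq] at hz1
    obtain ⟨rfl, rfl⟩ := hz1
    have h1 : (LinearEquiv.ofInjective (j : F →ₗ[ℂ] E) hj).symm ⟨e₀, he₀⟩ = f' :=
      congrArg Prod.fst hz2
    have h2 : K ⟨j f₀, hf₀⟩ = e' := congrArg Prod.snd hz2
    refine ⟨⟨⟨j f₀, hf₀⟩, rfl, h2⟩, ?_⟩
    rw [LinearEquiv.symm_apply_eq] at h1
    exact (congrArg Subtype.val h1).symm
  · rintro ⟨⟨u, hu1, hu2⟩, h⟩
    subst h
    have hf : j f ∈ K.domain := by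
      rw [← show (u : E) = j f from hu1]
      exact u.2
    have hu : u = ⟨j f, hf⟩ := Subtype.ext hu1
    refine ⟨⟨(f, j f'), hf, ⟨f', rfl⟩⟩, rfl, ?_⟩
    refine Prod.ext ?_ ?_
    · change (LinearEquiv.ofInjective (j : F →ₗ[ℂ] E) hj).symm ⟨j f', _⟩ = f'
      rw [LinearEquiv.symm_apply_eq]
      rfl
    · rw [hu] at hu2
      exact hu2

/-- `T` is the strongly continuous semigroup on `F × E` generated by `(0, I; K, 0)`. -/
structure IsReductionSemigroup (K : E →ₗ.[ℂ] E) (j : F →L[ℂ] E) (T : ℝ → (F × E) →L[ℂ] (F × E)) :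
    Prop extends IsExtendedSemigroup T where
  injective : Function.Injective j
  orbitDeriv_iff : ∀ f e f' e', OrbitDeriv T (f, e) (f', e') ↔ (j f, e') ∈ K.graph ∧ j f' = e

theorem IsKisynskiSpace.exists_reductionSemigroup {K : E →ₗ.[ℂ] E} {j : F →L[ℂ] E}
    (h : IsKisynskiSpace K j) : ∃ T, IsReductionSemigroup K j T := by
  obtain ⟨T, hT, hG⟩ := h.semigroup
  refine ⟨fun t => T (max t 0), hT.extend, h.injective, fun f e f' e' => ?_⟩
  rw [orbitDeriv_congr (T' := T) fun t ht => by rw [max_eq_left ht], OrbitDeriv, ← hG,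
    mem_graph_reductionMatrix]

/-- The reflection `(f, e) ↦ (-f, e)`, which turns the reduction matrix into its negative. -/
def reflection : (F × E) →L[ℂ] (F × E) :=
  (-ContinuousLinearMap.fst ℂ F E).prod (ContinuousLinearMap.snd ℂ F E)

theorem reflection_apply (z : F × E) : reflection z = (-z.1, z.2) :=
  rfl

theorem reflection_reflection (z : F × E) : reflection (reflection z) = z := by
  simp [reflection_apply]

/-- The cosine operator function `t ↦ pr₂ T(|t|) (0, ·)` given by the semigroup `T`. -/
def cosineOfSemigroup (T : ℝ → (F × E) →L[ℂ] (F × E)) (t : ℝ) : E →L[ℂ] E :=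
  (ContinuousLinearMap.snd ℂ F E).comp ((T |t|).comp (ContinuousLinearMap.inr ℂ F E))

theorem cosineOfSemigroup_apply (T : ℝ → (F × E) →L[ℂ] (F × E)) (t : ℝ) (x : E) :
    cosineOfSemigroup T t x = (T |t| (0, x)).2 :=
  rfl

namespace IsReductionSemigroup

variable {K : E →ₗ.[ℂ] E} {j : F →L[ℂ] E} {T : ℝ → (F × E) →L[ℂ] (F × E)}

theorem orbitDeriv_reflection (h : IsReductionSemigroup K j T) {z w : F × E}
    (hz : OrbitDeriv T z w) : OrbitDeriv T (reflection z) (-reflection w) := by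
  obtain ⟨f, e⟩ := z
  obtain ⟨f', e'⟩ := w
  rw [h.orbitDeriv_iff] at hz
  simp only [reflection_apply, Prod.neg_mk, neg_neg]
  rw [h.orbitDeriv_iff]
  refine ⟨?_, hz.2⟩
  rw [map_neg]
  exact K.graph.neg_mem hz.1

theorem graph_resolvent (h : IsReductionSemigroup K j T) {ν : ℂ} {R : (F × E) →L[ℂ] (F × E)}
    (hR : IsSemigroupResolvent T ν R) (g : E) :
    (j (R (0, g)).1, ν ^ 2 • j (R (0, g)).1 - g) ∈ K.graph ∧
      (R (0, g)).2 = ν • j (R (0, g)).1 := by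
  have h1 := hR.orbitDeriv (0, g)
  rcases hz : R (0, g) with ⟨f, e⟩
  rw [hz] at h1
  have h2 := (h.orbitDeriv_iff f e (ν • f - 0) (ν • e - g)).1 h1
  rw [sub_zero, map_smul] at h2
  refine ⟨?_, h2.2.symm⟩
  change (j f, ν ^ 2 • j f - g) ∈ _
  rw [pow_two, mul_smul, h2.2]
  exact h2.1

/-- Applying `ν - G` to `(f, ν f)` cancels the first component and leaves `(ν² - K) f` in the
second. The corner of `R` is thus the resolvent of `K` at `ν²`. -/
theorem resolvent_graph (h : IsReductionSemigroup K j T) {ν : ℂ} {R : (F × E) →L[ℂ] (F × E)}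
    (hR : IsSemigroupResolvent T ν R) {f : F} {y : E} (hf : (j f, y) ∈ K.graph) :
    (R (0, ν ^ 2 • j f - y)).1 = f := by
  have h1 := hR.left_inv (f, ν • j f) (ν • f, y) ((h.orbitDeriv_iff _ _ _ _).2 ⟨hf, by simp⟩)
  have h2 : ν • ((f, ν • j f) : F × E) - (ν • f, y) = (0, ν ^ 2 • j f - y) := by
    ext <;> simp [smul_smul, pow_two]
  rw [h2] at h1
  rw [h1]

theorem j_fst_apply_inl (h : IsReductionSemigroup K j T) {t : ℝ} (ht : 0 ≤ t) (f : F) :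
    j (T t (f, 0)).1 = (T t (0, j f)).2 := by
  have h1 : OrbitDeriv T (0, j f) (f, 0) :=
    (h.orbitDeriv_iff _ _ _ _).2 ⟨by rw [map_zero]; exact K.graph.zero_mem, rfl⟩
  have h2 := h.orbitDeriv_apply h1 ht
  exact ((h.orbitDeriv_iff (T t (0, j f)).1 (T t (0, j f)).2 (T t (f, 0)).1
    (T t (f, 0)).2).1 h2).2

variable [CompleteSpace E] [CompleteSpace F]

/-- With `ρ` the reflection, `ρ G = -G ρ`, so `s ↦ T(s) ρ T(s) ρ z` has zero derivative for `z` in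
the domain. In effect `ρ T(t) ρ` plays the role of `T(-t)`. -/
theorem apply_reflection_apply (h : IsReductionSemigroup K j T) {t : ℝ} (ht : 0 ≤ t) (z : F × E) :
    T t (reflection (T t (reflection z))) = z := by
  obtain ⟨ν₀, -, hν⟩ := h.exists_resolvent
  obtain ⟨R, hR⟩ := hν (ν₀ + 1) (lt_add_one _)
  refine (hR.denseRange h.toIsExtendedSemigroup).induction_on z
    (isClosed_eq (by fun_prop) continuous_id) fun y => ?_
  have hz := h.orbitDeriv_reflection (hR.orbitDeriv y)
  generalize -reflection ((((ν₀ + 1 : ℝ) : ℂ)) • R y - y) = w at hz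
  generalize R y = z at hz ⊢
  have hcont : Continuous fun s => T s (reflection (T s (reflection z))) :=
    h.cont.continuous_apply continuous_id (reflection.continuous.comp (h.cont _))
  have hconst := constant_of_has_deriv_right_zero (a := 0) (b := t) hcont.continuousOn
    (fun s hs => ?_) t (Set.right_mem_Icc.2 ht)
  · simp only [h.zero_apply, reflection_reflection] at hconst
    exact hconst
  · refine hasDerivWithinAt_Ioi_iff_Ici.1 ?_
    have h1 := ((reflection (E := E) (F := F)).restrictScalars ℝ).hasFDerivAt.comp_hasDerivWithinAt s
      (h.hasDerivWithinAt hz hs.1)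
    have h2 : HasDerivWithinAt (fun r => T r (reflection (T s (reflection z))))
        (T s (-reflection (T s w))) (Set.Ioi s) s :=
      h.hasDerivWithinAt (h.orbitDeriv_reflection (h.orbitDeriv_apply hz hs.1)) hs.1
    refine (h.cont.hasDerivWithinAt_apply h1 h2).congr_deriv ?_
    simp

/-- Adding the reflection of `T(r)(0, x)` cancels its first component and doubles the second.
Applying `T(p)` to the reflected vector moves time backwards by `r`, up to a reflection that does
not affect second components. -/
theorem cosine_add_abs_sub (h : IsReductionSemigroup K j T) {p r : ℝ} (hp : 0 ≤ p) (hr : 0 ≤ r)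
    (x : E) : (T (p + r) (0, x)).2 + (T |p - r| (0, x)).2 = (2 : ℂ) • (T p (0, (T r (0, x)).2)).2 := by
  have h0 : reflection ((0, x) : F × E) = (0, x) := by simp [reflection_apply]
  have h1 : T r (0, x) + reflection (T r (0, x)) = (2 : ℂ) • (0, (T r (0, x)).2) := by
    ext <;> simp [reflection_apply, two_smul]
  have h2 : (T |p - r| (0, x)).2 = (T p (reflection (T r (0, x)))).2 := by
    rcases le_total r p with hrp | hrp
    · have h3 : ∀ z, T p z = T (p - r) (T r z) := fun z => by
        rw [← h.semigroup _ _ (sub_nonneg.2 hrp) hr, sub_add_cancel]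
      have h4 := h.apply_reflection_apply hr (0, x)
      rw [h0] at h4
      rw [abs_of_nonneg (sub_nonneg.2 hrp), h3, h4]
    · have h3 : T r (0, x) = T p (T (r - p) (0, x)) := by
        rw [← h.semigroup _ _ hp (sub_nonneg.2 hrp), add_sub_cancel]
      have h4 := h.apply_reflection_apply hp (reflection (T (r - p) (0, x)))
      rw [reflection_reflection] at h4
      rw [abs_sub_comm, abs_of_nonneg (sub_nonneg.2 hrp), h3, h4]
      rfl
  rw [h2, h.semigroup p r hp hr, ← Prod.snd_add, ← map_add, h1, map_smul]
  rfl

theorem isCosineFunction (h : IsReductionSemigroup K j T) :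
    IsCosineFunction (cosineOfSemigroup T) where
  strongly_continuous x := continuous_snd.comp ((h.cont (0, x)).comp continuous_abs)
  at_zero := by ext x; simp [cosineOfSemigroup_apply, h.zero_apply]
  dAlembert t s x := by
    have key := h.cosine_add_abs_sub (abs_nonneg t) (abs_nonneg s) x
    simp only [cosineOfSemigroup_apply]
    rw [← key]
    rcases le_total 0 t with ht | ht <;> rcases le_total 0 s with hs | hs
    · rw [abs_of_nonneg ht, abs_of_nonneg hs, abs_of_nonneg (add_nonneg ht hs)]
    · rw [abs_of_nonneg ht, abs_of_nonpos hs, abs_of_nonneg (by linarith : 0 ≤ t - s), add_comm,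
        sub_neg_eq_add, ← sub_eq_add_neg]
    · rw [abs_of_nonpos ht, abs_of_nonneg hs, abs_of_nonpos (by linarith : t - s ≤ 0), add_comm,
        neg_sub, ← abs_neg (t + s), neg_add', neg_add_eq_sub]
    · rw [abs_of_nonpos ht, abs_of_nonpos hs, abs_of_nonpos (by linarith : t + s ≤ 0),
        ← abs_neg (t - s), neg_sub_neg, neg_add, neg_sub]

theorem j_fst_apply (h : IsReductionSemigroup K j T) {t : ℝ} (ht : 0 ≤ t) (x : E) :
    j (T t (0, x)).1 = ∫ s in (0 : ℝ)..t, (T s (0, x)).2 := by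
  have h1 := h.orbitDeriv_integral (0, x) ht
  have h2 := ((h.orbitDeriv_iff (strongIntegral T h.cont 0 t (0, x)).1
    (strongIntegral T h.cont 0 t (0, x)).2 (T t (0, x) - (0, x)).1 (T t (0, x) - (0, x)).2).1 h1).2
  rw [Prod.fst_sub, sub_zero, strongIntegral_apply] at h2
  rw [h2]
  exact ((ContinuousLinearMap.snd ℂ F E).intervalIntegral_comp_comm
    (h.cont.intervalIntegrable (0, x) 0 t)).symm

theorem graph_integral (h : IsReductionSemigroup K j T) {t : ℝ} (ht : 0 ≤ t) (x : E) :
    (∫ s in (0 : ℝ)..t, ∫ r in (0 : ℝ)..s, (T r (0, x)).2, (T t (0, x)).2 - x) ∈ K.graph := by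
  have h1 := h.orbitDeriv_integral (0, x) ht
  have h2 := ((h.orbitDeriv_iff (strongIntegral T h.cont 0 t (0, x)).1
    (strongIntegral T h.cont 0 t (0, x)).2 (T t (0, x) - (0, x)).1 (T t (0, x) - (0, x)).2).1 h1).1
  rw [Prod.snd_sub] at h2
  convert h2 using 2
  rw [strongIntegral_apply]
  have h3 := (j.comp (ContinuousLinearMap.fst ℂ F E)).intervalIntegral_comp_comm
    (h.cont.intervalIntegrable (0, x) 0 t)
  refine Eq.trans ?_ h3
  refine intervalIntegral.integral_congr fun s hs => ?_
  rw [Set.uIcc_of_le ht] at hs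
  exact (h.j_fst_apply hs.1 x).symm

theorem apply_inl_sub (h : IsReductionSemigroup K j T) {f : F} {y : E} (hf : (j f, y) ∈ K.graph)
    {t : ℝ} (ht : 0 ≤ t) :
    T t (f, 0) - (f, 0) = ∫ s in (0 : ℝ)..t, T s (0, y) :=
  h.apply_sub_eq_integral ((h.orbitDeriv_iff _ _ _ _).2 ⟨hf, map_zero j⟩) ht

theorem cosine_sub_self (h : IsReductionSemigroup K j T) {f : F} {y : E}
    (hf : (j f, y) ∈ K.graph) {t : ℝ} (ht : 0 ≤ t) :
    (T t (0, j f)).2 - j f = ∫ s in (0 : ℝ)..t, ∫ r in (0 : ℝ)..s, (T r (0, y)).2 := by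
  have h1 := congrArg (j.comp (ContinuousLinearMap.fst ℂ F E)) (h.apply_inl_sub hf ht)
  rw [← ContinuousLinearMap.intervalIntegral_comp_comm _
    (h.cont.intervalIntegrable (0, y) 0 t)] at h1
  rw [← h.j_fst_apply_inl ht, ← map_sub]
  refine Eq.trans h1 (intervalIntegral.integral_congr fun s hs => ?_)
  rw [Set.uIcc_of_le ht] at hs
  exact h.j_fst_apply hs.1 y

/-- If `(0, I; K, 0)` generates a semigroup, then `K` generates a cosine operator function. -/
theorem isCosineGenerator (h : IsReductionSemigroup K j T)
    (hdom : ∀ u : K.domain, ∃ v : F, j v = u) : IsCosineGenerator (cosineOfSemigroup T) K := by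
  have hev := h.isCosineFunction.even
  have hcont : ∀ x, Continuous fun t => (T t (0, x)).2 := fun x =>
    continuous_snd.comp (h.cont (0, x))
  have hsym : ∀ x y, Tendsto (fun t : ℝ => (2 / (t : ℂ) ^ 2) • (cosineOfSemigroup T t x - x))
      (𝓝[>] 0) (𝓝 y) → Tendsto (fun t : ℝ => (2 / (t : ℂ) ^ 2) • (cosineOfSemigroup T t x - x))
      (𝓝[≠] 0) (𝓝 y) := by
    intro x y hxy
    rw [← Set.Iio_union_Ioi, nhdsWithin_union, tendsto_sup]
    refine ⟨?_, hxy⟩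
    have hneg : Tendsto (fun t : ℝ => -t) (𝓝[<] 0) (𝓝[>] 0) := by
      have := tendsto_neg_nhdsLT (a := (0 : ℝ))
      rwa [neg_zero] at this
    refine (hxy.comp hneg).congr fun t => ?_
    simp [hev]
  intro x y
  constructor
  · intro hxy
    obtain ⟨f, rfl⟩ : ∃ f, j f = x := by
      obtain ⟨u, hu, -⟩ := (LinearPMap.mem_graph_iff _).1 hxy
      obtain ⟨f, hf⟩ := hdom u
      exact ⟨f, hf.trans hu⟩
    refine hsym _ _ ?_
    have hlim := tendsto_double_integral (hcont y)
    rw [h.zero_apply] at hlim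
    refine hlim.congr' ?_
    filter_upwards [self_mem_nhdsWithin] with t ht
    rw [cosineOfSemigroup_apply, abs_of_pos ht, h.cosine_sub_self hxy (le_of_lt ht)]
  · intro hxy
    replace hxy := hxy.mono_left (nhdsWithin_mono 0 fun t (ht : 0 < t) => ht.ne')
    obtain ⟨ν₀, -, hν⟩ := h.exists_resolvent
    obtain ⟨R, hR⟩ := hν (ν₀ + 1) (lt_add_one _)
    set ν : ℂ := ((ν₀ + 1 : ℝ) : ℂ)
    have hlim := tendsto_double_integral (hcont x)
    rw [h.zero_apply] at hlim
    set S : E →L[ℂ] E := j.comp ((ContinuousLinearMap.fst ℂ F E).comp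
      (R.comp (ContinuousLinearMap.inr ℂ F E)))
    have hS : ∀ g, S g = j (R (0, g)).1 := fun g => rfl
    -- A closedness argument through the resolvent `S` of `K` at `ν²`: the scaled double integrals
    -- tend to `x`, lie in `D(K)`, and are mapped by `K` to the difference quotients, which tend to
    -- `y`.
    have h1 := (S.continuous.tendsto _).comp ((hlim.const_smul (ν ^ 2)).sub hxy)
    have h2 : S (ν ^ 2 • x - y) = x := by
      refine tendsto_nhds_unique h1 (hlim.congr' ?_)
      filter_upwards [self_mem_nhdsWithin] with t ht
      have h3 := h.graph_integral (le_of_lt ht) x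
      have h4 := K.graph.smul_mem (2 / (t : ℂ) ^ 2) h3
      obtain ⟨u, hu, -⟩ := (LinearPMap.mem_graph_iff _).1 h4
      obtain ⟨f, hf⟩ := hdom u
      have h5 : j f = (2 / (t : ℂ) ^ 2) • ∫ s in (0 : ℝ)..t, ∫ r in (0 : ℝ)..s, (T r (0, x)).2 :=
        hf.trans hu
      rw [Prod.smul_mk, ← h5] at h4
      have h6 := h.resolvent_graph hR h4
      rw [Function.comp_apply, cosineOfSemigroup_apply, abs_of_pos ht, ← h5, hS, h6]
    have h7 := (h.graph_resolvent hR (ν ^ 2 • x - y)).1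
    rw [← hS, h2, sub_sub_cancel] at h7
    exact h7

end IsReductionSemigroup

theorem IsKisynskiSpace.generatesCosine [CompleteSpace E] {K : E →ₗ.[ℂ] E} {j : F →L[ℂ] E}
    (h : IsKisynskiSpace K j) : GeneratesCosineWithPhaseSpace K j := by
  have := h.complete
  obtain ⟨T, hT⟩ := h.exists_reductionSemigroup
  exact ⟨⟨_, hT.isCosineFunction, hT.isCosineGenerator h.domain_le⟩, h⟩

end Reduction

/-! ### Cosine and sine operator functions -/

section Cosine

variable {E : Type*} [NormedAddCommGroup E] [NormedSpace ℂ E]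

theorem integral_symm_add {φ : ℝ → E} (hφ : Continuous φ) (t τ : ℝ) :
    ∫ s in (0 : ℝ)..τ, (φ (t + s) + φ (t - s)) =
      (∫ s in (0 : ℝ)..(t + τ), φ s) - ∫ s in (0 : ℝ)..(t - τ), φ s := by
  rw [intervalIntegral.integral_add (Continuous.intervalIntegrable (by fun_prop) _ _)
    (Continuous.intervalIntegrable (by fun_prop) _ _),
    intervalIntegral.integral_comp_add_left, intervalIntegral.integral_comp_sub_left, add_zero,
    sub_zero, intervalIntegral.integral_interval_sub_left (hφ.intervalIntegrable _ _)
    (hφ.intervalIntegrable _ _), add_comm,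
    intervalIntegral.integral_add_adjacent_intervals (hφ.intervalIntegrable _ _)
    (hφ.intervalIntegrable _ _)]

theorem integral_symm_sub {φ : ℝ → E} (hφ : Continuous φ) (t τ : ℝ) :
    ∫ s in (0 : ℝ)..τ, (φ (t + s) - φ (t - s)) =
      (∫ s in (0 : ℝ)..(t + τ), φ s) + (∫ s in (0 : ℝ)..(t - τ), φ s) -
        (2 : ℂ) • ∫ s in (0 : ℝ)..t, φ s := by
  rw [intervalIntegral.integral_sub (Continuous.intervalIntegrable (by fun_prop) _ _)
    (Continuous.intervalIntegrable (by fun_prop) _ _),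
    intervalIntegral.integral_comp_add_left, intervalIntegral.integral_comp_sub_left, add_zero,
    sub_zero, ← intervalIntegral.integral_interval_sub_left (hφ.intervalIntegrable 0 (t + τ))
    (hφ.intervalIntegrable _ _), ← intervalIntegral.integral_interval_sub_left
    (hφ.intervalIntegrable 0 t) (hφ.intervalIntegrable 0 (t - τ)), two_smul]
  abel

theorem integral_zero_neg_of_odd {φ : ℝ → E} (h : ∀ t, φ (-t) = -φ t) (t : ℝ) :
    ∫ s in (0 : ℝ)..(-t), φ s = ∫ s in (0 : ℝ)..t, φ s := by
  have h1 := intervalIntegral.integral_comp_neg (a := 0) (b := -t) (fun s => φ s)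
  simp only [h, neg_neg, neg_zero, intervalIntegral.integral_neg] at h1
  rw [intervalIntegral.integral_symm 0 t, neg_inj] at h1
  exact h1

theorem integral_zero_neg_of_even {φ : ℝ → E} (h : ∀ t, φ (-t) = φ t) (t : ℝ) :
    ∫ s in (0 : ℝ)..(-t), φ s = -∫ s in (0 : ℝ)..t, φ s := by
  have h1 := intervalIntegral.integral_comp_neg (a := 0) (b := -t) (fun s => φ s)
  simp only [h, neg_neg, neg_zero] at h1
  rw [h1, intervalIntegral.integral_symm]

variable [CompleteSpace E] {C : ℝ → E →L[ℂ] E}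

/-- The sine operator function as a family of bounded operators. -/
def sineOp (hC : IsCosineFunction C) (t : ℝ) : E →L[ℂ] E :=
  strongIntegral C hC.strongly_continuous 0 t

namespace IsCosineFunction

omit [CompleteSpace E] in
theorem isStronglyContinuous (hC : IsCosineFunction C) : IsStronglyContinuous C :=
  hC.strongly_continuous

theorem sineOp_apply (hC : IsCosineFunction C) (t : ℝ) (x : E) :
    sineOp hC t x = ∫ s in (0 : ℝ)..t, C s x :=
  rfl

theorem isStronglyContinuous_sineOp (hC : IsCosineFunction C) : IsStronglyContinuous (sineOp hC) :=
  isStronglyContinuous_strongIntegral hC.isStronglyContinuous 0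

/-- The iterated integral of the cosine operator function. -/
def _root_.SecondOrder.sineIntegral (hC : IsCosineFunction C) (t : ℝ) : E →L[ℂ] E :=
  strongIntegral (sineOp hC) hC.isStronglyContinuous_sineOp 0 t

theorem sineIntegral_apply (hC : IsCosineFunction C) (t : ℝ) (x : E) :
    sineIntegral hC t x = ∫ s in (0 : ℝ)..t, sineOp hC s x :=
  rfl

theorem sineOp_neg (hC : IsCosineFunction C) (t : ℝ) (x : E) :
    sineOp hC (-t) x = -sineOp hC t x :=
  integral_zero_neg_of_even (fun s => hC.even s x) t

theorem sineIntegral_neg (hC : IsCosineFunction C) (t : ℝ) (x : E) :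
    sineIntegral hC (-t) x = sineIntegral hC t x :=
  integral_zero_neg_of_odd (fun s => hC.sineOp_neg s x) t

theorem apply_sineOp (hC : IsCosineFunction C) (t τ : ℝ) (x : E) :
    (2 : ℂ) • C t (sineOp hC τ x) = sineOp hC (t + τ) x - sineOp hC (t - τ) x := by
  rw [sineOp_apply, sineOp_apply, sineOp_apply, ← integral_symm_add (hC.strongly_continuous x),
    ← ContinuousLinearMap.intervalIntegral_comp_comm _
      (hC.isStronglyContinuous.intervalIntegrable x 0 τ), ← intervalIntegral.integral_smul]
  simp only [hC.dAlembert]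

theorem sineOp_comm (hC : IsCosineFunction C) (t τ : ℝ) (x : E) :
    C t (sineOp hC τ x) = sineOp hC τ (C t x) := by
  rw [sineOp_apply, sineOp_apply, ← ContinuousLinearMap.intervalIntegral_comp_comm _
      (hC.isStronglyContinuous.intervalIntegrable x 0 τ)]
  simp only [hC.comm t]

theorem sineIntegral_comm (hC : IsCosineFunction C) (t τ : ℝ) (x : E) :
    C t (sineIntegral hC τ x) = sineIntegral hC τ (C t x) := by
  rw [sineIntegral_apply, sineIntegral_apply, ← ContinuousLinearMap.intervalIntegral_comp_comm _
      (hC.isStronglyContinuous_sineOp.intervalIntegrable x 0 τ)]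
  simp only [hC.sineOp_comm t]

theorem apply_sineIntegral (hC : IsCosineFunction C) (t τ : ℝ) (x : E) :
    (2 : ℂ) • C t (sineIntegral hC τ x) =
      sineIntegral hC (t + τ) x + sineIntegral hC (t - τ) x - (2 : ℂ) • sineIntegral hC t x := by
  rw [sineIntegral_apply, sineIntegral_apply, sineIntegral_apply, sineIntegral_apply,
    ← integral_symm_sub (hC.isStronglyContinuous_sineOp x),
    ← ContinuousLinearMap.intervalIntegral_comp_comm _
      (hC.isStronglyContinuous_sineOp.intervalIntegrable x 0 τ), ← intervalIntegral.integral_smul]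
  simp only [hC.apply_sineOp]

/-- Both sides have half the value `W(t + τ) + W(t - τ) - 2 W(t) - 2 W(τ)`, with `W` the even double
integral of `C`. Dividing by `τ² / 2` and letting `τ → 0` gives the integrated form of `C'' = K C`.
-/
theorem sineIntegral_symm (hC : IsCosineFunction C) (t τ : ℝ) (x : E) :
    C t (sineIntegral hC τ x) - sineIntegral hC τ x =
      C τ (sineIntegral hC t x) - sineIntegral hC t x := by
  have h1 := hC.apply_sineIntegral t τ x
  have h2 := hC.apply_sineIntegral τ t x
  rw [← neg_sub t τ, hC.sineIntegral_neg, add_comm τ t] at h2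
  refine smul_right_injective E (two_ne_zero : (2 : ℂ) ≠ 0) ?_
  simp only [smul_sub, h1, h2]
  abel

theorem two_sineOp_sineOp (hC : IsCosineFunction C) (a : ℝ) (x : E) :
    (2 : ℂ) • sineOp hC a (sineOp hC a x) = sineIntegral hC (2 * a) x := by
  have h1 := integral_symm_add (hC.isStronglyContinuous_sineOp x) a a
  rw [sub_self, intervalIntegral.integral_same, sub_zero, ← two_mul] at h1
  rw [sineIntegral_apply, ← h1, sineOp_apply, ← intervalIntegral.integral_smul]
  refine intervalIntegral.integral_congr fun s _ => ?_
  simp only [hC.apply_sineOp]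
  rw [← neg_sub a s, hC.sineOp_neg, sub_neg_eq_add, add_comm s a]

theorem apply_sub_eq_sineIntegral (hC : IsCosineFunction C) {K : E →ₗ.[ℂ] E}
    (hK : IsCosineGenerator C K) {x y : E} (hxy : (x, y) ∈ K.graph) (t : ℝ) :
    C t x - x = sineIntegral hC t y := by
  have h1 := ((hK x y).1 hxy).mono_left (nhdsWithin_mono 0 fun t (ht : 0 < t) => ht.ne')
  have h2 := ((sineIntegral hC t).continuous.tendsto y).comp h1
  have h3 := tendsto_double_integral (hC.strongly_continuous x)
  rw [hC.at_zero, ContinuousLinearMap.id_apply] at h3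
  have h4 := (((C t).continuous.tendsto x).comp h3).sub h3
  refine tendsto_nhds_unique h4 (h2.congr fun τ => ?_)
  have h5 := hC.sineIntegral_symm t τ x
  have h6 : ∫ s in (0 : ℝ)..τ, ∫ r in (0 : ℝ)..s, C r x = sineIntegral hC τ x := rfl
  simp only [Function.comp_apply, h6, map_smul, map_sub, ← smul_sub]
  rw [h5, hC.sineIntegral_comm]

omit [CompleteSpace E] in
theorem apply_mem_graph (hC : IsCosineFunction C) {K : E →ₗ.[ℂ] E} (hK : IsCosineGenerator C K)
    {x y : E} (hxy : (x, y) ∈ K.graph) (t : ℝ) : (C t x, C t y) ∈ K.graph := by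
  rw [hK]
  refine (((C t).continuous.tendsto y).comp ((hK x y).1 hxy)).congr fun s => ?_
  simp [hC.comm t]

theorem hasDerivAt_sineOp (hC : IsCosineFunction C) (t : ℝ) (x : E) :
    HasDerivAt (fun s => sineOp hC s x) (C t x) t :=
  hasDerivAt_strongIntegral hC.isStronglyContinuous 0 t x

theorem hasDerivAt_apply (hC : IsCosineFunction C) {K : E →ₗ.[ℂ] E} (hK : IsCosineGenerator C K)
    {x y : E} (hxy : (x, y) ∈ K.graph) (t : ℝ) :
    HasDerivAt (fun s => C s x) (sineOp hC t y) t := by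
  refine ((hasDerivAt_strongIntegral hC.isStronglyContinuous_sineOp 0 t y).add_const x).congr_of_eventuallyEq
    (Filter.Eventually.of_forall fun s => ?_)
  exact sub_eq_iff_eq_add.1 (hC.apply_sub_eq_sineIntegral hK hxy s)

end IsCosineFunction

/-! ### The semigroup of the reduction matrix in terms of the cosine operator function -/

section Link

variable {F : Type*} [NormedAddCommGroup F] [NormedSpace ℂ F] [CompleteSpace F]
  {K : E →ₗ.[ℂ] E} {j : F →L[ℂ] E} {T : ℝ → (F × E) →L[ℂ] (F × E)}

/-- This ties the semigroup of the phase space to the given cosine function. For `(u, v) = T(s) z`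
with `z` in the domain, `C(t - s) u + S(t - s) v` is constant in `s`; its endpoint values are the
two sides. -/
theorem IsReductionSemigroup.j_fst_eq (hT : IsReductionSemigroup K j T) (hC : IsCosineFunction C)
    (hK : IsCosineGenerator C K) {t : ℝ} (ht : 0 ≤ t) (z : F × E) :
    j (T t z).1 = C t (j z.1) + sineOp hC t z.2 := by
  obtain ⟨ν₀, -, hν⟩ := hT.exists_resolvent
  obtain ⟨R, hR⟩ := hν (ν₀ + 1) (lt_add_one _)
  refine (hR.denseRange hT.toIsExtendedSemigroup).induction_on z
    (isClosed_eq (by fun_prop) (by fun_prop)) fun y => ?_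
  have hz := hR.orbitDeriv y
  generalize (((ν₀ + 1 : ℝ) : ℂ)) • R y - y = w at hz
  generalize R y = z at hz ⊢
  set Φ : ℝ → E := fun s => C (t - s) (j (T s z).1) + sineOp hC (t - s) (T s z).2
  have hCt : IsStronglyContinuous fun s => C (t - s) := fun x =>
    (hC.strongly_continuous x).comp (by fun_prop)
  have hSt : IsStronglyContinuous fun s => sineOp hC (t - s) := fun x =>
    (hC.isStronglyContinuous_sineOp x).comp (by fun_prop)
  have hcont : Continuous Φ :=
    (hCt.continuous_apply continuous_id (j.continuous.comp (hT.cont z).fst)).add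
      (hSt.continuous_apply continuous_id (hT.cont z).snd)
  have hconst := constant_of_has_deriv_right_zero (a := 0) (b := t) hcont.continuousOn
    (fun s hs => ?_) t (Set.right_mem_Icc.2 ht)
  · simpa [Φ, hT.zero_apply, hC.at_zero, IsCosineFunction.sineOp_apply] using hconst
  · refine hasDerivWithinAt_Ioi_iff_Ici.1 ?_
    have h0 := hT.hasDerivWithinAt hz hs.1
    have hg : (j (T s z).1, (T s w).2) ∈ K.graph ∧ j (T s w).1 = (T s z).2 :=
      (hT.orbitDeriv_iff (T s z).1 (T s z).2 (T s w).1 (T s w).2).1 (hT.orbitDeriv_apply hz hs.1)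
    have hu := ((j.comp (ContinuousLinearMap.fst ℂ F E)).restrictScalars
      ℝ).hasFDerivAt.comp_hasDerivWithinAt s h0
    have hv := ((ContinuousLinearMap.snd ℂ F E).restrictScalars
      ℝ).hasFDerivAt.comp_hasDerivWithinAt s h0
    have h1 : HasDerivWithinAt (fun r => C (t - r) (j (T s z).1)) (-sineOp hC (t - s) (T s w).2)
        (Set.Ioi s) s :=
      ((hC.hasDerivAt_apply hK hg.1 (t - s)).comp_const_sub t s).hasDerivWithinAt
    have h2 : HasDerivWithinAt (fun r => sineOp hC (t - r) (T s z).2) (-C (t - s) (T s z).2)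
        (Set.Ioi s) s :=
      ((hC.hasDerivAt_sineOp (t - s) (T s z).2).comp_const_sub t s).hasDerivWithinAt
    refine ((hCt.hasDerivWithinAt_apply hu h1).add
      (hSt.hasDerivWithinAt_apply hv h2)).congr_deriv ?_
    change -sineOp hC (t - s) (T s w).2 + C (t - s) (j (T s w).1) +
      (-C (t - s) (T s z).2 + sineOp hC (t - s) (T s w).2) = 0
    rw [hg.2]
    abel

end Link

end Cosine

/-! ### Integral estimates for the semigroup of the reduction matrix -/

section Estimate

variable {E : Type*} [NormedAddCommGroup E] [NormedSpace ℂ E]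
  {F : Type*} [NormedAddCommGroup F] [NormedSpace ℂ F]
  {G : Type*} [NormedAddCommGroup G] [NormedSpace ℂ G]
  {K : E →ₗ.[ℂ] E} {j : F →L[ℂ] E} {T : ℝ → (F × E) →L[ℂ] (F × E)} {C : ℝ → E →L[ℂ] E}
  {ν : ℂ} {R : (F × E) →L[ℂ] (F × E)} {Ψ : E →L[ℂ] G} {M : ℝ}

/-- The operator `g ↦ pr₁ R (0, g)`; for the resolvent `R` at `ν` of the reduction matrix of `K`,
it is the resolvent of `K` at `ν²`, as an operator with values in `F`. -/
def resolventFst (R : (F × E) →L[ℂ] (F × E)) : E →L[ℂ] F :=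
  (ContinuousLinearMap.fst ℂ F E).comp (R.comp (ContinuousLinearMap.inr ℂ F E))

theorem IsReductionSemigroup.resolventFst_mem_graph (hT : IsReductionSemigroup K j T)
    (hR : IsSemigroupResolvent T ν R) (g : E) :
    (j (resolventFst R g), ν ^ 2 • j (resolventFst R g) - g) ∈ K.graph :=
  (hT.graph_resolvent hR g).1

theorem IsReductionSemigroup.resolventFst_apply (hT : IsReductionSemigroup K j T)
    (hdom : ∀ u : K.domain, ∃ v : F, j v = u)
    (hR : IsSemigroupResolvent T ν R) {x y : E} (h : (x, y) ∈ K.graph) :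
    j (resolventFst R (ν ^ 2 • x - y)) = x := by
  obtain ⟨u, hu, -⟩ := (LinearPMap.mem_graph_iff _).1 h
  obtain ⟨f, hf⟩ := hdom u
  obtain rfl : j f = x := hf.trans hu
  exact congrArg j (hT.resolvent_graph hR h)

theorem resolventFst_cosine (hT : IsReductionSemigroup K j T)
    (hdom : ∀ u : K.domain, ∃ v : F, j v = u) (hR : IsSemigroupResolvent T ν R)
    (hC : IsCosineFunction C) (hK : IsCosineGenerator C K) (t : ℝ) (y : E) :
    j (resolventFst R (C t y)) = C t (j (resolventFst R y)) := by
  have h := hT.resolventFst_apply hdom hR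
    (hC.apply_mem_graph hK (hT.resolventFst_mem_graph hR y) t)
  rwa [map_sub (C t), map_smul (C t), sub_sub_cancel] at h

variable [CompleteSpace E]

theorem resolventFst_sine (hT : IsReductionSemigroup K j T)
    (hdom : ∀ u : K.domain, ∃ v : F, j v = u) (hR : IsSemigroupResolvent T ν R)
    (hC : IsCosineFunction C) (hK : IsCosineGenerator C K) (t : ℝ) (y : E) :
    j (resolventFst R (sineOp hC t y)) = sineOp hC t (j (resolventFst R y)) := by
  have h := (j.comp (resolventFst R)).intervalIntegral_comp_comm
    (hC.isStronglyContinuous.intervalIntegrable y 0 t)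
  rw [hC.sineOp_apply, hC.sineOp_apply]
  refine h.symm.trans (intervalIntegral.integral_congr fun s _ => ?_)
  exact resolventFst_cosine hT hdom hR hC hK s y

/-- Apply `C(t)` to `C(2a) y - y = 2 S(a)² K y` and use d'Alembert's equation together with `2 C(t)
S(a) = S(t + a) - S(t - a)`. -/
theorem cosine_eq_add_sub (hC : IsCosineFunction C) (hK : IsCosineGenerator C K) {y y₁ : E}
    (hy : (y, y₁) ∈ K.graph) (t a : ℝ) :
    C t y = (2 : ℂ)⁻¹ • (C (t + 2 * a) y + C (t - 2 * a) y) -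
      (sineOp hC (t + a) (sineOp hC a y₁) - sineOp hC (t + -a) (sineOp hC a y₁)) := by
  have h1 := hC.apply_sub_eq_sineIntegral hK hy (2 * a)
  rw [← hC.two_sineOp_sineOp] at h1
  rw [← sub_eq_add_neg, hC.dAlembert, ← hC.apply_sineOp, smul_smul, inv_mul_cancel₀ two_ne_zero, one_smul,
    ← map_smul, ← map_sub, ← h1, sub_sub_cancel]

/-- A shift by at most `1/2` keeps `[0, 1/2]` inside `[-1, 1]`; oddness of the sine function then
produces the factor `2`. -/
theorem integral_norm_sine_shift_le (hC : IsCosineFunction C)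
    (hM : ∀ y, ∫ s in (0 : ℝ)..1, ‖Ψ (sineOp hC s y)‖ ≤ M * ‖j (resolventFst R y)‖)
    {c : ℝ} (hc : |c| ≤ 1 / 2) (y : E) :
    ∫ t in (0 : ℝ)..(1 / 2), ‖Ψ (sineOp hC (t + c) y)‖ ≤ 2 * M * ‖j (resolventFst R y)‖ := by
  obtain ⟨hc1, hc2⟩ := abs_le.1 hc
  have hcont : Continuous fun s => ‖Ψ (sineOp hC s y)‖ :=
    (Ψ.continuous.comp (hC.isStronglyContinuous_sineOp y)).norm
  have hi : ∀ a b, IntervalIntegrable (fun s => ‖Ψ (sineOp hC s y)‖) volume a b :=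
    fun a b => hcont.intervalIntegrable a b
  have h1 : ∫ s in (-1 : ℝ)..0, ‖Ψ (sineOp hC s y)‖ = ∫ s in (0 : ℝ)..1, ‖Ψ (sineOp hC s y)‖ := by
    have := intervalIntegral.integral_comp_neg (a := 0) (b := 1)
      (fun s => ‖Ψ (sineOp hC s y)‖)
    simp only [hC.sineOp_neg, map_neg, norm_neg, neg_zero] at this
    exact this.symm
  rw [intervalIntegral.integral_comp_add_right (fun s => ‖Ψ (sineOp hC s y)‖)]
  calc ∫ s in (0 + c)..(1 / 2 + c), ‖Ψ (sineOp hC s y)‖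
      ≤ ∫ s in (-1 : ℝ)..1, ‖Ψ (sineOp hC s y)‖ :=
        intervalIntegral.integral_mono_interval (by linarith) (by linarith) (by linarith)
          (Filter.Eventually.of_forall fun s => norm_nonneg _) (hi _ _)
    _ = 2 * ∫ s in (0 : ℝ)..1, ‖Ψ (sineOp hC s y)‖ := by
        rw [← intervalIntegral.integral_add_adjacent_intervals (hi (-1) 0) (hi 0 1), h1, two_mul]
    _ ≤ 2 * (M * ‖j (resolventFst R y)‖) := by
        gcongr
        exact hM y
    _ = _ := by ring

/-- Averaging `cosine_eq_add_sub` over `a ∈ [0, 1/4]` integrates the two cosine terms to `S(t ±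
1/2)`, so only sine operators remain on the right. -/
theorem norm_cosine_le [CompleteSpace G] (hC : IsCosineFunction C) (hK : IsCosineGenerator C K) {y y₁ : E}
    (hy : (y, y₁) ∈ K.graph) (t : ℝ) :
    ‖Ψ (C t y)‖ ≤ ‖Ψ (sineOp hC (t + 1 / 2) y)‖ + ‖Ψ (sineOp hC (t + -(1 / 2)) y)‖ +
      4 * ∫ a in (0 : ℝ)..(1 / 4), (‖Ψ (sineOp hC (t + a) (sineOp hC a y₁))‖ +
        ‖Ψ (sineOp hC (t + -a) (sineOp hC a y₁))‖) := by
  have hS := hC.isStronglyContinuous_sineOp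
  have hCy : Continuous fun a => C a y := hC.strongly_continuous y
  have hc1 : Continuous fun a => (2 : ℂ)⁻¹ • (C (t + 2 * a) y + C (t - 2 * a) y) := by fun_prop
  have hc2 : Continuous fun a => sineOp hC (t + a) (sineOp hC a y₁) :=
    hS.continuous_apply (by fun_prop) (hS y₁)
  have hc3 : Continuous fun a => sineOp hC (t + -a) (sineOp hC a y₁) :=
    hS.continuous_apply (by fun_prop) (hS y₁)
  have hc4 : Continuous fun a => sineOp hC (t + a) (sineOp hC a y₁) -
      sineOp hC (t + -a) (sineOp hC a y₁) := hc2.sub hc3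
  have h1 : (1 / 4 : ℝ) • C t y = ∫ a in (0 : ℝ)..(1 / 4), C t y := by simp
  have h2 : ∫ a in (0 : ℝ)..(1 / 4), (C (t + 2 * a) y + C (t - 2 * a) y) =
      (2 : ℝ)⁻¹ • (sineOp hC (t + 1 / 2) y - sineOp hC (t + -(1 / 2)) y) := by
    have h3 := intervalIntegral.integral_comp_mul_left (a := 0) (b := 1 / 4)
      (fun s => C (t + s) y + C (t - s) y) (two_ne_zero : (2 : ℝ) ≠ 0)
    rw [h3, mul_zero, show (2 : ℝ) * (1 / 4) = 1 / 2 by norm_num, integral_symm_add hCy,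
      ← sub_eq_add_neg]
    rfl
  have h4 : (1 / 4 : ℝ) • C t y =
      (1 / 4 : ℝ) • (sineOp hC (t + 1 / 2) y - sineOp hC (t + -(1 / 2)) y) -
        ∫ a in (0 : ℝ)..(1 / 4), (sineOp hC (t + a) (sineOp hC a y₁) -
          sineOp hC (t + -a) (sineOp hC a y₁)) := by
    rw [h1, intervalIntegral.integral_congr fun a _ => cosine_eq_add_sub hC hK hy t a,
      intervalIntegral.integral_sub (hc1.intervalIntegrable _ _)
      (hc4.intervalIntegrable _ _), intervalIntegral.integral_smul, h2,
      ← Complex.coe_smul, ← Complex.coe_smul, smul_smul]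
    congr 3
    push_cast
    norm_num
  have h5 := congrArg (fun x => (4 : ℝ) • x) h4
  simp only [smul_sub, smul_smul] at h5
  norm_num only at h5
  simp only [one_smul] at h5
  have h6 : ‖Ψ (∫ a in (0 : ℝ)..(1 / 4), (sineOp hC (t + a) (sineOp hC a y₁) -
      sineOp hC (t + -a) (sineOp hC a y₁)))‖ ≤
      ∫ a in (0 : ℝ)..(1 / 4), (‖Ψ (sineOp hC (t + a) (sineOp hC a y₁))‖ +
        ‖Ψ (sineOp hC (t + -a) (sineOp hC a y₁))‖) := by
    rw [← ContinuousLinearMap.intervalIntegral_comp_comm _ (hc4.intervalIntegrable _ _)]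
    refine intervalIntegral.norm_integral_le_of_norm_le (by norm_num) ?_ ?_
    · refine Filter.Eventually.of_forall fun a _ => ?_
      rw [map_sub]
      exact norm_sub_le _ _
    · exact ((Ψ.continuous.comp hc2).norm.add (Ψ.continuous.comp hc3).norm).intervalIntegrable _ _
  rw [h5, map_sub, map_sub, ← Complex.coe_smul, map_smul]
  refine (norm_sub_le _ _).trans (add_le_add (norm_sub_le _ _) ?_)
  rw [norm_smul, Complex.norm_real]
  norm_num only [Real.norm_eq_abs, abs_of_pos]
  gcongr

theorem IsReductionSemigroup.snd_apply_inl [CompleteSpace F] (hT : IsReductionSemigroup K j T)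
    (hC : IsCosineFunction C) (hK : IsCosineGenerator C K) {f : F} {z : E}
    (hf : (j f, z) ∈ K.graph) {a : ℝ} (ha : 0 ≤ a) : (T a (f, 0)).2 = sineOp hC a z := by
  have h1 := congrArg Prod.snd (hT.apply_inl_sub hf ha)
  rw [Prod.snd_sub, sub_zero] at h1
  have h2 := (ContinuousLinearMap.snd ℂ F E).intervalIntegral_comp_comm
    (hT.cont.intervalIntegrable (0, z) 0 a)
  have h3 := hT.j_fst_eq hC hK ha (0, z)
  rw [map_zero, map_zero, zero_add] at h3
  rw [h1, ← h3, hT.j_fst_apply ha]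
  exact h2.symm

/-- The sine estimate is applied to each term of `norm_cosine_le`. The price of the correction term
is the `F`-norm on the right: `S(a) K` is the lower left corner of `T(a)`, hence bounded from `F` to
`E` uniformly for `a ∈ [0, 1]`. -/
theorem integral_norm_cosine_le [CompleteSpace F] [CompleteSpace G]
    (hT : IsReductionSemigroup K j T) (hdom : ∀ u : K.domain, ∃ v : F, j v = u)
    (hR : IsSemigroupResolvent T ν R) (hC : IsCosineFunction C) (hK : IsCosineGenerator C K)
    (hM0 : 0 ≤ M) (hM : ∀ y, ∫ s in (0 : ℝ)..1, ‖Ψ (sineOp hC s y)‖ ≤ M * ‖j (resolventFst R y)‖)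
    {N : ℝ} (hN : ∀ a ∈ Set.Icc (0 : ℝ) 1, ‖T a‖ ≤ N) {y y₁ : E} (hy : (y, y₁) ∈ K.graph) :
    ∫ t in (0 : ℝ)..(1 / 2), ‖Ψ (C t y)‖ ≤ (4 * M * ‖j‖ + 4 * M * N) * ‖resolventFst R y‖ := by
  have hS := hC.isStronglyContinuous_sineOp
  have hRV : ∀ a ∈ Set.Icc (0 : ℝ) 1,
      ‖j (resolventFst R (sineOp hC a y₁))‖ ≤ N * ‖resolventFst R y‖ := by
    intro a ha
    have h1 := hT.resolventFst_apply hdom hR hy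
    rw [map_sub, map_sub, map_smul, map_smul, sub_eq_iff_eq_add, ← sub_eq_iff_eq_add'] at h1
    rw [resolventFst_sine hT hdom hR hC hK, ← h1,
      ← hT.snd_apply_inl hC hK (hT.resolventFst_mem_graph hR y) ha.1]
    refine (norm_snd_le _).trans (((T a).le_of_opNorm_le (hN a ha) _).trans (le_of_eq ?_))
    rw [Prod.norm_mk, norm_zero, max_eq_left (norm_nonneg _)]
  let h : ℝ → ℝ → ℝ := fun t a => ‖Ψ (sineOp hC (t + a) (sineOp hC a y₁))‖ +
    ‖Ψ (sineOp hC (t + -a) (sineOp hC a y₁))‖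
  have hSa : Continuous fun p : ℝ × ℝ => sineOp hC p.2 y₁ := (hS y₁).comp continuous_snd
  have hh1 : Continuous fun p : ℝ × ℝ => ‖Ψ (sineOp hC (p.1 + p.2) (sineOp hC p.2 y₁))‖ :=
    (Ψ.continuous.comp (hS.continuous_apply (by fun_prop) hSa)).norm
  have hh2 : Continuous fun p : ℝ × ℝ => ‖Ψ (sineOp hC (p.1 + -p.2) (sineOp hC p.2 y₁))‖ :=
    (Ψ.continuous.comp (hS.continuous_apply (by fun_prop) hSa)).norm
  have hh : Continuous (Function.uncurry h) := hh1.add hh2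
  have hinner : Continuous fun t => ∫ a in (0 : ℝ)..(1 / 4), h t a :=
    intervalIntegral.continuous_parametric_intervalIntegral_of_continuous' hh _ _
  have hinner' : Continuous fun a => ∫ t in (0 : ℝ)..(1 / 2), h t a :=
    intervalIntegral.continuous_parametric_intervalIntegral_of_continuous' (f := fun a t => h t a)
      (hh.comp continuous_swap) _ _
  have hswap : ∫ t in (0 : ℝ)..(1 / 2), ∫ a in (0 : ℝ)..(1 / 4), h t a =
      ∫ a in (0 : ℝ)..(1 / 4), ∫ t in (0 : ℝ)..(1 / 2), h t a := by
    refine intervalIntegral_intervalIntegral_swap ?_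
    refine (hh.continuousOn.integrableOn_compact
      (isCompact_uIcc.prod isCompact_uIcc)).mono_set
      (Set.prod_mono Set.uIoc_subset_uIcc Set.uIoc_subset_uIcc)
  have hdouble : ∫ t in (0 : ℝ)..(1 / 2), ∫ a in (0 : ℝ)..(1 / 4), h t a ≤
      M * N * ‖resolventFst R y‖ := by
    rw [hswap]
    calc ∫ a in (0 : ℝ)..(1 / 4), ∫ t in (0 : ℝ)..(1 / 2), h t a
        ≤ ∫ a in (0 : ℝ)..(1 / 4), 4 * M * (N * ‖resolventFst R y‖) := by
          refine intervalIntegral.integral_mono_on (by norm_num) (hinner'.intervalIntegrable _ _)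
            intervalIntegrable_const fun a ha => ?_
          have h1 : |a| ≤ 1 / 2 := abs_le.2 ⟨by linarith [ha.1], by linarith [ha.2]⟩
          have h2 := integral_norm_sine_shift_le hC hM h1 (sineOp hC a y₁)
          have h3 := integral_norm_sine_shift_le hC hM (by rwa [abs_neg] : |-a| ≤ 1 / 2)
            (sineOp hC a y₁)
          have h4 := hRV a ⟨ha.1, by linarith [ha.2]⟩
          have h5 : 4 * M * ‖j (resolventFst R (sineOp hC a y₁))‖ ≤
            4 * M * (N * ‖resolventFst R y‖) := by gcongr
          have h6 : ∫ t in (0 : ℝ)..(1 / 2), h t a =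
              (∫ t in (0 : ℝ)..(1 / 2), ‖Ψ (sineOp hC (t + a) (sineOp hC a y₁))‖) +
              ∫ t in (0 : ℝ)..(1 / 2), ‖Ψ (sineOp hC (t + -a) (sineOp hC a y₁))‖ :=
            intervalIntegral.integral_add
              ((hh1.comp (continuous_id.prodMk continuous_const)).intervalIntegrable _ _)
              ((hh2.comp (continuous_id.prodMk continuous_const)).intervalIntegrable _ _)
          linarith
      _ = M * N * ‖resolventFst R y‖ := by
          rw [intervalIntegral.integral_const, smul_eq_mul]
          ring
  have hc : ∀ c : ℝ, Continuous fun t => ‖Ψ (sineOp hC (t + c) y)‖ := fun c =>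
    (Ψ.continuous.comp ((hS y).comp (continuous_add_const c))).norm
  have hcc : Continuous fun t => ‖Ψ (sineOp hC (t + 1 / 2) y)‖ + ‖Ψ (sineOp hC (t + -(1 / 2)) y)‖ :=
    (hc _).add (hc _)
  have hinner₄ : Continuous fun t => 4 * ∫ a in (0 : ℝ)..(1 / 4), h t a :=
    continuous_const.mul hinner
  have hhalf : |(1 / 2 : ℝ)| ≤ 1 / 2 := by rw [abs_of_pos (by norm_num)]
  have h7 := integral_norm_sine_shift_le hC hM hhalf y
  have h8 := integral_norm_sine_shift_le hC hM (by rwa [abs_neg] : |-(1 / 2 : ℝ)| ≤ 1 / 2) y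
  have h9 : 4 * M * ‖j (resolventFst R y)‖ ≤ 4 * M * (‖j‖ * ‖resolventFst R y‖) := by
    gcongr
    exact j.le_opNorm _
  calc ∫ t in (0 : ℝ)..(1 / 2), ‖Ψ (C t y)‖
      ≤ ∫ t in (0 : ℝ)..(1 / 2), (‖Ψ (sineOp hC (t + 1 / 2) y)‖ +
          ‖Ψ (sineOp hC (t + -(1 / 2)) y)‖ + 4 * ∫ a in (0 : ℝ)..(1 / 4), h t a) := by
        refine intervalIntegral.integral_mono_on (by norm_num) ?_ ?_ fun t _ =>
          norm_cosine_le hC hK hy t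
        · exact (Ψ.continuous.comp (hC.strongly_continuous y)).norm.intervalIntegrable _ _
        · exact (hcc.add hinner₄).intervalIntegrable _ _
    _ = (∫ t in (0 : ℝ)..(1 / 2), ‖Ψ (sineOp hC (t + 1 / 2) y)‖) +
          (∫ t in (0 : ℝ)..(1 / 2), ‖Ψ (sineOp hC (t + -(1 / 2)) y)‖) +
          4 * ∫ t in (0 : ℝ)..(1 / 2), ∫ a in (0 : ℝ)..(1 / 4), h t a := by
        rw [intervalIntegral.integral_add (hcc.intervalIntegrable _ _)
          (hinner₄.intervalIntegrable _ _),
          intervalIntegral.integral_add ((hc _).intervalIntegrable _ _)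
          ((hc _).intervalIntegrable _ _), intervalIntegral.integral_const_mul]
    _ ≤ (4 * M * ‖j‖ + 4 * M * N) * ‖resolventFst R y‖ := by linarith

/-- For `Ψ = B R(ν², K)`, the operator `B pr₁ R`, where `R` is the resolvent at `ν` of the
reduction matrix of `K`. -/
def reductionObservation (j : F →L[ℂ] E) (ν : ℂ) (R : (F × E) →L[ℂ] (F × E)) (Ψ : E →L[ℂ] G) :
    (F × E) →L[ℂ] G :=
  Ψ.comp (ν ^ 2 • (j.comp ((ContinuousLinearMap.fst ℂ F E).comp R)) -
    ν • ((ContinuousLinearMap.snd ℂ F E).comp R) + ContinuousLinearMap.snd ℂ F E)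

omit [CompleteSpace E] in
theorem IsReductionSemigroup.reductionObservation_eq (hT : IsReductionSemigroup K j T)
    (hR : IsSemigroupResolvent T ν R) {w : F × E} {p y : E} (hp : j (R w).1 = p)
    (hy : (p, y) ∈ K.graph) : reductionObservation j ν R Ψ w = Ψ (ν ^ 2 • p - y) := by
  subst hp
  have h1 := ((hT.orbitDeriv_iff (R w).1 (R w).2 (ν • R w - w).1 (ν • R w - w).2).1
    (hR.orbitDeriv w)).1
  have h2 : ν • (R w).2 - w.2 = y := LinearPMap.mem_graph_snd_inj' K h1 hy rfl
  rw [← h2]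
  change Ψ (ν ^ 2 • j (R w).1 - ν • (R w).2 + w.2) = _
  congr 1
  abel

omit [CompleteSpace E] in
theorem IsReductionSemigroup.reductionObservation_eq' (hT : IsReductionSemigroup K j T)
    (hR : IsSemigroupResolvent T ν R) {w : F × E} {p : E} (hp : j (R w).1 = j (resolventFst R p)) :
    reductionObservation j ν R Ψ w = Ψ p := by
  rw [hT.reductionObservation_eq hR hp (hT.resolventFst_mem_graph hR p), sub_sub_cancel]

/-- The integral estimate for `B S(s, K)` implies an integral estimate for `B pr₁ T(s)`. -/
theorem IsReductionSemigroup.integral_norm_reductionObservation_le [CompleteSpace F]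
    [CompleteSpace G] (hT : IsReductionSemigroup K j T) (hdom : ∀ u : K.domain, ∃ v : F, j v = u)
    (hdense : Dense (K.domain : Set E)) (hdenseF : Dense {v : F | j v ∈ K.domain})
    (hR : IsSemigroupResolvent T ν R) (hC : IsCosineFunction C) (hK : IsCosineGenerator C K)
    (hM0 : 0 ≤ M)
    (hM : ∀ y, ∫ s in (0 : ℝ)..1, ‖Ψ (sineOp hC s y)‖ ≤ M * ‖j (resolventFst R y)‖) :
    ∃ c : ℝ, 0 ≤ c ∧ ∀ w, ∫ s in (0 : ℝ)..(1 / 2), ‖reductionObservation j ν R Ψ (T s w)‖ ≤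
      c * ‖R w‖ := by
  obtain ⟨N, hN0, hN⟩ := hT.cont.exists_bound 0 1
  set c₁ := 4 * M * ‖j‖ + 4 * M * N
  have hc₁ : 0 ≤ c₁ := by positivity
  refine ⟨c₁ + M, by positivity, ?_⟩
  -- `Θ (y, g) = (ν - G) (f, j g)`, where `f` is the resolvent of `K` at `ν²` applied to `y`. This
  -- parametrizes the whole space so that regular `y` and `g` form a dense set, on which the cosine
  -- and sine estimates apply.
  let Θ : E × F → F × E := fun p => ν • (resolventFst R p.1, j p.2) -
    (p.2, ν ^ 2 • j (resolventFst R p.1) - p.1)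
  have hΘc : Continuous Θ := by fun_prop
  have hRΘ : ∀ p, R (Θ p) = (resolventFst R p.1, j p.2) := fun p =>
    hR.left_inv _ _ ((hT.orbitDeriv_iff _ _ _ _).2 ⟨hT.resolventFst_mem_graph hR p.1, rfl⟩)
  have hΘs : Function.Surjective Θ := by
    intro w
    obtain ⟨h1, h2⟩ := (hT.orbitDeriv_iff (R w).1 (R w).2 (ν • R w - w).1 (ν • R w - w).2).1
      (hR.orbitDeriv w)
    refine ⟨(ν ^ 2 • j (R w).1 - (ν • R w - w).2, (ν • R w - w).1), hR.injective ?_⟩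
    rw [hRΘ]
    refine Prod.ext ?_ h2
    exact hT.injective (hT.resolventFst_apply hdom hR h1)
  suffices h : ∀ p, ∫ s in (0 : ℝ)..(1 / 2), ‖reductionObservation j ν R Ψ (T s (Θ p))‖ ≤
      (c₁ + M) * ‖R (Θ p)‖ by
    intro w
    obtain ⟨p, rfl⟩ := hΘs w
    exact h p
  have hclosed : IsClosed {p | ∫ s in (0 : ℝ)..(1 / 2), ‖reductionObservation j ν R Ψ (T s (Θ p))‖ ≤
      (c₁ + M) * ‖R (Θ p)‖} := by
    refine isClosed_le ?_ (by fun_prop)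
    refine intervalIntegral.continuous_parametric_intervalIntegral_of_continuous'
      (f := fun p s => ‖reductionObservation j ν R Ψ (T s (Θ p))‖) ?_ _ _
    exact ((reductionObservation j ν R Ψ).continuous.comp
      (hT.cont.continuous_apply continuous_snd (hΘc.comp continuous_fst))).norm
  refine fun p => (hdense.prod hdenseF).induction (P := fun p =>
    ∫ s in (0 : ℝ)..(1 / 2), ‖reductionObservation j ν R Ψ (T s (Θ p))‖ ≤
      (c₁ + M) * ‖R (Θ p)‖) ?_ hclosed p
  rintro ⟨y, g⟩ ⟨hy, hg⟩
  obtain ⟨y₁, hy₁⟩ := LinearPMap.mem_domain_iff.1 hy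
  obtain ⟨g₁, hg₁⟩ := LinearPMap.mem_domain_iff.1 (show j g ∈ K.domain from hg)
  set x := ν ^ 2 • j g - g₁
  have hx : j (resolventFst R x) = j g := hT.resolventFst_apply hdom hR hg₁
  have heq : ∀ s ∈ Set.uIcc (0 : ℝ) (1 / 2), ‖reductionObservation j ν R Ψ (T s (Θ (y, g)))‖ =
      ‖Ψ (C s y + sineOp hC s x)‖ := by
    intro s hs
    rw [Set.uIcc_of_le (by norm_num)] at hs
    congr 1
    refine hT.reductionObservation_eq' hR ?_
    rw [hR.comm hT.toIsExtendedSemigroup hs.1, hRΘ, hT.j_fst_eq hC hK hs.1, map_add, map_add,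
      resolventFst_cosine hT hdom hR hC hK, resolventFst_sine hT hdom hR hC hK, hx]
  have hcC : Continuous fun s => ‖Ψ (C s y)‖ :=
    (Ψ.continuous.comp (hC.strongly_continuous y)).norm
  have hcS : Continuous fun s => ‖Ψ (sineOp hC s x)‖ :=
    (Ψ.continuous.comp (hC.isStronglyContinuous_sineOp x)).norm
  have hcCS : Continuous fun s => ‖Ψ (C s y + sineOp hC s x)‖ :=
    (Ψ.continuous.comp ((hC.strongly_continuous y).add (hC.isStronglyContinuous_sineOp x))).norm
  change ∫ s in (0 : ℝ)..(1 / 2), ‖reductionObservation j ν R Ψ (T s (Θ (y, g)))‖ ≤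
      (c₁ + M) * ‖R (Θ (y, g))‖
  rw [intervalIntegral.integral_congr heq]
  have h1 : ∫ s in (0 : ℝ)..(1 / 2), ‖Ψ (sineOp hC s x)‖ ≤ M * ‖j (resolventFst R x)‖ :=
    (intervalIntegral.integral_mono_interval le_rfl (by norm_num) (by norm_num)
      (Filter.Eventually.of_forall fun s => norm_nonneg _) (hcS.intervalIntegrable _ _)).trans (hM x)
  rw [hx] at h1
  have h2 := integral_norm_cosine_le hT hdom hR hC hK hM0 hM hN hy₁
  have h3 : ‖resolventFst R y‖ ≤ ‖R (Θ (y, g))‖ := by rw [hRΘ]; exact le_max_left _ _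
  have h4 : ‖j g‖ ≤ ‖R (Θ (y, g))‖ := by rw [hRΘ]; exact le_max_right _ _
  calc ∫ s in (0 : ℝ)..(1 / 2), ‖Ψ (C s y + sineOp hC s x)‖
      ≤ ∫ s in (0 : ℝ)..(1 / 2), (‖Ψ (C s y)‖ + ‖Ψ (sineOp hC s x)‖) := by
        refine intervalIntegral.integral_mono_on (by norm_num) (hcCS.intervalIntegrable _ _)
          ((hcC.add hcS).intervalIntegrable _ _) fun s _ => ?_
        rw [map_add]
        exact norm_add_le _ _
    _ = (∫ s in (0 : ℝ)..(1 / 2), ‖Ψ (C s y)‖) + ∫ s in (0 : ℝ)..(1 / 2), ‖Ψ (sineOp hC s x)‖ :=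
        intervalIntegral.integral_add (hcC.intervalIntegrable _ _) (hcS.intervalIntegrable _ _)
    _ ≤ c₁ * ‖resolventFst R y‖ + M * ‖j g‖ := add_le_add h2 h1
    _ ≤ c₁ * ‖R (Θ (y, g))‖ + M * ‖R (Θ (y, g))‖ := by gcongr
    _ = _ := by ring

end Estimate

/-! ### Perturbation of a semigroup coupled with a second space -/

section Coupled

variable {W : Type*} [NormedAddCommGroup W] [NormedSpace ℂ W]
  {U : Type*} [NormedAddCommGroup U] [NormedSpace ℂ U]
  {G : Type*} [NormedAddCommGroup G] [NormedSpace ℂ G]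
  {T : ℝ → W →L[ℂ] W} {ν : ℂ} {R : W →L[ℂ] W}

/-- If `e^{-ωα} ‖T(α)‖ ≤ 1/2`, the blocks of length `α` contribute a geometric series: the induction
closes because `c + (1/2) · 2c = 2c`. The constant does not depend on `ω`, which leaves `ω` free for
absorbing bounded perturbations. -/
theorem exists_weighted_bound (hT : IsExtendedSemigroup T) (hR : IsSemigroupResolvent T ν R)
    {Λ : W →L[ℂ] G} {c α : ℝ} (hc : 0 ≤ c) (hα : 0 < α)
    (h : ∀ w, ∫ s in (0 : ℝ)..α, ‖Λ (T s w)‖ ≤ c * ‖R w‖) :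
    ∃ ω₀ : ℝ, 0 ≤ ω₀ ∧ ∀ ω, ω₀ ≤ ω → ∀ t, 0 ≤ t → ∀ w,
      ∫ s in (0 : ℝ)..t, Real.exp (-(ω * s)) * ‖Λ (T s w)‖ ≤ 2 * c * ‖R w‖ := by
  have hb : 1 ≤ 2 * ‖T α‖ + 2 := by linarith [norm_nonneg (T α)]
  refine ⟨Real.log (2 * ‖T α‖ + 2) / α, div_nonneg (Real.log_nonneg hb) hα.le, fun ω hω => ?_⟩
  have hω0 : 0 ≤ ω := (div_nonneg (Real.log_nonneg hb) hα.le).trans hω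
  have hexp : Real.exp (-(ω * α)) * ‖T α‖ ≤ 1 / 2 := by
    have h1 : 2 * ‖T α‖ + 2 ≤ Real.exp (ω * α) := by
      rw [← Real.log_le_iff_le_exp (by linarith)]
      exact (div_le_iff₀ hα).1 hω
    rw [Real.exp_neg, inv_mul_le_iff₀ (Real.exp_pos _)]
    linarith
  have hcont : ∀ w, Continuous fun s => Real.exp (-(ω * s)) * ‖Λ (T s w)‖ := fun w =>
    (by fun_prop : Continuous fun s : ℝ => Real.exp (-(ω * s))).mul
      (Λ.continuous.comp (hT.cont w)).norm
  have hi : ∀ w a b, IntervalIntegrable (fun s => Real.exp (-(ω * s)) * ‖Λ (T s w)‖) volume a b :=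
    fun w a b => (hcont w).intervalIntegrable a b
  have key : ∀ n : ℕ, ∀ w,
      ∫ s in (0 : ℝ)..(n * α), Real.exp (-(ω * s)) * ‖Λ (T s w)‖ ≤ 2 * c * ‖R w‖ := by
    intro n
    induction n with
    | zero => intro w; simp; positivity
    | succ n ih =>
      intro w
      have hn : 0 ≤ n * α := by positivity
      have h1 : ∫ s in α..((n + 1 : ℕ) * α), Real.exp (-(ω * s)) * ‖Λ (T s w)‖ =
          Real.exp (-(ω * α)) *
            ∫ s in (0 : ℝ)..(n * α), Real.exp (-(ω * s)) * ‖Λ (T s (T α w))‖ := by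
        have h2 := intervalIntegral.integral_comp_add_right (a := 0) (b := n * α)
          (fun s => Real.exp (-(ω * s)) * ‖Λ (T s w)‖) α
        rw [zero_add, show n * α + α = (n + 1 : ℕ) * α by push_cast; ring] at h2
        rw [← h2, ← intervalIntegral.integral_const_mul]
        refine intervalIntegral.integral_congr fun s hs => ?_
        rw [Set.uIcc_of_le hn] at hs
        simp only [hT.semigroup s α hs.1 hα.le, ← mul_assoc, ← Real.exp_add]
        congr 2
        ring
      have h3 : ∫ s in (0 : ℝ)..α, Real.exp (-(ω * s)) * ‖Λ (T s w)‖ ≤ c * ‖R w‖ := by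
        refine le_trans ?_ (h w)
        refine intervalIntegral.integral_mono_on hα.le (hi w _ _)
          ((Λ.continuous.comp (hT.cont w)).norm.intervalIntegrable _ _) fun s hs => ?_
        refine mul_le_of_le_one_left (norm_nonneg _) (Real.exp_le_one_iff.2 ?_)
        have := mul_nonneg hω0 hs.1
        linarith
      have h4 : ‖R (T α w)‖ ≤ ‖T α‖ * ‖R w‖ := by
        rw [hR.comm hT hα.le]
        exact (T α).le_opNorm _
      rw [← intervalIntegral.integral_add_adjacent_intervals (hi w 0 α) (hi w α _), h1]
      calc _ ≤ c * ‖R w‖ + Real.exp (-(ω * α)) * (2 * c * (‖T α‖ * ‖R w‖)) := by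
            gcongr
            exact (ih (T α w)).trans (by gcongr)
        _ = c * ‖R w‖ + Real.exp (-(ω * α)) * ‖T α‖ * (2 * c * ‖R w‖) := by ring
        _ ≤ c * ‖R w‖ + 1 / 2 * (2 * c * ‖R w‖) := by gcongr
        _ = 2 * c * ‖R w‖ := by ring
  intro t ht w
  obtain ⟨n, hn⟩ := exists_nat_ge (t / α)
  refine le_trans ?_ (key n w)
  exact intervalIntegral.integral_mono_interval le_rfl ht ((div_le_iff₀ hα).1 hn)
    (Filter.Eventually.of_forall fun s => by positivity) (hi w _ _)

theorem integral_exp_neg_mul_le {a : ℝ} (ha : 0 < a) (t : ℝ) :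
    ∫ s in (0 : ℝ)..t, Real.exp (-(a * s)) ≤ 1 / a := by
  have h : ∀ s ∈ Set.uIcc 0 t,
      HasDerivAt (fun s => -(Real.exp (-(a * s)) / a)) (Real.exp (-(a * s))) s := fun s _ => by
    have := ((((hasDerivAt_id s).const_mul a).neg.exp).div_const a).neg
    refine this.congr_deriv ?_
    simp only [Pi.neg_apply, id_eq]
    field_simp
  rw [intervalIntegral.integral_eq_sub_of_hasDerivAt h
    (Continuous.intervalIntegrable (by fun_prop) _ _)]
  have : 0 ≤ Real.exp (-(a * t)) / a := by positivity
  simp only [mul_zero, neg_zero, Real.exp_zero]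
  linarith

theorem orbitDeriv_prodMap_id (T : ℝ → W →L[ℂ] W) (z w : W × U) :
    OrbitDeriv (fun t => (T t).prodMap (ContinuousLinearMap.id ℂ U)) z w ↔
      OrbitDeriv T z.1 w.1 ∧ w.2 = 0 := by
  unfold OrbitDeriv
  rw [Prod.tendsto_iff]
  refine and_congr Iff.rfl ⟨fun h => tendsto_nhds_unique h ?_, fun h => ?_⟩
  · simp
  · rw [h]; simp

theorem IsExtendedSemigroup.prodMap_id (hT : IsExtendedSemigroup T) :
    IsExtendedSemigroup fun t => (T t).prodMap (ContinuousLinearMap.id ℂ U) := by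
  have hc : IsStronglyContinuous fun t => (T t).prodMap (ContinuousLinearMap.id ℂ U) := fun x =>
    (hT.cont x.1).prodMk continuous_const
  refine ⟨⟨?_, fun t s ht hs x => ?_, fun x => (hc x).continuousOn⟩, hc⟩
  · ext x <;> simp [hT.at_zero]
  · exact Prod.ext (hT.semigroup t s ht hs x.1) rfl

theorem IsSemigroupResolvent.prodMap_id (hR : IsSemigroupResolvent T ν R) (hν : ν ≠ 0) :
    IsSemigroupResolvent (fun t => (T t).prodMap (ContinuousLinearMap.id ℂ U)) ν
      (R.prodMap (ν⁻¹ • ContinuousLinearMap.id ℂ U)) where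
  orbitDeriv x := (orbitDeriv_prodMap_id T _ _).2 ⟨hR.orbitDeriv x.1, by simp [smul_smul, hν]⟩
  left_inv x y h := by
    obtain ⟨h1, h2⟩ := (orbitDeriv_prodMap_id T _ _).1 h
    refine Prod.ext (hR.left_inv _ _ h1) ?_
    simp [h2, smul_smul, hν]

/-- A semigroup `T` on `W`, coupled with a second space `U` by a small Miyadera perturbation
`P (Λ (ν - A))` of its generator `A` and by a bounded perturbation `Q`. -/
theorem exists_coupled_perturbation [CompleteSpace W] [CompleteSpace U]
    (hT : IsExtendedSemigroup T) (hR : IsSemigroupResolvent T ν R) (hν : ν ≠ 0)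
    {Λ : W →L[ℂ] G} {c α : ℝ} (hc : 0 ≤ c) (hα : 0 < α)
    (h : ∀ w, ∫ s in (0 : ℝ)..α, ‖Λ (T s w)‖ ≤ c * ‖R w‖)
    (P : G →L[ℂ] W × U) (hP : ‖P‖ * (2 * c) ≤ 1 / 4) (Q : (W × U) →L[ℂ] (W × U)) :
    ∃ S : ℝ → (W × U) →L[ℂ] (W × U), IsExtendedSemigroup S ∧ ∀ z w, OrbitDeriv S z w ↔
      ∃ v, OrbitDeriv T z.1 v ∧ w = (v, 0) + P (Λ (ν • z.1 - v)) + Q z := by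
  set T' : ℝ → (W × U) →L[ℂ] (W × U) := fun t => (T t).prodMap (ContinuousLinearMap.id ℂ U)
  set R' : (W × U) →L[ℂ] (W × U) := R.prodMap (ν⁻¹ • ContinuousLinearMap.id ℂ U)
  have hT' : IsExtendedSemigroup T' := hT.prodMap_id
  have hR' : IsSemigroupResolvent T' ν R' := hR.prodMap_id hν
  obtain ⟨ω₀, hω₀, hw⟩ := exists_weighted_bound hT hR hc hα h
  obtain ⟨M, ω₁, hM1, hω₁, hM⟩ := hT'.extend.exists_exp_bound
  have hM' : ∀ t, 0 ≤ t → ‖T' t‖ ≤ M * Real.exp (ω₁ * t) := fun t ht => by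
    simpa [max_eq_left ht] using hM t ht
  -- This makes `‖Q‖ M / (ω - ω₁) ≤ 1/4`. With `1/4` from the small feedback term, the Miyadera
  -- constant is `1/2`.
  set ω := max ω₀ (ω₁ + 4 * (‖Q‖ * M) + 1)
  have hω0 : ω₀ ≤ ω := le_max_left _ _
  have hω1 : ω₁ + 4 * (‖Q‖ * M) + 1 ≤ ω := le_max_right _ _
  have hQM : 0 ≤ ‖Q‖ * M := by positivity
  have hpos : 0 < ω - ω₁ := by linarith
  set Ψ : (W × U) →L[ℂ] (W × U) := P.comp (Λ.comp (ContinuousLinearMap.fst ℂ W U)) + Q.comp R'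
  have hΨ : ∀ y, Ψ y = P (Λ y.1) + Q (R' y) := fun y => rfl
  have hbound : MiyaderaBound (fun t => T' (max t 0)) R' Ψ ω (1 / 2) := by
    intro t ht y
    have hc1 : Continuous fun s => ‖P‖ * (Real.exp (-(ω * s)) * ‖Λ (T s y.1)‖) :=
      continuous_const.mul ((by fun_prop : Continuous fun s : ℝ => Real.exp (-(ω * s))).mul
        (Λ.continuous.comp (hT.cont y.1)).norm)
    have hc2 : Continuous fun s : ℝ => ‖Q‖ * M * ‖R' y‖ * Real.exp (-((ω - ω₁) * s)) := by
      fun_prop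
    calc ∫ s in (0 : ℝ)..t, Real.exp (-(ω * s)) * ‖Ψ (T' (max s 0) y)‖
        ≤ ∫ s in (0 : ℝ)..t, (‖P‖ * (Real.exp (-(ω * s)) * ‖Λ (T s y.1)‖) +
            ‖Q‖ * M * ‖R' y‖ * Real.exp (-((ω - ω₁) * s))) := by
          refine intervalIntegral.integral_mono_on ht ?_ ((hc1.add hc2).intervalIntegrable _ _)
            fun s hs => ?_
          · exact ((by fun_prop : Continuous fun s : ℝ => Real.exp (-(ω * s))).mul
              (Ψ.continuous.comp (hT'.extend.cont y)).norm).intervalIntegrable _ _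
          · have h1 : ‖Ψ (T' s y)‖ ≤ ‖P‖ * ‖Λ (T s y.1)‖ +
                ‖Q‖ * (M * Real.exp (ω₁ * s) * ‖R' y‖) := by
              rw [hΨ, hR'.comm hT' hs.1]
              refine (norm_add_le _ _).trans (add_le_add (P.le_opNorm _) ?_)
              refine (Q.le_opNorm _).trans ?_
              gcongr
              exact (T' s).le_of_opNorm_le (hM' s hs.1) _
            rw [max_eq_left hs.1]
            calc _ ≤ Real.exp (-(ω * s)) * (‖P‖ * ‖Λ (T s y.1)‖ +
                  ‖Q‖ * (M * Real.exp (ω₁ * s) * ‖R' y‖)) := by gcongr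
              _ = _ := by
                rw [show -((ω - ω₁) * s) = -(ω * s) + ω₁ * s by ring, Real.exp_add]
                ring
      _ = ‖P‖ * (∫ s in (0 : ℝ)..t, Real.exp (-(ω * s)) * ‖Λ (T s y.1)‖) +
            ‖Q‖ * M * ‖R' y‖ * ∫ s in (0 : ℝ)..t, Real.exp (-((ω - ω₁) * s)) := by
          rw [intervalIntegral.integral_add (hc1.intervalIntegrable _ _)
            (hc2.intervalIntegrable _ _), intervalIntegral.integral_const_mul,
            intervalIntegral.integral_const_mul]
      _ ≤ ‖P‖ * (2 * c * ‖R y.1‖) + ‖Q‖ * M * ‖R' y‖ * (1 / (ω - ω₁)) := by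
          gcongr
          · exact hw ω hω0 t ht y.1
          · exact integral_exp_neg_mul_le hpos t
      _ ≤ 1 / 4 * ‖R' y‖ + 1 / 4 * ‖R' y‖ := by
          refine add_le_add ?_ ?_
          · calc ‖P‖ * (2 * c * ‖R y.1‖) = ‖P‖ * (2 * c) * ‖R y.1‖ := by ring
              _ ≤ 1 / 4 * ‖R' y‖ := by
                gcongr
                exact norm_fst_le (R' y)
          · rw [mul_right_comm]
            gcongr
            rw [mul_one_div, div_le_iff₀ hpos]
            linarith
      _ = 1 / 2 * ‖R' y‖ := by ring
  have hR'' : IsSemigroupResolvent (fun t => T' (max t 0)) ν R' := by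
    have hcongr := orbitDeriv_congr (T := fun t => T' (max t 0)) (T' := T')
      fun t ht => by rw [max_eq_left ht]
    exact ⟨fun x => (hcongr _ _).2 (hR'.orbitDeriv x),
      fun x y hxy => hR'.left_inv _ _ ((hcongr _ _).1 hxy)⟩
  have hMω : ∀ t, ‖T' (max t 0)‖ ≤ M * Real.exp (ω * max t 0) := fun t => by
    refine (hM' _ (le_max_right _ _)).trans ?_
    have : ω₁ ≤ ω := by linarith
    gcongr
  obtain ⟨S, hS, hSg⟩ := exists_miyadera_perturbation hT'.extend hR'' (by norm_num) (by norm_num)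
    (hω₀.trans hω0) hMω hbound
  refine ⟨S, hS, fun z w => (hSg z w).trans ⟨?_, ?_⟩⟩
  · rintro ⟨y, rfl, rfl⟩
    refine ⟨ν • R y.1 - y.1, hR.orbitDeriv _, ?_⟩
    have h1 : ν • (R' y).1 - (ν • R y.1 - y.1) = y.1 := sub_sub_cancel _ _
    have h2 : ν • R' y - y = (ν • R y.1 - y.1, 0) :=
      Prod.ext rfl ((orbitDeriv_prodMap_id T _ _).1 (hR'.orbitDeriv y)).2
    rw [h1, hΨ, h2, add_assoc]
  · rintro ⟨v, hv, rfl⟩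
    have h1 : R' (ν • z - (v, 0)) = z :=
      hR'.left_inv _ _ ((orbitDeriv_prodMap_id T _ _).2 ⟨hv, rfl⟩)
    refine ⟨ν • z - (v, 0), h1.symm, ?_⟩
    rw [hΨ, h1, sub_sub_cancel, add_assoc]
    rfl

end Coupled

/-! ### Similarity and factorization -/

section Similarity

variable {E : Type*} [NormedAddCommGroup E] [NormedSpace ℂ E]
  {F : Type*} [NormedAddCommGroup F] [NormedSpace ℂ F]
  {G : Type*} [NormedAddCommGroup G] [NormedSpace ℂ G]

/-- The family `T` transported along an isomorphism. -/
def conjugate (e : E ≃L[ℂ] F) (T : ℝ → E →L[ℂ] E) (t : ℝ) : F →L[ℂ] F :=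
  (e : E →L[ℂ] F).comp ((T t).comp (e.symm : F →L[ℂ] E))

theorem conjugate_apply (e : E ≃L[ℂ] F) (T : ℝ → E →L[ℂ] E) (t : ℝ) (x : F) :
    conjugate e T t x = e (T t (e.symm x)) :=
  rfl

theorem IsC0Semigroup.conjugate {T : ℝ → E →L[ℂ] E} (hT : IsC0Semigroup T) (e : E ≃L[ℂ] F) :
    IsC0Semigroup (conjugate e T) where
  at_zero := by ext x; simp [conjugate_apply, hT.at_zero]
  semigroup t s ht hs x := by simp [conjugate_apply, hT.semigroup t s ht hs]
  strongly_continuous x := e.continuous.comp_continuousOn (hT.strongly_continuous (e.symm x))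

theorem orbitDeriv_conjugate (e : E ≃L[ℂ] F) (T : ℝ → E →L[ℂ] E) (x y : E) :
    OrbitDeriv (conjugate e T) (e x) (e y) ↔ OrbitDeriv T x y := by
  unfold OrbitDeriv
  simp only [conjugate_apply, e.symm_apply_apply, ← map_sub, ← map_smul]
  exact e.toHomeomorph.isInducing.tendsto_nhds_iff.symm

/-- A bounded operator whose range is contained in the range of an injective bounded operator
factors through the latter. -/
theorem exists_factorization [CompleteSpace F] [CompleteSpace G] {i : F →L[ℂ] E}
    (hi : Function.Injective i) (D : G →L[ℂ] E) (h : ∀ x, ∃ y, i y = D x) :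
    ∃ D' : G →L[ℂ] F, ∀ x, i (D' x) = D x := by
  choose d hd using h
  let D₀ : G →ₗ[ℂ] F :=
    { toFun := d
      map_add' := fun x y => hi (by simp [hd])
      map_smul' := fun c x => hi (by simp [hd]) }
  have hgraph : IsClosed (D₀.graph : Set (G × F)) := by
    have hset : (D₀.graph : Set (G × F)) = {p | i p.2 = D p.1} := by
      ext p
      simp only [SetLike.mem_coe, LinearMap.mem_graph_iff, Set.mem_ofPred_eq]
      refine ⟨fun hp => ?_, fun hp => hi (hp.trans (hd p.1).symm)⟩
      rw [hp]
      exact hd p.1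
    rw [hset]
    exact isClosed_eq (by fun_prop) (by fun_prop)
  exact ⟨ContinuousLinearMap.ofIsClosedGraph hgraph, hd⟩

end Similarity

/-! ### The operator matrix with coupled domain -/

section Boundary

variable {X : Type*} [NormedAddCommGroup X] [NormedSpace ℂ X]
  {bX : Type*} [NormedAddCommGroup bX] [NormedSpace ℂ bX]
  {Y : Type*} [NormedAddCommGroup Y] [NormedSpace ℂ Y]
  {V : Type*} [NormedAddCommGroup V] [NormedSpace ℂ V]
  {A : X →ₗ.[ℂ] X} {L B : A.domain →ₗ[ℂ] bX} {B' : bX →L[ℂ] bX} {l : ℂ} {D : bX →L[ℂ] X}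

theorem mem_restrictKer_domain {p : X} :
    p ∈ (restrictKer A L).domain ↔ ∃ h : p ∈ A.domain, L ⟨p, h⟩ = 0 := by
  constructor
  · rintro ⟨u, hu, rfl⟩
    exact ⟨u.2, hu⟩
  · rintro ⟨h, h0⟩
    exact ⟨⟨p, h⟩, h0, rfl⟩

theorem mem_graph_restrictKer {p y : X} :
    (p, y) ∈ (restrictKer A L).graph ↔
      ∃ h : p ∈ (restrictKer A L).domain, A ⟨p, restrictKer_domain_le A L h⟩ = y := by
  rw [LinearPMap.mem_graph_iff]
  constructor
  · rintro ⟨u, hu1, hu2⟩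
    obtain rfl : (u : X) = p := hu1
    exact ⟨u.2, hu2⟩
  · rintro ⟨h, hy⟩
    exact ⟨⟨p, h⟩, rfl, hy⟩

theorem IsDirichletOperator.mem (hD : IsDirichletOperator A L l D) (x : bX) : D x ∈ A.domain :=
  (hD.1 x).elim fun h _ => h

theorem IsDirichletOperator.apply (hD : IsDirichletOperator A L l D) (x : bX) :
    A ⟨D x, hD.mem x⟩ = l • D x :=
  (hD.1 x).elim fun _ h => h.1

theorem IsDirichletOperator.trace (hD : IsDirichletOperator A L l D) (x : bX) :
    L ⟨D x, hD.mem x⟩ = x :=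
  (hD.1 x).elim fun _ h => h.2

/-- Subtracting the Dirichlet lift of the trace decouples the domain: `p` ranges over `D(A₀)` and
`x` over all of `∂X`, while the coupling moves into the action. -/
theorem mem_graph_operatorMatrix (hD : IsDirichletOperator A L l D) {p a : X} {x b : bX} :
    ((p + D x, x), (a, b)) ∈ (operatorMatrix A L B B').graph ↔
      ∃ h : p ∈ (restrictKer A L).domain, a = A ⟨p, restrictKer_domain_le A L h⟩ + l • D x ∧
        b = B ⟨p, restrictKer_domain_le A L h⟩ + B ⟨D x, hD.mem x⟩ + B' x := by
  have hsum : ∀ (h : p ∈ A.domain) (h' : p + D x ∈ A.domain),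
      (⟨p + D x, h'⟩ : A.domain) = ⟨p, h⟩ + ⟨D x, hD.mem x⟩ := fun _ _ => rfl
  rw [LinearPMap.mem_graph_iff]
  constructor
  · rintro ⟨⟨q, hq⟩, hq1, hq2⟩
    obtain rfl : q = (p + D x, x) := hq1
    obtain ⟨h', hL⟩ := id hq
    have hp : p ∈ A.domain := by simpa using A.domain.sub_mem h' (hD.mem x)
    have hp0 : p ∈ (restrictKer A L).domain := by
      refine mem_restrictKer_domain.2 ⟨hp, ?_⟩
      have h1 := hL
      dsimp only at h1
      rw [hsum hp h', map_add, hD.trace] at h1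
      simpa using h1
    have h2 : A ⟨p + D x, h'⟩ = a := congrArg Prod.fst hq2
    have h3 : B ⟨p + D x, h'⟩ + B' x = b := congrArg Prod.snd hq2
    rw [hsum hp h', LinearPMap.map_add, hD.apply] at h2
    rw [hsum hp h', map_add] at h3
    exact ⟨hp0, h2.symm, h3.symm⟩
  · rintro ⟨h, rfl, rfl⟩
    obtain ⟨hp, hp0⟩ := mem_restrictKer_domain.1 h
    have h' : p + D x ∈ A.domain := A.domain.add_mem hp (hD.mem x)
    have hmem : (p + D x, x) ∈ (operatorMatrix A L B B').domain := by
      refine ⟨h', ?_⟩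
      change L ⟨p + D x, h'⟩ = x
      rw [hsum hp h', map_add, hD.trace, hp0, zero_add]
    refine ⟨⟨(p + D x, x), hmem⟩, rfl, ?_⟩
    refine Prod.ext ?_ ?_
    · change A ⟨p + D x, h'⟩ = _
      rw [hsum hp h', LinearPMap.map_add, hD.apply]
    · change B ⟨p + D x, h'⟩ + B' x = _
      rw [hsum hp h', map_add]

theorem exists_comp_dirichlet (hD : IsDirichletOperator A L l D)
    (hB : ∃ c : ℝ, ∀ u : A.domain, ‖B u‖ ≤ c * (‖(u : X)‖ + ‖A u‖ + ‖L u‖)) :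
    ∃ BD : bX →L[ℂ] bX, ∀ x, BD x = B ⟨D x, hD.mem x⟩ := by
  obtain ⟨c, hc⟩ := hB
  refine ⟨LinearMap.mkContinuousOfExistsBound
    (B ∘ₗ (D : bX →ₗ[ℂ] X).codRestrict A.domain hD.mem) ?_, fun x => rfl⟩
  refine ⟨|c| * (‖D‖ + ‖l‖ * ‖D‖ + 1), fun x => ?_⟩
  refine (hc ⟨D x, hD.mem x⟩).trans ?_
  rw [hD.apply, hD.trace, norm_smul]
  calc c * (‖D x‖ + ‖l‖ * ‖D x‖ + ‖x‖)
      ≤ |c| * (‖D‖ * ‖x‖ + ‖l‖ * (‖D‖ * ‖x‖) + ‖x‖) := by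
        have := D.le_opNorm x
        have := le_abs_self c
        gcongr
    _ = _ := by ring

/-- The graph norm of `R₀ y` is controlled by `‖y‖`, since `A R₀ y = μ R₀ y - y` and `L R₀ y = 0`;
thus `B R₀` is bounded on `X`. -/
theorem exists_comp_resolvent {μ : ℂ} {R₀ : X →L[ℂ] X}
    (hR₀ : ∀ y, (R₀ y, μ • R₀ y - y) ∈ (restrictKer A L).graph)
    (hB : ∃ c : ℝ, ∀ u : A.domain, ‖B u‖ ≤ c * (‖(u : X)‖ + ‖A u‖ + ‖L u‖)) :
    ∃ Ψ : X →L[ℂ] bX, ∀ y (h : R₀ y ∈ A.domain), Ψ y = B ⟨R₀ y, h⟩ := by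
  obtain ⟨c, hc⟩ := hB
  have hmem : ∀ y, R₀ y ∈ A.domain := fun y =>
    (mem_graph_restrictKer.1 (hR₀ y)).elim fun h _ => restrictKer_domain_le A L h
  refine ⟨LinearMap.mkContinuousOfExistsBound
    (B ∘ₗ (R₀ : X →ₗ[ℂ] X).codRestrict A.domain hmem) ?_, fun x _ => rfl⟩
  refine ⟨|c| * (‖R₀‖ + (‖μ‖ * ‖R₀‖ + 1)), fun y => ?_⟩
  obtain ⟨h, hA⟩ := mem_graph_restrictKer.1 (hR₀ y)
  obtain ⟨_, hL⟩ := mem_restrictKer_domain.1 h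
  refine (hc ⟨R₀ y, hmem y⟩).trans ?_
  rw [hA, hL, norm_zero, add_zero]
  have h1 : ‖μ • R₀ y - y‖ ≤ ‖μ‖ * ‖R₀ y‖ + ‖y‖ := (norm_sub_le _ _).trans (by rw [norm_smul])
  calc c * (‖R₀ y‖ + ‖μ • R₀ y - y‖)
      ≤ |c| * (‖R₀‖ * ‖y‖ + (‖μ‖ * (‖R₀‖ * ‖y‖) + ‖y‖)) := by
        have := R₀.le_opNorm y
        have := le_abs_self c
        refine mul_le_mul this (add_le_add ‹_› (h1.trans ?_)) (by positivity) (abs_nonneg c)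
        gcongr
    _ = _ := by ring

theorem isClosed_coupledSpace (LY : Y →L[ℂ] bX) : IsClosed (coupledSpace LY : Set (Y × bX)) :=
  isClosed_eq (by fun_prop : Continuous fun p : Y × bX => LY p.1) continuous_snd

theorem coupledEmbedding_apply (i : Y →L[ℂ] X) (LY : Y →L[ℂ] bX) (v : coupledSpace LY) :
    coupledEmbedding i LY v = (i v.1.1, v.1.2) :=
  rfl

/-- The map `(f, x) ↦ (f + D x, x)` from `V × ∂X` to the coupled space. -/
def coupledShift (LY : Y →L[ℂ] bX) (j : V →L[ℂ] Y) (DY : bX →L[ℂ] Y)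
    (hj : ∀ v, LY (j v) = 0) (hDY : ∀ x, LY (DY x) = x) : (V × bX) →L[ℂ] coupledSpace LY :=
  ((j.coprod DY).prod (ContinuousLinearMap.snd ℂ V bX)).codRestrict (coupledSpace LY) fun p => by
    change LY (j p.1 + DY p.2) = p.2
    rw [map_add, hj, hDY, zero_add]

section Shift

variable {LY : Y →L[ℂ] bX} {j : V →L[ℂ] Y} {DY : bX →L[ℂ] Y}
  (hj : ∀ v, LY (j v) = 0) (hDY : ∀ x, LY (DY x) = x)

theorem coupledShift_coe (p : V × bX) :
    (coupledShift LY j DY hj hDY p : Y × bX) = (j p.1 + DY p.2, p.2) :=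
  rfl

theorem coupledShift_injective (hinj : Function.Injective j) :
    Function.Injective (coupledShift LY j DY hj hDY) := by
  rintro ⟨f, x⟩ ⟨f', x'⟩ h
  have h1 : (j f + DY x, x) = (j f' + DY x', x') := congrArg Subtype.val h
  obtain ⟨h2, rfl⟩ := Prod.mk.injEq .. ▸ h1
  rw [hinj (add_right_cancel h2)]

theorem coupledShift_surjective (hker : ∀ y : Y, LY y = 0 → ∃ v : V, j v = y) :
    Function.Surjective (coupledShift LY j DY hj hDY) := by
  rintro ⟨⟨y, x⟩, hyx⟩
  have hyx' : LY y = x := hyx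
  obtain ⟨f, hf⟩ := hker (y - DY x) (by rw [map_sub, hDY, hyx', sub_self])
  refine ⟨(f, x), Subtype.ext ?_⟩
  rw [coupledShift_coe, hf, sub_add_cancel]

end Shift

end Boundary

/-! ### Choice of the spectral parameter, and the phase space of the coupled operator -/

section Main

/-- The resolvent of a reduction matrix at `μ` yields that of its lower left entry at `μ²`, so the
decay is evaluated along squares of large reals. -/
theorem exists_sq_norm_le {N : ℂ → ℝ} {ε : ℝ} (hε : 0 < ε)
    (hN : N =O[Bornology.cobounded ℂ ⊓ 𝓟 {l : ℂ | 0 < l.re}] fun l : ℂ => ‖l‖ ^ (-ε))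
    (ν₀ : ℝ) {η : ℝ} (hη : 0 < η) : ∃ μ : ℝ, ν₀ < μ ∧ ‖N ((μ : ℂ) ^ 2)‖ ≤ η := by
  have hsq : Tendsto (fun μ : ℝ => (μ : ℂ) ^ 2) atTop
      (Bornology.cobounded ℂ ⊓ 𝓟 {l : ℂ | 0 < l.re}) := by
    refine tendsto_inf.2 ⟨?_, tendsto_principal.2 ?_⟩
    · rw [← tendsto_norm_atTop_iff_cobounded]
      refine (tendsto_pow_atTop (two_ne_zero : (2 : ℕ) ≠ 0)).congr fun μ => ?_
      simp
    · filter_upwards [eventually_gt_atTop 0] with μ hμ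
      rw [← Complex.ofReal_pow, Complex.ofReal_re]
      positivity
  have hzero : Tendsto (fun l : ℂ => ‖l‖ ^ (-ε)) (Bornology.cobounded ℂ ⊓ 𝓟 {l : ℂ | 0 < l.re})
      (𝓝 0) :=
    (tendsto_rpow_neg_atTop hε).comp
      (tendsto_norm_cobounded_atTop.mono_left inf_le_left)
  have h := ((hN.trans_tendsto hzero).comp hsq).norm
  rw [norm_zero] at h
  obtain ⟨μ, h1, h2⟩ := ((h.eventually_le_const hη).and (eventually_gt_atTop ν₀)).exists
  exact ⟨μ, h2, h1⟩

theorem IsReductionSemigroup.sq_mem_resolventSet {E F : Type*} [NormedAddCommGroup E]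
    [NormedSpace ℂ E] [NormedAddCommGroup F] [NormedSpace ℂ F] {K : E →ₗ.[ℂ] E} {j : F →L[ℂ] E}
    {T : ℝ → (F × E) →L[ℂ] (F × E)} {ν : ℂ} {R : (F × E) →L[ℂ] (F × E)}
    (hT : IsReductionSemigroup K j T) (hdom : ∀ u : K.domain, ∃ v : F, j v = u)
    (hR : IsSemigroupResolvent T ν R) : ν ^ 2 ∈ resolventSet K := by
  refine ⟨j.comp (resolventFst R), fun x => ?_, fun u =>
    hT.resolventFst_apply hdom hR (K.mem_graph u)⟩
  obtain ⟨u, hu1, hu2⟩ := (LinearPMap.mem_graph_iff _).1 (hT.resolventFst_mem_graph hR x)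
  have hmem : j (resolventFst R x) ∈ K.domain := by
    rw [← show (u : E) = j (resolventFst R x) from hu1]
    exact u.2
  refine ⟨hmem, ?_⟩
  have hu : u = ⟨j (resolventFst R x), hmem⟩ := Subtype.ext hu1
  rw [hu] at hu2
  change ν ^ 2 • j (resolventFst R x) - K ⟨j (resolventFst R x), hmem⟩ = x
  rw [hu2, sub_sub_cancel]

variable {X Y V bX : Type*}
  [NormedAddCommGroup X] [NormedSpace ℂ X] [CompleteSpace X]
  [NormedAddCommGroup Y] [NormedSpace ℂ Y] [CompleteSpace Y]
  [NormedAddCommGroup V] [NormedSpace ℂ V] [CompleteSpace V]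
  [NormedAddCommGroup bX] [NormedSpace ℂ bX] [CompleteSpace bX]
  {i : Y →L[ℂ] X} {j : V →L[ℂ] Y} {A : X →ₗ.[ℂ] X} {L B : A.domain →ₗ[ℂ] bX} {B' : bX →L[ℂ] bX}
  {LY : Y →L[ℂ] bX} {l : ℂ} {D : bX →L[ℂ] X}

/-- The semigroup generated by the reduction matrix of the operator matrix with coupled domain,
for a Dirichlet operator `D` of small norm. -/
theorem exists_coupled_semigroup (hi : Function.Injective i) (hj : Function.Injective j)
    (hAY : ∀ u : A.domain, ∃ y : Y, i y = u)
    (hLY : ∀ (y : Y) (u : A.domain), i y = u → LY y = L u)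
    (hker : ∀ y : Y, LY y = 0 ↔ ∃ v : V, j v = y)
    (hD : IsDirichletOperator A L l D) {BD : bX →L[ℂ] bX} (hBD : ∀ x, BD x = B ⟨D x, hD.mem x⟩)
    {T : ℝ → (V × X) →L[ℂ] (V × X)} (hT : IsReductionSemigroup (restrictKer A L) (i.comp j) T)
    (hdom : ∀ u : (restrictKer A L).domain, ∃ v : V, i.comp j v = u)
    {ν : ℂ} (hν : ν ≠ 0) {R : (V × X) →L[ℂ] (V × X)} (hR : IsSemigroupResolvent T ν R)
    {Ψ : X →L[ℂ] bX} (hΨ : ∀ y (h : (i.comp j).comp (resolventFst R) y ∈ A.domain),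
      Ψ y = B ⟨(i.comp j).comp (resolventFst R) y, h⟩)
    {c : ℝ} (hc : 0 ≤ c) (hest : ∀ w, ∫ s in (0 : ℝ)..(1 / 2),
      ‖reductionObservation (i.comp j) ν R Ψ (T s w)‖ ≤ c * ‖R w‖)
    (hsmall : ‖D‖ * (2 * c) ≤ 1 / 4) (hJ : Function.Injective (coupledEmbedding i LY)) :
    ∃ S : ℝ → (coupledSpace LY × (X × bX)) →L[ℂ] (coupledSpace LY × (X × bX)),
      IsC0Semigroup S ∧ IsSemigroupGenerator S
        (reductionMatrix (operatorMatrix A L B B') (coupledEmbedding i LY) hJ) := by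
  have : CompleteSpace (coupledSpace LY) := (isClosed_coupledSpace LY).completeSpace_coe
  obtain ⟨DY, hDY⟩ := exists_factorization hi D fun x => hAY ⟨D x, hD.mem x⟩
  have hLDY : ∀ x, LY (DY x) = x := fun x => by rw [hLY _ ⟨D x, hD.mem x⟩ (hDY x), hD.trace]
  have hLj : ∀ v, LY (j v) = 0 := fun v => (hker _).2 ⟨v, rfl⟩
  set E₀ := coupledShift LY j DY hLj hLDY
  have hE₀ : ∀ f x, coupledEmbedding i LY (E₀ (f, x)) = (i.comp j f + D x, x) := fun f x => by
    rw [coupledEmbedding_apply, coupledShift_coe, map_add, hDY]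
    rfl
  -- The weight on `∂X` shrinks the boundary part of the feedback, which does not become small with
  -- `D`; `c + 1` covers `c = 0`.
  set δ : ℝ := 1 / (8 * (c + 1))
  have hδ : 0 < δ := by positivity
  have hδc : δ * (2 * c) ≤ 1 / 4 := by
    rw [one_div_mul_eq_div, div_le_iff₀ (by positivity)]
    linarith
  set κ : ℂ := (δ : ℂ)⁻¹
  have hδ0 : (δ : ℂ) ≠ 0 := Complex.ofReal_ne_zero.2 hδ.ne'
  have hκ : κ ≠ 0 := inv_ne_zero hδ0
  have hκδX : ∀ z : X, κ • (δ : ℂ) • z = z := inv_smul_smul₀ hδ0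
  have hκδ : ∀ z : bX, κ • (δ : ℂ) • z = z := inv_smul_smul₀ hδ0
  have hδκ : ∀ z : bX, (δ : ℂ) • κ • z = z := smul_inv_smul₀ hδ0
  have hDδ : ∀ β γ, κ • D ((δ : ℂ) • β + γ) = D β + κ • D γ := fun β γ => by
    rw [map_add, map_smul, smul_add, hκδX]
  let P : bX →L[ℂ] (V × X) × (bX × bX) :=
    ((0 : bX →L[ℂ] V).prod (-D)).prod
      ((0 : bX →L[ℂ] bX).prod ((δ : ℂ) • ContinuousLinearMap.id ℂ bX))
  have hP : ∀ β, P β = ((0, -D β), (0, (δ : ℂ) • β)) := fun β => rfl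
  have hPn : ‖P‖ * (2 * c) ≤ 1 / 4 := by
    have h1 : ‖P‖ ≤ max ‖D‖ δ := by
      refine P.opNorm_le_bound (by positivity) fun β => ?_
      have h2 : ‖D β‖ ≤ max ‖D‖ δ * ‖β‖ :=
        (D.le_opNorm β).trans (by gcongr; exact le_max_left _ _)
      have h3 : δ * ‖β‖ ≤ max ‖D‖ δ * ‖β‖ := by gcongr; exact le_max_right _ _
      have h4 : 0 ≤ max ‖D‖ δ * ‖β‖ := by positivity
      rw [hP, Prod.norm_mk, Prod.norm_mk, Prod.norm_mk, norm_zero, norm_zero, norm_neg, norm_smul,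
        Complex.norm_real, Real.norm_of_nonneg hδ.le]
      exact max_le (max_le h4 h2) (max_le h4 h3)
    refine (mul_le_mul_of_nonneg_right h1 (by positivity)).trans ?_
    rcases max_choice ‖D‖ δ with h | h <;> rw [h] <;> assumption
  let pξ : (V × X) × (bX × bX) →L[ℂ] bX :=
    (ContinuousLinearMap.fst ℂ bX bX).comp (ContinuousLinearMap.snd ℂ (V × X) (bX × bX))
  let pη : (V × X) × (bX × bX) →L[ℂ] bX :=
    (ContinuousLinearMap.snd ℂ bX bX).comp (ContinuousLinearMap.snd ℂ (V × X) (bX × bX))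
  let pf : (V × X) × (bX × bX) →L[ℂ] V :=
    (ContinuousLinearMap.fst ℂ V X).comp (ContinuousLinearMap.fst ℂ (V × X) (bX × bX))
  let pg : (V × X) × (bX × bX) →L[ℂ] X :=
    (ContinuousLinearMap.snd ℂ V X).comp (ContinuousLinearMap.fst ℂ (V × X) (bX × bX))
  let Q : (V × X) × (bX × bX) →L[ℂ] (V × X) × (bX × bX) :=
    ((0 : (V × X) × (bX × bX) →L[ℂ] V).prod (κ • (l • D - D.comp (BD + B')).comp pξ)).prod
      (pη.prod ((BD + B').comp pξ))
  have hQ : ∀ f g ξ η, Q ((f, g), (ξ, η)) =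
      ((0, κ • (l • D ξ - D (BD ξ + B' ξ))), (η, BD ξ + B' ξ)) := fun _ _ _ _ => rfl
  -- The similarity: position and velocity are both shifted by the Dirichlet lift of their boundary
  -- parts, and those parts are rescaled by `κ = δ⁻¹`. In these coordinates the reduction matrix is
  -- `diag(G, 0)` plus the feedback through `P` plus `Q`.
  let Ξ₀ : (V × X) × (bX × bX) →L[ℂ] coupledSpace LY × (X × bX) :=
    (E₀.comp (pf.prod (κ • pξ))).prod ((pg + κ • D.comp pη).prod (κ • pη))
  have hΞ₀ : ∀ f g ξ η, Ξ₀ ((f, g), (ξ, η)) = (E₀ (f, κ • ξ), (g + κ • D η, κ • η)) :=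
    fun _ _ _ _ => rfl
  have hinj : Function.Injective Ξ₀ := by
    rintro ⟨⟨f, g⟩, ξ, η⟩ ⟨⟨f', g'⟩, ξ', η'⟩ h
    rw [hΞ₀, hΞ₀] at h
    simp only [Prod.mk.injEq] at h
    obtain ⟨h1, h2, h3⟩ := h
    have h4 := coupledShift_injective hLj hLDY hj h1
    simp only [Prod.mk.injEq] at h4
    obtain rfl := h4.1
    obtain rfl := smul_right_injective bX hκ h4.2
    obtain rfl := smul_right_injective bX hκ h3
    rw [add_right_cancel h2]
  have hsurj : Function.Surjective Ξ₀ := by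
    rintro ⟨v, a, b⟩
    obtain ⟨⟨f, x⟩, rfl⟩ := coupledShift_surjective hLj hLDY (fun y => (hker y).1) v
    refine ⟨((f, a - D b), ((δ : ℂ) • x, (δ : ℂ) • b)), ?_⟩
    rw [hΞ₀, hκδ, hκδ, map_smul, hκδX, sub_add_cancel]
  let Ξ := ContinuousLinearEquiv.ofBijective Ξ₀ (LinearMap.ker_eq_bot.2 hinj)
    (LinearMap.range_eq_top.2 hsurj)
  have hΞ : ∀ z, Ξ z = Ξ₀ z := fun z => rfl
  obtain ⟨S, hS, hSg⟩ := exists_coupled_perturbation hT.toIsExtendedSemigroup hR hν hc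
    (by norm_num : (0 : ℝ) < 1 / 2) hest P hPn Q
  refine ⟨conjugate Ξ S, hS.toIsC0Semigroup.conjugate Ξ, fun x y => ?_⟩
  obtain ⟨⟨⟨f, g⟩, ξ, η⟩, rfl⟩ := Ξ.surjective x
  obtain ⟨⟨⟨f', g'⟩, ξ', η'⟩, rfl⟩ := Ξ.surjective y
  refine Iff.trans ?_ ((orbitDeriv_conjugate Ξ S _ _).trans (hSg _ _)).symm
  rw [hΞ, hΞ, hΞ₀, hΞ₀, mem_graph_reductionMatrix, hE₀, hE₀, mem_graph_operatorMatrix hD]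
  -- On `(ν - G)(f, g)` the observation returns `B f`; the alternative covers pairs that are not in
  -- the graph of `G`.
  have hΛ : ∀ v₁ v₂ (h : i.comp j f ∈ (restrictKer A L).domain),
      A ⟨i.comp j f, restrictKer_domain_le A L h⟩ = v₂ →
      reductionObservation (i.comp j) ν R Ψ (ν • (f, g) - (v₁, v₂)) =
        B ⟨i.comp j f, restrictKer_domain_le A L h⟩ ∨ i.comp j v₁ ≠ g := by
    intro v₁ v₂ h hv
    by_cases hg : i.comp j v₁ = g
    · left
      have hgr : (i.comp j f, v₂) ∈ (restrictKer A L).graph := mem_graph_restrictKer.2 ⟨h, hv⟩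
      have h1 : R (ν • (f, g) - (v₁, v₂)) = (f, g) :=
        hR.left_inv _ _ ((hT.orbitDeriv_iff _ _ _ _).2 ⟨hgr, hg⟩)
      rw [hT.reductionObservation_eq hR (congrArg (fun z => i.comp j z.1) h1) hgr]
      have h2 := hT.resolventFst_apply hdom hR hgr
      rw [hΨ _ (by
        change i.comp j (resolventFst R _) ∈ _
        rw [h2]
        exact restrictKer_domain_le A L h)]
      exact congrArg B (Subtype.ext h2)
    · exact Or.inr hg
  constructor
  · rintro ⟨⟨h, h1, h2⟩, h3⟩
    simp only [Prod.mk.injEq] at h3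
    obtain ⟨h3, h4⟩ := h3
    obtain rfl := smul_right_injective bX hκ h4
    rw [map_smul, add_right_cancel_iff] at h3
    refine ⟨(f', A ⟨i.comp j f, restrictKer_domain_le A L h⟩),
      (hT.orbitDeriv_iff _ _ _ _).2 ⟨mem_graph_restrictKer.2 ⟨h, rfl⟩, h3⟩, ?_⟩
    rw [(hΛ f' _ h rfl).resolve_right (not_not.2 h3), hP, hQ]
    have h5 : η' = (δ : ℂ) • B ⟨i.comp j f, restrictKer_domain_le A L h⟩ + (BD ξ + B' ξ) := by
      rw [← hδκ η', h2, ← hBD, map_smul, map_smul, smul_add, smul_add, hδκ, hδκ, add_assoc]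
    have h6 : g' = A ⟨i.comp j f, restrictKer_domain_le A L h⟩ +
        -D (B ⟨i.comp j f, restrictKer_domain_le A L h⟩) +
        κ • (l • D ξ - D (BD ξ + B' ξ)) := by
      rw [h5, hDδ, map_smul, smul_comm l κ, ← eq_sub_iff_add_eq] at h1
      rw [h1, smul_sub]
      abel
    simp only [Prod.mk_add_mk, add_zero, zero_add, ← h5, ← h6]
  · rintro ⟨⟨v₁, v₂⟩, hv, hw⟩
    obtain ⟨hgr, hg⟩ := (hT.orbitDeriv_iff _ _ _ _).1 hv
    obtain ⟨h, h1⟩ := mem_graph_restrictKer.1 hgr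
    rw [(hΛ v₁ v₂ h h1).resolve_right (not_not.2 hg), hP, hQ] at hw
    simp only [Prod.mk_add_mk, add_zero, zero_add, Prod.mk.injEq] at hw
    obtain ⟨⟨rfl, rfl⟩, rfl, rfl⟩ := hw
    refine ⟨⟨h, ?_, ?_⟩, ?_⟩
    · rw [h1, hDδ, map_smul, smul_comm l κ, smul_sub]
      abel
    · rw [← hBD, smul_add, hκδ, map_smul, map_smul, smul_add, add_assoc]
    · rw [hg, map_smul]

/-- The coupled space is a phase space for the operator matrix with coupled domain, provided that the
reduction matrix generates a semigroup. -/
theorem isKisynskiSpace_coupled (hi : Function.Injective i)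
    (hAY : ∀ u : A.domain, ∃ y : Y, i y = u)
    (hLY : ∀ (y : Y) (u : A.domain), i y = u → LY y = L u)
    (hker : ∀ y : Y, LY y = 0 ↔ ∃ v : V, j v = y)
    (hA₀dense : Dense ((restrictKer A L).domain : Set X))
    (hphase : IsKisynskiSpace (restrictKer A L) (i.comp j))
    (hD : IsDirichletOperator A L l D)
    (hS : ∀ hJ : Function.Injective (coupledEmbedding i LY),
      ∃ S : ℝ → (coupledSpace LY × (X × bX)) →L[ℂ] (coupledSpace LY × (X × bX)),
      IsC0Semigroup S ∧ IsSemigroupGenerator S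
        (reductionMatrix (operatorMatrix A L B B') (coupledEmbedding i LY) hJ)) :
    IsKisynskiSpace (operatorMatrix A L B B') (coupledEmbedding i LY) := by
  obtain ⟨DY, hDY⟩ := exists_factorization hi D fun x => hAY ⟨D x, hD.mem x⟩
  have hLDY : ∀ x, LY (DY x) = x := fun x => by rw [hLY _ ⟨D x, hD.mem x⟩ (hDY x), hD.trace]
  have hLj : ∀ v, LY (j v) = 0 := fun v => (hker _).2 ⟨v, rfl⟩
  set E₀ := coupledShift LY j DY hLj hLDY
  have hE₀ : ∀ f x, coupledEmbedding i LY (E₀ (f, x)) = (i.comp j f + D x, x) := fun f x => by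
    rw [coupledEmbedding_apply, coupledShift_coe, map_add, hDY]
    rfl
  have hE₀s : Function.Surjective E₀ := coupledShift_surjective hLj hLDY fun y => (hker y).1
  have hJ : Function.Injective (coupledEmbedding i LY) := by
    rintro ⟨⟨y, x⟩, h⟩ ⟨⟨y', x'⟩, h'⟩ hyy
    rw [coupledEmbedding_apply, coupledEmbedding_apply] at hyy
    simp only [Prod.mk.injEq] at hyy
    obtain ⟨h1, rfl⟩ := hyy
    obtain rfl := hi h1
    rfl
  have hmem : ∀ p x, p ∈ (restrictKer A L).domain →
      (p + D x, x) ∈ (operatorMatrix A L B B').domain := fun p x hp =>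
    LinearPMap.mem_domain_of_mem_graph ((mem_graph_operatorMatrix hD).2 ⟨hp, rfl, rfl⟩)
  have hrange : ∀ u : (operatorMatrix A L B B').domain, ∃ v, coupledEmbedding i LY v = u := by
    rintro ⟨⟨q, x⟩, hq⟩
    obtain ⟨hq1, hq2⟩ := id hq
    obtain ⟨y, hy⟩ := hAY ⟨q, hq1⟩
    have hx : LY y = x := (hLY y ⟨q, hq1⟩ hy).trans hq2
    exact ⟨⟨(y, x), hx⟩, Prod.ext hy rfl⟩
  refine ⟨(isClosed_coupledSpace LY).completeSpace_coe, hJ, ?_, hrange, ?_, ?_, hS hJ⟩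
  · have hcont : Continuous fun p : X × bX => (p.1 + D p.2, p.2) := by fun_prop
    have hsurj : Function.Surjective fun p : X × bX => (p.1 + D p.2, p.2) := fun p =>
      ⟨(p.1 - D p.2, p.2), by simp⟩
    refine (hsurj.denseRange.dense_image hcont (hA₀dense.prod dense_univ)).mono ?_
    rintro _ ⟨⟨p, x⟩, ⟨hp, -⟩, rfl⟩
    exact hrange ⟨_, hmem p x hp⟩
  · obtain ⟨c, hc⟩ := hphase.domain_embedding_continuous
    -- `A₀ f = a - l D x` is recovered from the first component of the image, so the graph norm of
    -- `f` for `A₀`, and with it `‖f‖` in `V`, is controlled without estimating `B`.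
    refine ⟨‖E₀‖ * (|c| * (2 + ‖D‖ + ‖l‖ * ‖D‖) + 1), fun v u hvu => ?_⟩
    obtain ⟨⟨f, x⟩, rfl⟩ := hE₀s v
    rw [hE₀] at hvu
    obtain ⟨⟨q, x'⟩, hq⟩ := u
    obtain ⟨rfl, rfl⟩ : i.comp j f + D x = q ∧ x = x' := Prod.mk.injEq .. ▸ hvu
    have hgraph := (operatorMatrix A L B B').mem_graph ⟨_, hq⟩
    rcases hab : operatorMatrix A L B B' ⟨(i.comp j f + D x, x), hq⟩ with ⟨a, b⟩
    rw [hab] at hgraph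
    obtain ⟨hp, ha, -⟩ := (mem_graph_operatorMatrix hD).1 hgraph
    have h1 := hc f ⟨i.comp j f, hp⟩ rfl
    have h2 : restrictKer A L ⟨i.comp j f, hp⟩ = a - l • D x := by
      rw [ha, add_sub_cancel_right]
      rfl
    rw [h2] at h1
    have h3 : ‖x‖ ≤ ‖(i.comp j f + D x, x)‖ + ‖(a, b)‖ :=
      (le_max_right _ _).trans (le_add_of_nonneg_right (norm_nonneg _))
    have h4 : ‖i.comp j f‖ ≤ ‖(i.comp j f + D x, x)‖ + ‖D‖ * ‖x‖ := by
      have h5 : ‖i.comp j f + D x‖ ≤ ‖(i.comp j f + D x, x)‖ := le_max_left _ _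
      have h6 := norm_sub_le (i.comp j f + D x) (D x)
      rw [add_sub_cancel_right] at h6
      linarith [D.le_opNorm x]
    have h5 : ‖a - l • D x‖ ≤ ‖(a, b)‖ + ‖l‖ * (‖D‖ * ‖x‖) := by
      refine (norm_sub_le _ _).trans (add_le_add (le_max_left _ _) ?_)
      rw [norm_smul]
      gcongr
      exact D.le_opNorm x
    set n := ‖(i.comp j f + D x, x)‖ + ‖(a, b)‖
    have hn1 : ‖(i.comp j f + D x, x)‖ ≤ n := le_add_of_nonneg_right (norm_nonneg _)
    have hn2 : ‖(a, b)‖ ≤ n := le_add_of_nonneg_left (norm_nonneg _)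
    have hn : 0 ≤ n := by positivity
    have h6 : ‖f‖ ≤ |c| * (2 + ‖D‖ + ‖l‖ * ‖D‖) * n := by
      calc ‖f‖ ≤ |c| * (‖i.comp j f‖ + ‖a - l • D x‖) :=
            h1.trans (mul_le_mul_of_nonneg_right (le_abs_self c) (by positivity))
        _ ≤ |c| * ((n + ‖D‖ * n) + (n + ‖l‖ * (‖D‖ * n))) := by
            gcongr
            · exact h4.trans (by gcongr)
            · exact h5.trans (by gcongr)
        _ = _ := by ring
    calc ‖E₀ (f, x)‖ ≤ ‖E₀‖ * ‖(f, x)‖ := E₀.le_opNorm _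
      _ ≤ ‖E₀‖ * (|c| * (2 + ‖D‖ + ‖l‖ * ‖D‖) * n + n) := by
          gcongr
          refine max_le (h6.trans (le_add_of_nonneg_right hn)) (h3.trans ?_)
          exact le_add_of_nonneg_left (by positivity)
      _ = ‖E₀‖ * (|c| * (2 + ‖D‖ + ‖l‖ * ‖D‖) + 1) * n := by ring
  · refine (hE₀s.denseRange.dense_image E₀.continuous
      (hphase.domain_dense.prod (dense_univ (X := bX)))).mono ?_
    rintro _ ⟨⟨f, x⟩, ⟨hf, -⟩, rfl⟩
    change coupledEmbedding i LY (E₀ (f, x)) ∈ (operatorMatrix A L B B').domain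
    rw [hE₀]
    exact hmem _ x hf

end Main

end SecondOrder

end

theorem corollary5p4
    {X Y V bX : Type*}
    [NormedAddCommGroup X] [NormedSpace ℂ X] [CompleteSpace X]
    [NormedAddCommGroup Y] [NormedSpace ℂ Y] [CompleteSpace Y]
    [NormedAddCommGroup V] [NormedSpace ℂ V] [CompleteSpace V]
    [NormedAddCommGroup bX] [NormedSpace ℂ bX] [CompleteSpace bX]
    -- the continuous embeddings `V ↪ Y ↪ X`
    (i : Y →L[ℂ] X) (hi : Function.Injective i)
    (j : V →L[ℂ] Y) (hj : Function.Injective j)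
    -- the operators `A : D(A) → X`, with `D(A) ⊆ Y`, and `L : D(A) → ∂X`
    (A : X →ₗ.[ℂ] X) (hAY : ∀ u : A.domain, ∃ y : Y, i y = u)
    (L : A.domain →ₗ[ℂ] bX) (hL : Function.Surjective L)
    (hA₀closed : (SecondOrder.restrictKer A L).IsClosed)
    (hA₀dense : Dense ((SecondOrder.restrictKer A L).domain : Set X))
    (hA₀res : (SecondOrder.resolventSet (SecondOrder.restrictKer A L)).Nonempty)
    (hAL : (SecondOrder.stackedOperator A L).IsClosed)
    -- the feedback operators `B`, bounded on `D(A)` with the graph norm of `(A; L)`, and `B'`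
    (B : A.domain →ₗ[ℂ] bX)
    (hB : ∃ c : ℝ, ∀ u : A.domain, ‖B u‖ ≤ c * (‖(u : X)‖ + ‖A u‖ + ‖L u‖))
    (B' : bX →L[ℂ] bX)
    -- `L` extends to a bounded operator on `Y` with kernel `V`
    (LY : Y →L[ℂ] bX) (hLY : ∀ (y : Y) (u : A.domain), i y = u → LY y = L u)
    (hker : ∀ y : Y, LY y = 0 ↔ ∃ v : V, j v = y)
    -- `A₀` generates the cosine operator function `C₀`, with phase space `V × X`
    (C₀ : ℝ → X →L[ℂ] X) (hC₀ : SecondOrder.IsCosineFunction C₀)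
    (hgen : SecondOrder.IsCosineGenerator C₀ (SecondOrder.restrictKer A L))
    (hphase : SecondOrder.IsKisynskiSpace (SecondOrder.restrictKer A L) (i.comp j))
    -- decay of the Dirichlet operator as `|λ| → ∞`, `Re λ > 0`
    (ε : ℝ) (hε : 0 < ε)
    (hD : (fun l : ℂ => ‖SecondOrder.dirichletOperator A L l‖)
      =O[Bornology.cobounded ℂ ⊓ 𝓟 {l : ℂ | 0 < l.re}] (fun l : ℂ => ‖l‖ ^ (-ε)))
    -- the integral estimate for `B S(s, A₀)` on `D(A₀)`
    (M : ℝ) (hM : 0 < M)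
    (hR : ∀ (f : X) (hf : f ∈ (SecondOrder.restrictKer A L).domain),
      ∫ s in (0 : ℝ)..1, ‖B ⟨SecondOrder.sine C₀ s f, SecondOrder.restrictKer_domain_le A L
        (SecondOrder.sine_mem_domain hC₀ hgen s hf)⟩‖ ≤ M * ‖f‖) :
    SecondOrder.GeneratesCosineWithPhaseSpace
      (SecondOrder.operatorMatrix A L B B') (SecondOrder.coupledEmbedding i LY) := by
  have hdom := hphase.domain_le
  obtain ⟨T, hT⟩ := hphase.exists_reductionSemigroup
  obtain ⟨ν₀, hν₀, hres⟩ := hT.exists_resolvent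
  obtain ⟨R, hRν⟩ := hres (ν₀ + 1) (lt_add_one ν₀)
  -- Needed because the zero operator on the boundary factor must also have a resolvent at this
  -- point.
  have hν : ((ν₀ + 1 : ℝ) : ℂ) ≠ 0 := Complex.ofReal_ne_zero.2 (by linarith)
  obtain ⟨Ψ, hΨ⟩ := SecondOrder.exists_comp_resolvent (μ := ((ν₀ + 1 : ℝ) : ℂ) ^ 2)
    (R₀ := (i.comp j).comp (SecondOrder.resolventFst R))
    (fun y => hT.resolventFst_mem_graph hRν y) hB
  have hΨM : ∀ y, ∫ s in (0 : ℝ)..1, ‖Ψ (SecondOrder.sineOp hC₀ s y)‖ ≤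
      M * ‖(i.comp j) (SecondOrder.resolventFst R y)‖ := by
    intro y
    have hf := LinearPMap.mem_domain_of_mem_graph (hT.resolventFst_mem_graph hRν y)
    refine le_of_eq_of_le (intervalIntegral.integral_congr fun s _ => ?_)
      (hR ((i.comp j) (SecondOrder.resolventFst R y)) hf)
    -- The resolvent commutes with the sine function, so `Ψ S(s) y = B S(s) f` with `f` the
    -- resolvent of `y`, to which the assumed estimate applies.
    have h1 := SecondOrder.resolventFst_sine hT hdom hRν hC₀ hgen s y
    have h2 : (i.comp j).comp (SecondOrder.resolventFst R) (SecondOrder.sineOp hC₀ s y) =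
      SecondOrder.sine C₀ s ((i.comp j) (SecondOrder.resolventFst R y)) := h1
    have hmem := SecondOrder.restrictKer_domain_le A L
      (SecondOrder.sine_mem_domain hC₀ hgen s hf)
    have h3 := hΨ (SecondOrder.sineOp hC₀ s y) (h2 ▸ hmem)
    exact congrArg norm (h3.trans (congrArg B (Subtype.ext h2)))
  obtain ⟨c, hc, hest⟩ := hT.integral_norm_reductionObservation_le hdom hA₀dense
    hphase.domain_dense hRν hC₀ hgen hM.le hΨM
  -- The constant `c` was fixed using the resolvent at `ν₀ + 1`, so choosing `μ` in terms of `c` is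
  -- not circular. `μ > ν₀` places `μ²` in the resolvent set of `A₀`.
  obtain ⟨μ, hμ, hDμ⟩ := SecondOrder.exists_sq_norm_le hε hD ν₀
    (by positivity : 0 < 1 / (8 * (c + 1)))
  obtain ⟨R', hR'⟩ := hres μ hμ
  have hDir := SecondOrder.dirichletOperator_spec A L hL hAL (hT.sq_mem_resolventSet hdom hR')
  rw [norm_norm] at hDμ
  have hsmall : ‖SecondOrder.dirichletOperator A L ((μ : ℂ) ^ 2)‖ * (2 * c) ≤ 1 / 4 := by
    refine (mul_le_mul_of_nonneg_right hDμ (by positivity)).trans ?_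
    rw [one_div_mul_eq_div, div_le_iff₀ (by positivity)]
    linarith
  obtain ⟨BD, hBD⟩ := SecondOrder.exists_comp_dirichlet hDir hB
  exact (SecondOrder.isKisynskiSpace_coupled hi hAY hLY hker hA₀dense hphase hDir fun hJ =>
    SecondOrder.exists_coupled_semigroup hi hj hAY hLY hker hDir hBD hT hdom hν hRν hΨ hc hest
      hsmall hJ).generatesCosine
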